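/- Write $(x)_n=x(x+1)\cdots(x+n-1)$, $H_n=\sum_{j=1}^n 1/j$, and $$a_n=\Big(\frac{16}{27}\Big)^n\frac{(1/4)_n(1/3)_n(2/3)_n(3/4)_n}{(1/2)_n(1)_n^3}.$$ (i) The following three series converge (absolutely), with the stated sums: $$\sum_{n\ge0}a_n\,\frac{66n^2+37n+4}{2n+1}=\frac{27\sqrt3}{2\pi},$$ $$\sum_{n\ge0}a_n\,\frac{(66n^2+37n+4)(-3H_n-H_{2n}+2H_{4n})+60n+26}{2n+1}=\frac{81\sqrt3\,\log 3}{2\pi},$$ $$\sum_{n\ge0}a_n\,\frac{(66n^2+37n+4)(3H_n-2H_{2n}+3H_{3n})-\frac{108n^2+92n+23}{2n+1}}{2n+1}=0.$$ (ii) For complex $a,b,c,d$ and integers $n,k\ge0$ put $$F(n,k)=\frac{4^n\,\Gamma(a+k+\frac23)\,\Gamma(a+d+k+\frac13)\,\Gamma(c+2k-3n+1)\,\Gamma(2a-2b-c+n+\frac43)\,(-2a+b-d-2k+n-1)\,\Gamma(2a-b-c+d+2n+\frac12)}{\Gamma(b+n)\,\Gamma(a-b+k-n+\frac53)\,\Gamma(-2a+2b+c-2d-n+\frac13)\,\Gamma(2a-2b-c+d+n+\frac12)\,\Gamma(a-b+d+k-n+\frac43)\,\Gamma(4a-2b-c+2d+2k+n+2)},$$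 where $1/\Gamma$ is understood as an entire function. There is a neighbourhood of the origin in $\mathbb C^4$ such that for all $(a,b,c,d)$ in it with $c\ne0$ the series $\sum_{k\ge0}F(n,k)$ converges absolutely for every $n\ge 0$ and $$\lim_{n\to\infty}\sum_{k\ge0}F(n,k)=4^{-b}\csc(\pi c)\,\sin\!\big(\pi(-2a+2b+c-2d+\tfrac13)\big).$$ (iii) There is a neighbourhood of the origin in $\mathbb C^4$ such that for all $(a,b,c,d)$ in it both series below converge absolutely and $$bc(-6a+6b+3c-1)\sum_{k\ge0}\frac{(a+\frac23)_k\,(c+1)_{2k}\,(2a-b+d+2k+1)\,(a+d+\frac13)_k}{(a-b+\frac23)_{k+1}\,(4a-2b-c+2d+2k+1)\,(a-b+d+\frac13)_{k+1}\,(4a-2b-c+2d+1)_{2k}}$$ $$=\frac{3\cdot4^{-b}\,\Gamma(b+1)\Gamma(1-c)\Gamma(a-b+\frac23)\Gamma(a-b+d+\frac13)\Gamma(2a-2b-c+d+\frac12)\Gamma(4a-2b-c+2d+1)}{\Gamma(a+\frac23)\Gamma(a+d+\frac13)\Gamma(2a-2b-c+\frac13)\Gamma(2a-b-c+d+\frac12)\Gamma(2a-2b-c+2d+\frac23)}$$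 $$+\sum_{n\ge0}\frac{4^n(6a-6b-3c+3n+1)\,P(a,b,c,d,n)\,(-a+b+\frac13)_n(2a-2b-c+\frac13)_n(-a+b-d+\frac23)_n(2a-b-c+d+\frac12)_{2n}(2a-2b-c+2d+\frac23)_n}{9\,(b+1)_n(1-c)_{3n+2}(-4a+4b+2c-2d-2n-1)(2a-2b-c+d+\frac12)_n(4a-2b-c+2d+1)_n},$$ where $$\begin{aligned}P={}&198n^3+243n^2+86n+8+90dn^2+150dn+40d+36d^2n+48d^2\\ &-198cn^2-180cn-34c-144cdn-102cd-36cd^2+90c^2n+45c^2+54c^2d-18c^3\\ &-54bn-16b-252bdn-156bd-72bd^2+144bcn+90bc+180bcd-72bc^2\\ &+216b^2n+108b^2+144b^2d-144b^2c-72b^3\\ &+180an^2+252an+68a+288adn+204ad+72ad^2-288acn-180ac-216acd+108ac^2\\ &-504abn-288ab-360abd+360abc+288ab^2\\ &+288a^2n+180a^2+216a^2d-216a^2c-360a^2b+144a^3.\end{aligned}$$ -/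

import Mathlib

noncomputable section

namespace SunSeries

/-- The Pochhammer symbol `(x)_n = x (x+1) ⋯ (x+n-1)`. -/
def poch {R : Type*} [CommRing R] (x : R) (n : ℕ) : R := (ascPochhammer R n).eval x

/-- The hypergeometric factor
`a_n = (16/27)^n (1/4)_n (1/3)_n (2/3)_n (3/4)_n / ((1/2)_n (1)_n^3)`. -/
def coeff (n : ℕ) : ℝ :=
  (16 / 27 : ℝ) ^ n *
    (poch (1 / 4 : ℝ) n * poch (1 / 3 : ℝ) n * poch (2 / 3 : ℝ) n * poch (3 / 4 : ℝ) n) /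
    (poch (1 / 2 : ℝ) n * poch (1 : ℝ) n ^ 3)

/-- The polynomial `66 n² + 37 n + 4`. -/
def quad (n : ℕ) : ℝ := 66 * (n : ℝ) ^ 2 + 37 * n + 4

/-- The harmonic number `H_n` as a real number. -/
def harm (n : ℕ) : ℝ := ((harmonic n : ℚ) : ℝ)

/-- The summand `F(n,k)` with parameters `a, b, c, d`. Mathlib's `Gamma` takes the value `0` at
the poles and `x / 0 = 0`, so a factor `Γ` in the denominator is read through the entire function
`1/Γ`; the factors `Γ` of the numerator have no pole for small `a, b, c, d` with `c ≠ 0`. -/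
def F (a b c d : ℂ) (n k : ℕ) : ℂ :=
  (4 ^ n * Complex.Gamma (a + k + 2 / 3) * Complex.Gamma (a + d + k + 1 / 3) *
      Complex.Gamma (c + 2 * k - 3 * n + 1) *
      Complex.Gamma (2 * a - 2 * b - c + n + 4 / 3) *
      (-2 * a + b - d - 2 * k + n - 1) *
      Complex.Gamma (2 * a - b - c + d + 2 * n + 1 / 2)) /
    (Complex.Gamma (b + n) * Complex.Gamma (a - b + k - n + 5 / 3) *
      Complex.Gamma (-2 * a + 2 * b + c - 2 * d - n + 1 / 3) *
      Complex.Gamma (2 * a - 2 * b - c + d + n + 1 / 2) *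
      Complex.Gamma (a - b + d + k - n + 4 / 3) *
      Complex.Gamma (4 * a - 2 * b - c + 2 * d + 2 * k + n + 2))

/-- The value of the limit of `∑_k F(n,k)` as `n → ∞`. -/
def boundaryLimit (a b c d : ℂ) : ℂ :=
  (4 : ℂ) ^ (-b) * (Complex.sin (Real.pi * c))⁻¹ *
    Complex.sin (Real.pi * (-2 * a + 2 * b + c - 2 * d + 1 / 3))

/-- The polynomial `P` with integer coefficients; `P(0,0,0,0,n) = (3n+2)(66n²+37n+4)`. -/
def P (a b c d n : ℂ) : ℂ :=
  198 * n ^ 3 + 243 * n ^ 2 + 86 * n + 8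
    + 90 * d * n ^ 2 + 150 * d * n + 40 * d + 36 * d ^ 2 * n + 48 * d ^ 2
    - 198 * c * n ^ 2 - 180 * c * n - 34 * c - 144 * c * d * n - 102 * c * d - 36 * c * d ^ 2
    + 90 * c ^ 2 * n + 45 * c ^ 2 + 54 * c ^ 2 * d - 18 * c ^ 3
    - 54 * b * n - 16 * b - 252 * b * d * n - 156 * b * d - 72 * b * d ^ 2
    + 144 * b * c * n + 90 * b * c + 180 * b * c * d - 72 * b * c ^ 2
    + 216 * b ^ 2 * n + 108 * b ^ 2 + 144 * b ^ 2 * d - 144 * b ^ 2 * c - 72 * b ^ 3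
    + 180 * a * n ^ 2 + 252 * a * n + 68 * a + 288 * a * d * n + 204 * a * d + 72 * a * d ^ 2
    - 288 * a * c * n - 180 * a * c - 216 * a * c * d + 108 * a * c ^ 2
    - 504 * a * b * n - 288 * a * b - 360 * a * b * d + 360 * a * b * c + 288 * a * b ^ 2
    + 288 * a ^ 2 * n + 180 * a ^ 2 + 216 * a ^ 2 * d - 216 * a ^ 2 * c - 360 * a ^ 2 * b
    + 144 * a ^ 3

/-- The summand over `k` of the left side of the four-parameter identity. -/
def lhsTerm (a b c d : ℂ) (k : ℕ) : ℂ :=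
  (poch (a + 2 / 3) k * poch (c + 1) (2 * k) * (2 * a - b + d + 2 * k + 1) *
      poch (a + d + 1 / 3) k) /
    (poch (a - b + 2 / 3) (k + 1) * (4 * a - 2 * b - c + 2 * d + 2 * k + 1) *
      poch (a - b + d + 1 / 3) (k + 1) * poch (4 * a - 2 * b - c + 2 * d + 1) (2 * k))

/-- The Gamma product on the right side of the four-parameter identity. -/
def gammaTerm (a b c d : ℂ) : ℂ :=
  (3 * (4 : ℂ) ^ (-b) * Complex.Gamma (b + 1) * Complex.Gamma (1 - c) *
      Complex.Gamma (a - b + 2 / 3) * Complex.Gamma (a - b + d + 1 / 3) *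
      Complex.Gamma (2 * a - 2 * b - c + d + 1 / 2) *
      Complex.Gamma (4 * a - 2 * b - c + 2 * d + 1)) /
    (Complex.Gamma (a + 2 / 3) * Complex.Gamma (a + d + 1 / 3) *
      Complex.Gamma (2 * a - 2 * b - c + 1 / 3) *
      Complex.Gamma (2 * a - b - c + d + 1 / 2) *
      Complex.Gamma (2 * a - 2 * b - c + 2 * d + 2 / 3))

/-- The summand over `n` of the right side of the four-parameter identity. -/
def rhsTerm (a b c d : ℂ) (n : ℕ) : ℂ :=
  (4 ^ n * (6 * a - 6 * b - 3 * c + 3 * n + 1) * P a b c d n * poch (-a + b + 1 / 3) n *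
      poch (2 * a - 2 * b - c + 1 / 3) n * poch (-a + b - d + 2 / 3) n *
      poch (2 * a - b - c + d + 1 / 2) (2 * n) * poch (2 * a - 2 * b - c + 2 * d + 2 / 3) n) /
    (9 * poch (b + 1) n * poch (1 - c) (3 * n + 2) *
      (-4 * a + 4 * b + 2 * c - 2 * d - 2 * n - 1) *
      poch (2 * a - 2 * b - c + d + 1 / 2) n * poch (4 * a - 2 * b - c + 2 * d + 1) n)

end SunSeries

end

namespace SunSeries

open Filter Topology

noncomputable section

/-! The engine is a Wilf–Zeilberger pair. Raising `n` by one in `F` shifts `(b, c)` to `(b + 1, c -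
3)`, and raising `k` shifts `(a, c)` to `(a + 1, c + 2)`. There is a companion `G`, namely
`mateTerm`, with `F(n,k) - F(n+1,k) = G(n,k) - G(n,k+1)` (`F_sub_F_succ`). As `G(n,k)` tends to zero
in `k`, summing over `k` gives `∑ₖ F(n,k) - ∑ₖ F(n+1,k) = G(n,0)`, and summing over `n` gives `∑ₖ
F(0,k) = lim ∑ₖ F(n,k) + ∑ₙ G(n,0)`. Dividing by the constant `scale` turns this into the
four-parameter identity for `c ≠ 0`. At `c = 0` it follows by continuity, since the left side is `c`
times a bounded quantity.

The limit is the analytic core. By reflection and the duplication formula, `F(n,k)` is compared with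
explicit weights `wt n j` at `j = 2(k - n)`. A Beta integral shows that they sum to `1` over all `j`
and that their alternating sum tends to zero, so the even `j` carry half of the mass
(`tendsto_sum_wt_even`). The ratio of consecutive weights shows concentration at `j ≈ (√2 - 1)n`,
that is `k ≈ (1 + √2)n/2` (`wt_le_of_abs_gt`). There the quotient of `F` by the weight tends to
twice the asserted limit (`tendsto_F_mul_inv_wt`). Elsewhere the contribution is negligible, by
bounds up to polynomial factors on `k < n`, `n ≤ k ≤ 3n/2` and `k ≥ 3n/2` (`polyLE_F_lower`,
`polyLE_F_middle`, `polyLE_F_upper`).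

The three numerical series are the identity at the origin and its first derivatives there along
`(a,b,c,d) = (1,1,0,0)t` and `(-2,-1,-3,0)t`. The left side carries the factor `bc` and so is of
second order along such lines. Logarithmic derivatives of Pochhammer symbols produce the harmonic
numbers, and those of the Gamma product produce digamma values. The latter reduce to `3 log 3`, by
triplication, and to `0`. Bounds on the summands that are uniform in the parameters justify termwise
differentiation. -/

/-! ### The Wilf–Zeilberger equation -/

/-- The summand `F` at `n = k = 0`; the general one arises by shifting the parameters. -/
def kernel (a b c d : ℂ) : ℂ :=
  (Complex.Gamma (a + 2 / 3) * Complex.Gamma (a + d + 1 / 3) * Complex.Gamma (c + 1) *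
      Complex.Gamma (2 * a - 2 * b - c + 4 / 3) * (-2 * a + b - d - 1) *
      Complex.Gamma (2 * a - b - c + d + 1 / 2)) *
    ((Complex.Gamma b)⁻¹ * (Complex.Gamma (a - b + 5 / 3))⁻¹ *
      (Complex.Gamma (-2 * a + 2 * b + c - 2 * d + 1 / 3))⁻¹ *
      (Complex.Gamma (2 * a - 2 * b - c + d + 1 / 2))⁻¹ *
      (Complex.Gamma (a - b + d + 4 / 3))⁻¹ *
      (Complex.Gamma (4 * a - 2 * b - c + 2 * d + 2))⁻¹)

/-- The companion of `kernel` in the Wilf–Zeilberger pair. -/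
def mate (a b c d : ℂ) : ℂ :=
  -P a b c d 0 / 18 *
    (Complex.Gamma (a + 2 / 3) * Complex.Gamma (a + d + 1 / 3) * Complex.Gamma (c - 2) *
      Complex.Gamma (2 * a - 2 * b - c + 4 / 3) *
      Complex.Gamma (2 * a - b - c + d + 1 / 2)) *
    ((Complex.Gamma (b + 1))⁻¹ * (Complex.Gamma (a - b + 2 / 3))⁻¹ *
      (Complex.Gamma (-2 * a + 2 * b + c - 2 * d + 1 / 3))⁻¹ *
      (Complex.Gamma (2 * a - 2 * b - c + d + 3 / 2))⁻¹ *
      (Complex.Gamma (a - b + d + 1 / 3))⁻¹ *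
      (Complex.Gamma (4 * a - 2 * b - c + 2 * d + 1))⁻¹)

/-- Since `1/Γ` is entire and the value `0` of `Gamma` at its poles inverts to `0`, no condition on
`x` is needed, in contrast to `Gamma_eq`. -/
theorem inv_Gamma_eq (x y : ℂ) (h : y = x + 1) :
    (Complex.Gamma x)⁻¹ = x * (Complex.Gamma y)⁻¹ := by
  rw [h]; exact Complex.one_div_Gamma_eq_self_mul_one_div_Gamma_add_one x

theorem Gamma_eq (x y : ℂ) (h : y = x + 1) (hx : x ≠ 0) :
    Complex.Gamma y = x * Complex.Gamma x := by
  rw [h, Complex.Gamma_add_one x hx]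

/-- The recurrence of `Γ` writes all four terms as polynomials times one common product of eleven
Gamma values and reciprocals, which leaves a polynomial identity. The factor `4` comes from `4 ^ n`.
Only the Gamma factors in numerators require nonvanishing hypotheses. -/
theorem kernel_sub_kernel_shift (a b c d : ℂ) (h1 : a + 2 / 3 ≠ 0) (h2 : a + d + 1 / 3 ≠ 0)
    (h3 : c - 2 ≠ 0) (h4 : c - 1 ≠ 0) (h5 : c ≠ 0) (h6 : 2 * a - 2 * b - c + 4 / 3 ≠ 0)
    (h7 : 2 * a - b - c + d + 1 / 2 ≠ 0) (h8 : 2 * a - b - c + d + 3 / 2 ≠ 0) :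
    kernel a b c d - 4 * kernel a (b + 1) (c - 3) d =
      mate a b c d - mate (a + 1) b (c + 2) d := by
  unfold kernel mate
  rw [Gamma_eq (a + 2 / 3) (a + 1 + 2 / 3) (by ring) h1,
    Gamma_eq (a + d + 1 / 3) (a + 1 + d + 1 / 3) (by ring) h2,
    show c - 3 + 1 = c - 2 by ring, show c + 2 - 2 = c by ring,
    Gamma_eq c (c + 1) rfl h5, Gamma_eq (c - 1) c (by ring) h4,
    Gamma_eq (c - 2) (c - 1) (by ring) h3,
    Gamma_eq (2 * a - 2 * b - c + 4 / 3) (2 * a - 2 * (b + 1) - (c - 3) + 4 / 3) (by ring) h6,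
    show 2 * (a + 1) - 2 * b - (c + 2) + 4 / 3 = 2 * a - 2 * b - c + 4 / 3 by ring,
    Gamma_eq (2 * a - b - c + d + 3 / 2) (2 * a - (b + 1) - (c - 3) + d + 1 / 2) (by ring) h8,
    Gamma_eq (2 * a - b - c + d + 1 / 2) (2 * a - b - c + d + 3 / 2) (by ring) h7,
    show 2 * (a + 1) - b - (c + 2) + d + 1 / 2 = 2 * a - b - c + d + 1 / 2 by ring,
    inv_Gamma_eq b (b + 1) rfl,
    show a - (b + 1) + 5 / 3 = a - b + 2 / 3 by ring,
    inv_Gamma_eq (a - b + 2 / 3) (a - b + 5 / 3) (by ring),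
    show a + 1 - b + 2 / 3 = a - b + 5 / 3 by ring,
    inv_Gamma_eq (-2 * a + 2 * (b + 1) + (c - 3) - 2 * d + 1 / 3)
      (-2 * a + 2 * b + c - 2 * d + 1 / 3) (by ring),
    show -2 * (a + 1) + 2 * b + (c + 2) - 2 * d + 1 / 3 = -2 * a + 2 * b + c - 2 * d + 1 / 3 by ring,
    inv_Gamma_eq (2 * a - 2 * b - c + d + 1 / 2) (2 * a - 2 * b - c + d + 3 / 2) (by ring),
    show 2 * a - 2 * (b + 1) - (c - 3) + d + 1 / 2 = 2 * a - 2 * b - c + d + 3 / 2 by ring,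
    show 2 * (a + 1) - 2 * b - (c + 2) + d + 3 / 2 = 2 * a - 2 * b - c + d + 3 / 2 by ring,
    show a - (b + 1) + d + 4 / 3 = a - b + d + 1 / 3 by ring,
    inv_Gamma_eq (a - b + d + 1 / 3) (a - b + d + 4 / 3) (by ring),
    show a + 1 - b + d + 1 / 3 = a - b + d + 4 / 3 by ring,
    show 4 * a - 2 * (b + 1) - (c - 3) + 2 * d + 2 = 4 * a - 2 * b - c + 2 * d + 3 by ring,
    show 4 * (a + 1) - 2 * b - (c + 2) + 2 * d + 1 = 4 * a - 2 * b - c + 2 * d + 3 by ring,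
    inv_Gamma_eq (4 * a - 2 * b - c + 2 * d + 1) (4 * a - 2 * b - c + 2 * d + 2) (by ring),
    inv_Gamma_eq (4 * a - 2 * b - c + 2 * d + 2) (4 * a - 2 * b - c + 2 * d + 3) (by ring)]
  generalize Complex.Gamma (a + 2 / 3) = g1
  generalize Complex.Gamma (a + d + 1 / 3) = g2
  generalize Complex.Gamma (c - 2) = g3
  generalize Complex.Gamma (2 * a - 2 * b - c + 4 / 3) = g4
  generalize Complex.Gamma (2 * a - b - c + d + 1 / 2) = g5
  generalize (Complex.Gamma (b + 1))⁻¹ = g6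
  generalize (Complex.Gamma (a - b + 5 / 3))⁻¹ = g7
  generalize (Complex.Gamma (-2 * a + 2 * b + c - 2 * d + 1 / 3))⁻¹ = g8
  generalize (Complex.Gamma (2 * a - 2 * b - c + d + 3 / 2))⁻¹ = g9
  generalize (Complex.Gamma (a - b + d + 4 / 3))⁻¹ = g10
  generalize (Complex.Gamma (4 * a - 2 * b - c + 2 * d + 3))⁻¹ = g11
  unfold P
  -- The intermediate expression is the `kernel` side with the common product pulled out; the
  -- polynomial `P` enters only in the second `ring`.
  trans (g1 * g2 * g3 * g4 * g5 * g6 * g7 * g8 * g9 * g10 * g11) *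
    ((c * (c - 1) * (c - 2) * (-2 * a + b - d - 1) * b * (2 * a - 2 * b - c + d + 1 / 2) *
        (4 * a - 2 * b - c + 2 * d + 2)
      - 4 * ((2 * a - 2 * b - c + 4 / 3) * (-2 * a + (b + 1) - d - 1) *
        (2 * a - b - c + d + 3 / 2) * (2 * a - b - c + d + 1 / 2) * (a - b + 2 / 3) *
        (-2 * a + 2 * (b + 1) + (c - 3) - 2 * d + 1 / 3) * (a - b + d + 1 / 3))))
  · ring
  · ring

theorem F_eq_kernel (a b c d : ℂ) (n k : ℕ) :
    F a b c d n k = 4 ^ n * kernel (a + k) (b + n) (c + 2 * k - 3 * n) d := by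
  unfold F kernel
  rw [div_eq_mul_inv]
  simp only [mul_inv]
  rw [show a + k + d + 1 / 3 = a + d + k + 1 / 3 by ring,
    show 2 * (a + k) - 2 * (b + n) - (c + 2 * k - 3 * n) + 4 / 3 = 2 * a - 2 * b - c + n + 4 / 3 by ring,
    show 2 * (a + k) - (b + n) - (c + 2 * k - 3 * n) + d + 1 / 2 = 2 * a - b - c + d + 2 * n + 1 / 2 by ring,
    show a + k - (b + n) + 5 / 3 = a - b + k - n + 5 / 3 by ring,
    show -2 * (a + k) + 2 * (b + n) + (c + 2 * k - 3 * n) - 2 * d + 1 / 3 = -2 * a + 2 * b + c - 2 * d - n + 1 / 3 by ring,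
    show 2 * (a + k) - 2 * (b + n) - (c + 2 * k - 3 * n) + d + 1 / 2 = 2 * a - 2 * b - c + d + n + 1 / 2 by ring,
    show a + k - (b + n) + d + 4 / 3 = a - b + d + k - n + 4 / 3 by ring,
    show 4 * (a + k) - 2 * (b + n) - (c + 2 * k - 3 * n) + 2 * d + 2 = 4 * a - 2 * b - c + 2 * d + 2 * k + n + 2 by ring]
  ring

/-! ### Asymptotics and bounds for `Γ(z + m)` -/

theorem tendsto_natCast_add_div (x y : ℂ) :
    Tendsto (fun m : ℕ => ((m : ℂ) + x) / (m + y)) atTop (𝓝 1) := by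
  have h0 (w : ℂ) : Tendsto (fun m : ℕ => 1 + w / (m : ℂ)) atTop (𝓝 (1 + 0)) :=
    tendsto_const_nhds.add (tendsto_const_div_atTop_nhds_zero_nat w)
  have := (h0 x).div (h0 y) (by simp)
  simp only [add_zero, div_one] at this
  refine this.congr' ?_
  filter_upwards [eventually_gt_atTop 0] with m hm
  have : (m : ℂ) ≠ 0 := by exact_mod_cast hm.ne'
  simp only [Pi.div_apply]
  rw [← mul_div_mul_left _ _ this, mul_add, mul_add, mul_div_cancel₀ _ this,
    mul_div_cancel₀ _ this, mul_one]

theorem Gamma_add_natCast (z : ℂ) (hz : ∀ k : ℕ, z ≠ -k) (n : ℕ) :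
    Complex.Gamma (z + n) = Complex.Gamma z * poch z n := by
  rw [poch, ← Complex.Gamma_add_nat_div_Gamma_eq z hz, mul_div_cancel₀ _ (Complex.Gamma_ne_zero hz)]

theorem poch_eq_prod {R : Type*} [CommRing R] (x : R) (n : ℕ) :
    poch x n = ∏ j ∈ Finset.range n, (x + j) := by
  unfold poch
  induction n with
  | zero => simp
  | succ n ih => rw [ascPochhammer_succ_eval, ih, Finset.prod_range_succ]

theorem poch_succ {R : Type*} [CommRing R] (x : R) (n : ℕ) :
    poch x (n + 1) = poch x n * (x + n) := by
  rw [poch_eq_prod, poch_eq_prod, Finset.prod_range_succ]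

/-- This is Euler's limit for `Γ(z)` at index `m + 1`, corrected by two factors tending to `1`. The
base `m + 1`, rather than `m`, keeps the comparison function nonzero at `m = 0`, so that convergence
later yields bounds valid for every `m`. -/
theorem tendsto_Gamma_add_natCast_of_re_pos (z : ℂ) (hz : 0 < z.re) :
    Tendsto (fun m : ℕ => Complex.Gamma (z + m) / (m.factorial * ((m : ℂ) + 1) ^ (z - 1)))
      atTop (𝓝 1) := by
  have hz' : ∀ k : ℕ, z ≠ -k := by
    rintro k rfl
    simp at hz
    linarith [(Nat.cast_nonneg k : (0 : ℝ) ≤ k)]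
  have hG := Complex.Gamma_ne_zero hz'
  have hadd : ∀ k : ℕ, z + k ≠ 0 := fun k h => hz' k (eq_neg_of_add_eq_zero_left h)
  have h1 := (Complex.GammaSeq_tendsto_Gamma z).comp (tendsto_add_atTop_nat 1)
  have h2 := (((tendsto_const_nhds (x := Complex.Gamma z)).div h1 hG).mul (tendsto_natCast_add_div 1 z)).mul
    (tendsto_natCast_add_div 1 (z + 1))
  rw [div_self hG, one_mul, one_mul] at h2
  refine h2.congr fun m => ?_
  have hm : (m : ℂ) + 1 ≠ 0 := by exact_mod_cast m.succ_ne_zero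
  have e1 : (m : ℂ) + z ≠ 0 := by rw [add_comm]; exact hadd m
  have e2 : (m : ℂ) + (z + 1) ≠ 0 := by
    have := hadd (m + 1); push_cast at this; convert this using 1; ring
  have hp : poch z m ≠ 0 := by
    rw [poch_eq_prod]; exact Finset.prod_ne_zero_iff.mpr fun j _ => hadd j
  have hc : ((m : ℂ) + 1) ^ (z - 1) ≠ 0 := by rw [Complex.cpow_ne_zero_iff]; simp [hm]
  have hf : (m.factorial : ℂ) ≠ 0 := by exact_mod_cast m.factorial_ne_zero
  have hcp : ((m : ℂ) + 1) ^ z = ((m : ℂ) + 1) ^ (z - 1) * (m + 1) := by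
    conv_lhs => rw [show z = (z - 1) + 1 by ring, Complex.cpow_add _ _ hm, Complex.cpow_one]
  simp only [Function.comp, Complex.GammaSeq, Pi.div_apply]
  rw [Gamma_add_natCast z hz', Finset.prod_range_succ, Finset.prod_range_succ, ← poch_eq_prod,
    Nat.factorial_succ]
  push_cast
  rw [hcp]
  rw [show z + (m : ℂ) = m + z by ring, show z + ((m : ℂ) + 1) = m + (z + 1) by ring]
  field_simp

/-- `Γ(z + m) ∼ m! (m+1)^(z-1)` for every complex `z`. -/
theorem tendsto_Gamma_add_natCast (z : ℂ) :
    Tendsto (fun m : ℕ => Complex.Gamma (z + m) / (m.factorial * ((m : ℂ) + 1) ^ (z - 1)))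
      atTop (𝓝 1) := by
  -- Induction on a bound for `-Re z`: each step trades `z` for `z + 1` through `Γ(z + 1 + m) = (z +
  -- m) Γ(z + m)`.
  obtain ⟨N, hN⟩ := exists_nat_gt (-z.re)
  induction N generalizing z with
  | zero => exact tendsto_Gamma_add_natCast_of_re_pos z (by simpa using hN)
  | succ N ih =>
    have h := ((ih (z + 1) (by push_cast at hN; simp; linarith)).mul (tendsto_natCast_add_div 1 z))
    rw [one_mul] at h
    refine h.congr' ?_
    obtain ⟨K, hK⟩ := exists_nat_gt ‖z‖
    filter_upwards [eventually_ge_atTop K] with m hmK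
    have hne : z + m ≠ 0 := by
      intro h0
      have : ‖z‖ = m := by rw [eq_neg_of_add_eq_zero_left h0]; simp
      have : (K : ℝ) ≤ m := by exact_mod_cast hmK
      linarith
    have hm : (m : ℂ) + 1 ≠ 0 := by exact_mod_cast m.succ_ne_zero
    have hc : ((m : ℂ) + 1) ^ (z - 1) ≠ 0 := by rw [Complex.cpow_ne_zero_iff]; simp [hm]
    have hf : (m.factorial : ℂ) ≠ 0 := by exact_mod_cast m.factorial_ne_zero
    rw [show z + 1 + (m : ℂ) = z + m + 1 by ring, Complex.Gamma_add_one _ hne,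
      show z + 1 - 1 = (z - 1) + 1 by ring, Complex.cpow_add _ _ hm, Complex.cpow_one,
      show (m : ℂ) + z = z + m by ring]
    field_simp

/-- The asymptotics of `Γ(z + m)` along a filter on which `m / n` has a positive limit. -/
theorem tendsto_Gamma_add_div_pow {α : Type*} {l : Filter α} {m n : α → ℕ} {μ : ℝ} (hμ : 0 < μ)
    (hn : Tendsto n l atTop) (hm : Tendsto (fun p => (m p : ℝ) / n p) l (𝓝 μ)) (z : ℂ) :
    Tendsto (fun p => Complex.Gamma (z + m p) / ((m p).factorial * (n p : ℂ) ^ (z - 1))) l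
      (𝓝 ((μ : ℂ) ^ (z - 1))) := by
  have hnR : Tendsto (fun p => (n p : ℝ)) l atTop := tendsto_natCast_atTop_atTop.comp hn
  have hmtop : Tendsto m l atTop := by
    rw [← tendsto_natCast_atTop_iff (R := ℝ)]
    have := hnR.atTop_mul_pos hμ hm
    refine this.congr' ?_
    filter_upwards [hn.eventually_gt_atTop 0] with p hp
    have : (n p : ℝ) ≠ 0 := by exact_mod_cast hp.ne'
    field_simp
  have h1 : Tendsto (fun p => ((m p : ℝ) + 1) / n p) l (𝓝 μ) := by
    have := hm.add hnR.inv_tendsto_atTop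
    rw [add_zero] at this
    refine this.congr fun p => ?_
    simp only [Pi.inv_apply, add_div, one_div]
  have h2 : Tendsto (fun p => (((((m p : ℝ) + 1) / n p : ℝ) : ℂ)) ^ (z - 1)) l
      (𝓝 ((μ : ℂ) ^ (z - 1))) := by
    have hc : ContinuousAt (fun x : ℂ => x ^ (z - 1)) (μ : ℂ) :=
      continuousAt_cpow_const (Or.inl (by simpa using hμ))
    exact hc.tendsto.comp ((Complex.continuous_ofReal.tendsto μ).comp h1)
  have h3 := ((tendsto_Gamma_add_natCast z).comp hmtop).mul h2
  rw [one_mul] at h3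
  refine h3.congr' ?_
  filter_upwards [hn.eventually_gt_atTop 0] with p hp
  have hnp : (n p : ℂ) ≠ 0 := by exact_mod_cast hp.ne'
  have hmp : (m p : ℂ) + 1 ≠ 0 := by exact_mod_cast (m p).succ_ne_zero
  have e : ((m p : ℂ) + 1) ^ (z - 1) =
      (((((m p : ℝ) + 1) / n p : ℝ) : ℂ)) ^ (z - 1) * (n p : ℂ) ^ (z - 1) := by
    have := Complex.mul_cpow_ofReal_nonneg (a := ((m p : ℝ) + 1) / n p) (b := n p)
      (by positivity) (by positivity) (z - 1)
    rw [Complex.ofReal_natCast] at this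
    rw [← this]
    congr 1
    push_cast
    field_simp
  have c1 : (n p : ℂ) ^ (z - 1) ≠ 0 := by rw [Complex.cpow_ne_zero_iff]; simp [hnp]
  have c2 : (((((m p : ℝ) + 1) / n p : ℝ) : ℂ)) ^ (z - 1) ≠ 0 := by
    rw [Complex.cpow_ne_zero_iff]
    left
    rw [Complex.ofReal_ne_zero]
    have : (0 : ℝ) < n p := by exact_mod_cast hp
    positivity
  have hf : ((m p).factorial : ℂ) ≠ 0 := by exact_mod_cast (m p).factorial_ne_zero
  simp only [Function.comp]
  rw [e]
  field_simp

theorem exists_norm_le_of_tendsto {E : Type*} [NormedAddCommGroup E] {f : ℕ → E} {x : E}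
    (h : Tendsto f atTop (𝓝 x)) : ∃ C : ℝ, 0 < C ∧ ∀ m, ‖f m‖ ≤ C := by
  obtain ⟨C, hC⟩ := (Metric.isBounded_range_of_tendsto f h).exists_norm_le
  exact ⟨max C 1, by positivity, fun m => (hC _ ⟨m, rfl⟩).trans (le_max_left _ _)⟩

theorem norm_succ_cpow (m : ℕ) (z : ℂ) :
    ‖((m : ℂ) + 1) ^ z‖ = ((m : ℝ) + 1) ^ z.re := by
  have := Complex.norm_cpow_eq_rpow_re_of_pos (show (0 : ℝ) < (m : ℝ) + 1 by positivity) z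
  push_cast at this
  exact this

theorem exists_norm_Gamma_add_natCast_le (z : ℂ) : ∃ C : ℝ, 0 < C ∧ ∀ m : ℕ,
    ‖Complex.Gamma (z + m)‖ ≤ C * (m.factorial * ((m : ℝ) + 1) ^ (z.re - 1)) := by
  obtain ⟨C, hC, h⟩ := exists_norm_le_of_tendsto (tendsto_Gamma_add_natCast z)
  refine ⟨C, hC, fun m => ?_⟩
  have hm := h m
  rw [norm_div, norm_mul, norm_succ_cpow, Complex.norm_natCast, div_le_iff₀ (by positivity)] at hm
  simpa using hm

theorem exists_norm_inv_Gamma_add_natCast_le (z : ℂ) : ∃ C : ℝ, 0 < C ∧ ∀ m : ℕ,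
    ‖(Complex.Gamma (z + m))⁻¹‖ ≤ C * ((m.factorial : ℝ)⁻¹ * ((m : ℝ) + 1) ^ (1 - z.re)) := by
  obtain ⟨C, hC, h⟩ := exists_norm_le_of_tendsto
    ((tendsto_Gamma_add_natCast z).inv₀ one_ne_zero)
  refine ⟨C, hC, fun m => ?_⟩
  have hm := h m
  rw [norm_inv, norm_div, inv_div, norm_mul, norm_succ_cpow, Complex.norm_natCast] at hm
  rw [norm_inv, show 1 - z.re = -(z - 1).re by simp, Real.rpow_neg (by positivity), ← mul_inv]
  have hp : (0 : ℝ) < m.factorial * ((m : ℝ) + 1) ^ (z - 1).re := by positivity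
  rw [← div_eq_mul_inv, le_div_iff₀ hp, inv_mul_eq_div]
  exact hm

/-! ### Convergence of the series over `k` and telescoping -/

/-- The parameters lie in the neighbourhood of the origin on which everything converges. -/
structure Small (a b c d : ℂ) : Prop where
  a : ‖a‖ < 1 / 1000
  b : ‖b‖ < 1 / 1000
  c : ‖c‖ < 1 / 1000
  d : ‖d‖ < 1 / 1000

theorem ne_zero_of_re_pos {z : ℂ} (h : 0 < z.re) : z ≠ 0 := by
  rintro rfl; simp at h

theorem ne_neg_natCast_of_re_pos {z : ℂ} (h : 0 < z.re) (k : ℕ) : z ≠ -k := by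
  rintro rfl
  simp at h
  linarith [(Nat.cast_nonneg k : (0 : ℝ) ≤ k)]

theorem Small.re {a b c d : ℂ} (h : Small a b c d) :
    (|a.re| < 1 / 1000 ∧ |b.re| < 1 / 1000) ∧ (|c.re| < 1 / 1000 ∧ |d.re| < 1 / 1000) :=
  ⟨⟨(Complex.abs_re_le_norm a).trans_lt h.a, (Complex.abs_re_le_norm b).trans_lt h.b⟩,
    ⟨(Complex.abs_re_le_norm c).trans_lt h.c, (Complex.abs_re_le_norm d).trans_lt h.d⟩⟩

/-- Together with `c ≠ 0` this keeps `Γ(c + 2k - 3n + 1)` away from its poles for all `n` and `k`.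
-/
theorem add_intCast_ne_zero {c : ℂ} (hc : ‖c‖ < 1) (h0 : c ≠ 0) (m : ℤ) : c + m ≠ 0 := by
  intro h
  have h1 : c = -(m : ℂ) := eq_neg_of_add_eq_zero_left h
  have h2 : ‖c‖ = |(m : ℝ)| := by rw [h1, norm_neg, Complex.norm_intCast]
  rw [h2] at hc
  have h3 : |m| < 1 := by exact_mod_cast hc
  rw [Int.abs_lt_one_iff.mp h3] at h1
  exact h0 (by simpa using h1)

/-- The Wilf–Zeilberger mate of `F`. -/
def mateTerm (a b c d : ℂ) (n k : ℕ) : ℂ :=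
  4 ^ n * mate (a + k) (b + n) (c + 2 * k - 3 * n) d

theorem F_sub_F_succ {a b c d : ℂ} (h : Small a b c d) (hc : c ≠ 0) (n k : ℕ) :
    F a b c d n k - F a b c d (n + 1) k = mateTerm a b c d n k - mateTerm a b c d n (k + 1) := by
  obtain ⟨⟨ha, hb⟩, hc', hd⟩ := h.re
  rw [abs_lt] at ha hb hc' hd
  have hk : (0 : ℝ) ≤ k := k.cast_nonneg
  have hn : (0 : ℝ) ≤ n := n.cast_nonneg
  have hint (m : ℤ) : c + m ≠ 0 := add_intCast_ne_zero (h.c.trans (by norm_num)) hc m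
  have key := kernel_sub_kernel_shift (a + k) (b + n) (c + 2 * k - 3 * n) d
    (ne_zero_of_re_pos (by simp; linarith)) (ne_zero_of_re_pos (by simp; linarith))
    (by have := hint (2 * k - 3 * n - 2); push_cast at this; convert this using 1; ring)
    (by have := hint (2 * k - 3 * n - 1); push_cast at this; convert this using 1; ring)
    (by have := hint (2 * k - 3 * n); push_cast at this; convert this using 1; ring)
    (ne_zero_of_re_pos (by simp; linarith)) (ne_zero_of_re_pos (by simp; linarith))
    (ne_zero_of_re_pos (by simp; linarith))
  rw [F_eq_kernel, F_eq_kernel, mateTerm, mateTerm]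
  push_cast
  rw [show b + ((n : ℂ) + 1) = b + n + 1 by ring,
    show c + 2 * (k : ℂ) - 3 * ((n : ℂ) + 1) = c + 2 * k - 3 * n - 3 by ring,
    show a + ((k : ℂ) + 1) = a + k + 1 by ring,
    show c + 2 * ((k : ℂ) + 1) - 3 * n = c + 2 * k - 3 * n + 2 by ring,
    ← mul_sub, ← key]
  ring

theorem exists_norm_Gamma_ratio_le (z w : ℂ) : ∃ C : ℝ, 0 < C ∧ ∀ m : ℕ,
    ‖Complex.Gamma (z + m) * (Complex.Gamma (w + m))⁻¹‖ ≤ C * ((m : ℝ) + 1) ^ (z.re - w.re) := by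
  obtain ⟨C, hC, h1⟩ := exists_norm_Gamma_add_natCast_le z
  obtain ⟨D, hD, h2⟩ := exists_norm_inv_Gamma_add_natCast_le w
  refine ⟨C * D, by positivity, fun m => ?_⟩
  rw [norm_mul]
  refine (mul_le_mul (h1 m) (h2 m) (norm_nonneg _) (by positivity)).trans (le_of_eq ?_)
  have hf : (m.factorial : ℝ) ≠ 0 := by exact_mod_cast m.factorial_ne_zero
  rw [show z.re - w.re = (z.re - 1) + (1 - w.re) by ring, Real.rpow_add (by positivity)]
  field_simp

theorem exists_norm_Gamma_quotient_le (z₁ z₂ z₃ w₁ w₂ w₃ : ℂ) (h : z₃.re ≤ w₃.re) :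
    ∃ C : ℝ, 0 < C ∧ ∀ k : ℕ,
      ‖(Complex.Gamma (z₁ + k) * (Complex.Gamma (w₁ + k))⁻¹) *
        (Complex.Gamma (z₂ + k) * (Complex.Gamma (w₂ + k))⁻¹) *
        (Complex.Gamma (z₃ + 2 * k) * (Complex.Gamma (w₃ + 2 * k))⁻¹)‖ ≤
      C * ((k : ℝ) + 1) ^ ((z₁ + z₂ + z₃ - w₁ - w₂ - w₃).re) := by
  obtain ⟨C₁, h1, H1⟩ := exists_norm_Gamma_ratio_le z₁ w₁
  obtain ⟨C₂, h2, H2⟩ := exists_norm_Gamma_ratio_le z₂ w₂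
  obtain ⟨C₃, h3, H3⟩ := exists_norm_Gamma_ratio_le z₃ w₃
  refine ⟨C₁ * C₂ * C₃, by positivity, fun k => ?_⟩
  have H3' := H3 (2 * k)
  push_cast at H3'
  -- The hypothesis `h` makes this exponent nonpositive, so `2k + 1` may be replaced by the smaller
  -- `k + 1`.
  have H4 : C₃ * (2 * (k : ℝ) + 1) ^ (z₃.re - w₃.re) ≤ C₃ * ((k : ℝ) + 1) ^ (z₃.re - w₃.re) := by
    gcongr ?_ * ?_
    exact Real.rpow_le_rpow_of_nonpos (by positivity)
      (by linarith [(Nat.cast_nonneg k : (0 : ℝ) ≤ k)]) (by linarith)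
  rw [norm_mul, norm_mul]
  refine (mul_le_mul (mul_le_mul (H1 k) (H2 k) (norm_nonneg _) (by positivity))
    (H3'.trans H4) (norm_nonneg _) (by positivity)).trans (le_of_eq ?_)
  have : (z₁ + z₂ + z₃ - w₁ - w₂ - w₃).re =
      (z₁.re - w₁.re) + (z₂.re - w₂.re) + (z₃.re - w₃.re) := by simp; ring
  rw [this, Real.rpow_add (by positivity), Real.rpow_add (by positivity)]
  ring

/-- The Gamma quotients contribute the exponent `-3 - 2n` and the linear factor adds `1`, up to a
small combination of the parameters. The exponent `-3/2` leaves room for that and is still summable.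
-/
theorem exists_norm_F_le {a b c d : ℂ} (h : Small a b c d) (n : ℕ) :
    ∃ C : ℝ, ∀ k : ℕ, ‖F a b c d n k‖ ≤ C * ((k : ℝ) + 1) ^ (-(3 / 2) : ℝ) := by
  obtain ⟨⟨ha, hb⟩, hc, hd⟩ := h.re
  rw [abs_lt] at ha hb hc hd
  have hn : (0 : ℝ) ≤ n := n.cast_nonneg
  obtain ⟨C, hC, H⟩ := exists_norm_Gamma_quotient_le (a + 2 / 3) (a + d + 1 / 3) (c - 3 * n + 1)
    (a - b - n + 5 / 3) (a - b + d - n + 4 / 3) (4 * a - 2 * b - c + 2 * d + n + 2)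
    (by simp; linarith)
  set K : ℂ := 4 ^ n * Complex.Gamma (2 * a - 2 * b - c + n + 4 / 3) *
    Complex.Gamma (2 * a - b - c + d + 2 * n + 1 / 2) * ((Complex.Gamma (b + n))⁻¹ *
    (Complex.Gamma (-2 * a + 2 * b + c - 2 * d - n + 1 / 3))⁻¹ *
    (Complex.Gamma (2 * a - 2 * b - c + d + n + 1 / 2))⁻¹) with hK
  refine ⟨‖K‖ * C * (‖-2 * a + b - d + n - 1‖ + 2), fun k => ?_⟩
  have e : F a b c d n k = K * (-2 * a + b - d + n - 1 - 2 * k) *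
      ((Complex.Gamma (a + 2 / 3 + k) * (Complex.Gamma (a - b - n + 5 / 3 + k))⁻¹) *
        (Complex.Gamma (a + d + 1 / 3 + k) * (Complex.Gamma (a - b + d - n + 4 / 3 + k))⁻¹) *
        (Complex.Gamma (c - 3 * n + 1 + 2 * k) *
          (Complex.Gamma (4 * a - 2 * b - c + 2 * d + n + 2 + 2 * k))⁻¹)) := by
    rw [hK, F, div_eq_mul_inv]
    simp only [mul_inv]
    rw [show a + k + 2 / 3 = a + 2 / 3 + k by ring,
      show a + d + k + 1 / 3 = a + d + 1 / 3 + k by ring,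
      show c + 2 * k - 3 * n + 1 = c - 3 * n + 1 + 2 * k by ring,
      show a - b + k - n + 5 / 3 = a - b - n + 5 / 3 + k by ring,
      show a - b + d + k - n + 4 / 3 = a - b + d - n + 4 / 3 + k by ring,
      show 4 * a - 2 * b - c + 2 * d + 2 * k + n + 2 =
        4 * a - 2 * b - c + 2 * d + n + 2 + 2 * k by ring]
    ring
  have hlin : ‖-2 * a + b - d + n - 1 - 2 * (k : ℂ)‖ ≤
      (‖-2 * a + b - d + n - 1‖ + 2) * ((k : ℝ) + 1) := by
    refine (norm_sub_le _ _).trans ?_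
    rw [norm_mul, Complex.norm_natCast]
    simp only [Complex.norm_ofNat]
    have : (0 : ℝ) ≤ k := k.cast_nonneg
    nlinarith [norm_nonneg (-2 * a + b - d + n - 1)]
  rw [e, norm_mul, norm_mul]
  refine (mul_le_mul (mul_le_mul_of_nonneg_left hlin (norm_nonneg _)) (H k) (norm_nonneg _)
    (by positivity)).trans ?_
  have h1 : ((k : ℝ) + 1) * ((k : ℝ) + 1) ^ ((a + 2 / 3 + (a + d + 1 / 3) + (c - 3 * n + 1) -
      (a - b - n + 5 / 3) - (a - b + d - n + 4 / 3) - (4 * a - 2 * b - c + 2 * d + n + 2)).re) ≤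
      ((k : ℝ) + 1) ^ (-(3 / 2) : ℝ) := by
    rw [← Real.rpow_one_add' (by positivity)]
    · refine Real.rpow_le_rpow_of_exponent_le (by linarith [(Nat.cast_nonneg k : (0 : ℝ) ≤ k)]) ?_
      simp
      linarith
    · simp
      apply ne_of_lt
      linarith
  calc _ = ‖K‖ * C * (‖-2 * a + b - d + n - 1‖ + 2) * (((k : ℝ) + 1) * ((k : ℝ) + 1) ^
      ((a + 2 / 3 + (a + d + 1 / 3) + (c - 3 * n + 1) -
      (a - b - n + 5 / 3) - (a - b + d - n + 4 / 3) -
      (4 * a - 2 * b - c + 2 * d + n + 2)).re)) := by ring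
    _ ≤ _ := by gcongr

theorem summable_F {a b c d : ℂ} (h : Small a b c d) (n : ℕ) :
    Summable (fun k : ℕ => F a b c d n k) := by
  obtain ⟨C, hC⟩ := exists_norm_F_le h n
  refine Summable.of_norm_bounded ?_ hC
  refine Summable.mul_left _ ?_
  have := (summable_nat_add_iff 1).mpr (Real.summable_nat_rpow.mpr (show (-(3 / 2) : ℝ) < -1 by norm_num))
  simpa using this

/-- Although `P` is cubic, its cubic part vanishes in the direction `(a, c) = (1, 2)`, so `P` is
quadratic in `k` and is recovered by interpolation at `k = -1, 0, 1`. -/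
theorem P_shift_eq (a b c d n k : ℂ) :
    P (a + k) (b + n) (c + 2 * k - 3 * n) d 0 = P a (b + n) (c - 3 * n) d 0 +
      (P (a + 1) (b + n) (c + 2 - 3 * n) d 0 - P (a - 1) (b + n) (c - 2 - 3 * n) d 0) / 2 * k +
      ((P (a + 1) (b + n) (c + 2 - 3 * n) d 0 + P (a - 1) (b + n) (c - 2 - 3 * n) d 0) / 2 -
        P a (b + n) (c - 3 * n) d 0) * k ^ 2 := by
  unfold P
  ring

/-- The Gamma quotients decay with exponent near `-3 - 2n`, and `P` grows only quadratically, which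
leaves an exponent near `-1 - 2n`. Cubic growth would spoil the decay at `n = 0`. -/
theorem tendsto_mateTerm {a b c d : ℂ} (h : Small a b c d) (n : ℕ) :
    Tendsto (fun k : ℕ => mateTerm a b c d n k) atTop (𝓝 0) := by
  obtain ⟨⟨ha, hb⟩, hc, hd⟩ := h.re
  rw [abs_lt] at ha hb hc hd
  have hn : (0 : ℝ) ≤ n := n.cast_nonneg
  obtain ⟨C, hC, H⟩ := exists_norm_Gamma_quotient_le (a + 2 / 3) (a + d + 1 / 3) (c - 3 * n - 2)
    (a - b - n + 2 / 3) (a - b + d - n + 1 / 3) (4 * a - 2 * b - c + 2 * d + n + 1)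
    (by simp; linarith)
  set K : ℂ := 4 ^ n * Complex.Gamma (2 * a - 2 * b - c + n + 4 / 3) *
    Complex.Gamma (2 * a - b - c + d + 2 * n + 1 / 2) * ((Complex.Gamma (b + n + 1))⁻¹ *
    (Complex.Gamma (-2 * a + 2 * b + c - 2 * d - n + 1 / 3))⁻¹ *
    (Complex.Gamma (2 * a - 2 * b - c + d + n + 3 / 2))⁻¹) / (-18) with hK
  set p₀ := P a (b + n) (c - 3 * n) d 0
  set p₁ := (P (a + 1) (b + n) (c + 2 - 3 * n) d 0 - P (a - 1) (b + n) (c - 2 - 3 * n) d 0) / 2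
  set p₂ := (P (a + 1) (b + n) (c + 2 - 3 * n) d 0 + P (a - 1) (b + n) (c - 2 - 3 * n) d 0) / 2 - p₀
  have hP (k : ℂ) : P (a + k) (b + n) (c + 2 * k - 3 * n) d 0 = p₀ + p₁ * k + p₂ * k ^ 2 :=
    P_shift_eq a b c d n k
  have e (k : ℕ) : mateTerm a b c d n k = K * (p₀ + p₁ * k + p₂ * k ^ 2) *
      ((Complex.Gamma (a + 2 / 3 + k) * (Complex.Gamma (a - b - n + 2 / 3 + k))⁻¹) *
        (Complex.Gamma (a + d + 1 / 3 + k) * (Complex.Gamma (a - b + d - n + 1 / 3 + k))⁻¹) *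
        (Complex.Gamma (c - 3 * n - 2 + 2 * k) *
          (Complex.Gamma (4 * a - 2 * b - c + 2 * d + n + 1 + 2 * k))⁻¹)) := by
    rw [hK, mateTerm, mate, hP]
    rw [show a + k + 2 / 3 = a + 2 / 3 + k by ring,
      show a + k + d + 1 / 3 = a + d + 1 / 3 + k by ring,
      show c + 2 * k - 3 * n - 2 = c - 3 * n - 2 + 2 * k by ring,
      show 2 * (a + k) - 2 * (b + n) - (c + 2 * k - 3 * n) + 4 / 3 =
        2 * a - 2 * b - c + n + 4 / 3 by ring,
      show 2 * (a + k) - (b + n) - (c + 2 * k - 3 * n) + d + 1 / 2 =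
        2 * a - b - c + d + 2 * n + 1 / 2 by ring,
      show a + k - (b + n) + 2 / 3 = a - b - n + 2 / 3 + k by ring,
      show -2 * (a + k) + 2 * (b + n) + (c + 2 * k - 3 * n) - 2 * d + 1 / 3 =
        -2 * a + 2 * b + c - 2 * d - n + 1 / 3 by ring,
      show 2 * (a + k) - 2 * (b + n) - (c + 2 * k - 3 * n) + d + 3 / 2 =
        2 * a - 2 * b - c + d + n + 3 / 2 by ring,
      show a + k - (b + n) + d + 1 / 3 = a - b + d - n + 1 / 3 + k by ring,
      show 4 * (a + k) - 2 * (b + n) - (c + 2 * k - 3 * n) + 2 * d + 1 =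
        4 * a - 2 * b - c + 2 * d + n + 1 + 2 * k by ring]
    ring
  have hquad (k : ℕ) : ‖p₀ + p₁ * k + p₂ * k ^ 2‖ ≤
      (‖p₀‖ + ‖p₁‖ + ‖p₂‖) * ((k : ℝ) + 1) ^ (2 : ℝ) := by
    refine (norm_add₃_le).trans ?_
    rw [norm_mul, norm_mul, norm_pow, Complex.norm_natCast, Real.rpow_two]
    have : (0 : ℝ) ≤ k := k.cast_nonneg
    have h0 := norm_nonneg p₀
    have h1 := norm_nonneg p₁
    have h2 := norm_nonneg p₂
    have : ‖p₀‖ * 1 ≤ ‖p₀‖ * ((k : ℝ) + 1) ^ 2 := by gcongr; nlinarith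
    have : ‖p₁‖ * k ≤ ‖p₁‖ * ((k : ℝ) + 1) ^ 2 := by gcongr; nlinarith
    have : ‖p₂‖ * k ^ 2 ≤ ‖p₂‖ * ((k : ℝ) + 1) ^ 2 := by gcongr; nlinarith
    linarith
  have hbound (k : ℕ) : ‖mateTerm a b c d n k‖ ≤
      ‖K‖ * C * (‖p₀‖ + ‖p₁‖ + ‖p₂‖) * ((k : ℝ) + 1) ^ (-(1 / 2) : ℝ) := by
    rw [e, norm_mul, norm_mul]
    refine (mul_le_mul (mul_le_mul_of_nonneg_left (hquad k) (norm_nonneg _)) (H k) (norm_nonneg _)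
      (by positivity)).trans ?_
    have h1 : ((k : ℝ) + 1) ^ (2 : ℝ) * ((k : ℝ) + 1) ^ ((a + 2 / 3 + (a + d + 1 / 3) +
        (c - 3 * n - 2) - (a - b - n + 2 / 3) - (a - b + d - n + 1 / 3) -
        (4 * a - 2 * b - c + 2 * d + n + 1)).re) ≤ ((k : ℝ) + 1) ^ (-(1 / 2) : ℝ) := by
      rw [← Real.rpow_add (by positivity)]
      refine Real.rpow_le_rpow_of_exponent_le (by linarith [(Nat.cast_nonneg k : (0 : ℝ) ≤ k)]) ?_
      simp
      linarith
    calc _ = ‖K‖ * C * (‖p₀‖ + ‖p₁‖ + ‖p₂‖) * (((k : ℝ) + 1) ^ (2 : ℝ) * ((k : ℝ) + 1) ^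
        ((a + 2 / 3 + (a + d + 1 / 3) +
        (c - 3 * n - 2) - (a - b - n + 2 / 3) - (a - b + d - n + 1 / 3) -
        (4 * a - 2 * b - c + 2 * d + n + 1)).re)) := by ring
      _ ≤ _ := by gcongr
  refine squeeze_zero_norm hbound ?_
  have h0 := (tendsto_rpow_neg_atTop (show (0 : ℝ) < 1 / 2 by norm_num)).comp
    (tendsto_atTop_add_const_right atTop (1 : ℝ) (tendsto_natCast_atTop_atTop (R := ℝ)))
  simpa using h0.const_mul (‖K‖ * C * (‖p₀‖ + ‖p₁‖ + ‖p₂‖))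

theorem tsum_F_sub_tsum_F_succ {a b c d : ℂ} (h : Small a b c d) (hc : c ≠ 0) (n : ℕ) :
    ∑' k : ℕ, F a b c d n k - ∑' k : ℕ, F a b c d (n + 1) k = mateTerm a b c d n 0 := by
  have h1 := ((summable_F h n).hasSum.sub (summable_F h (n + 1)).hasSum).tendsto_sum_nat
  have h2 : Tendsto (fun K => ∑ k ∈ Finset.range K, (F a b c d n k - F a b c d (n + 1) k)) atTop
      (𝓝 (mateTerm a b c d n 0 - 0)) := by
    simp only [F_sub_F_succ h hc, Finset.sum_range_sub']
    exact tendsto_const_nhds.sub (tendsto_mateTerm h n)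
  rw [sub_zero] at h2
  exact tendsto_nhds_unique h1 h2

/-! ### The comparison weights and their sums -/

theorem integral_pow_mul_one_sub_pow (p r : ℕ) :
    ∫ t in (0 : ℝ)..1, t ^ p * (1 - t) ^ r = p.factorial * r.factorial / (p + r + 1).factorial := by
  induction r generalizing p with
  | zero =>
    simp [integral_pow, Nat.factorial_succ]
    have : (p.factorial : ℝ) ≠ 0 := by exact_mod_cast p.factorial_ne_zero
    field_simp
  | succ r ih =>
    have hint (f : ℝ → ℝ) (hf : Continuous f) : IntervalIntegrable f MeasureTheory.volume 0 1 :=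
      hf.intervalIntegrable 0 1
    -- Integration by parts: this function vanishes at both endpoints, so its derivative integrates
    -- to zero and relates `(p, r + 1)` to `(p + 1, r)`.
    have hd (t : ℝ) : HasDerivAt (fun t : ℝ => t ^ (p + 1) * (1 - t) ^ (r + 1))
        ((p + 1) * (t ^ p * (1 - t) ^ (r + 1)) - (r + 1) * (t ^ (p + 1) * (1 - t) ^ r)) t := by
      have h1 := hasDerivAt_pow (p + 1) t
      have h2 := ((hasDerivAt_id t).const_sub 1).pow (r + 1)
      refine (h1.mul h2).congr_deriv ?_
      push_cast
      simp
      ring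
    have h := intervalIntegral.integral_eq_sub_of_hasDerivAt (fun t _ => hd t)
      (hint _ (by fun_prop))
    rw [intervalIntegral.integral_sub (hint _ (by fun_prop)) (hint _ (by fun_prop)),
      intervalIntegral.integral_const_mul, intervalIntegral.integral_const_mul, ih (p + 1)] at h
    simp only [sub_self, zero_pow (Nat.succ_ne_zero _), mul_zero, zero_mul] at h
    have hp : (p : ℝ) + 1 ≠ 0 := by positivity
    have h' : ∫ t in (0 : ℝ)..1, t ^ p * (1 - t) ^ (r + 1) =
        (r + 1) * ((p + 1).factorial * r.factorial / (p + 1 + r + 1).factorial) / (p + 1) := by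
      rw [eq_div_iff hp]; linarith
    rw [h', show p + (r + 1) + 1 = p + 1 + r + 1 by ring, Nat.factorial_succ p,
      Nat.factorial_succ r]
    push_cast
    field_simp

/-- A probability distribution in `j`, concentrated near `j = (√2 - 1) n`. -/
def wt (n j : ℕ) : ℝ :=
  2 * (2 * n + 1).factorial / (n.factorial : ℝ) ^ 2 * (n.choose j) *
    ((2 * n + j + 1).factorial * n.factorial / (3 * n + j + 2).factorial)

theorem wt_nonneg (n j : ℕ) : 0 ≤ wt n j := by unfold wt; positivity

theorem wt_of_lt {n j : ℕ} (h : n < j) : wt n j = 0 := by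
  simp [wt, Nat.choose_eq_zero_of_lt h]

theorem wt_eq {n j : ℕ} (h : j ≤ n) : wt n j =
    2 * (2 * n + 1).factorial * (2 * n + j + 1).factorial /
      (j.factorial * (n - j).factorial * (3 * n + j + 2).factorial) := by
  rw [wt, Nat.cast_choose ℝ h]
  have h1 : (n.factorial : ℝ) ≠ 0 := by exact_mod_cast n.factorial_ne_zero
  field_simp

/-- The range is longer than the binomial theorem needs, but its even length allows even and odd
indices to be paired; the extra coefficients vanish. -/
theorem sum_choose_mul_pow (n : ℕ) (x : ℝ) :
    ∑ j ∈ Finset.range (2 * (n + 1)), (n.choose j : ℝ) * x ^ j = (x + 1) ^ n := by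
  rw [add_pow]
  symm
  refine (Finset.sum_subset (s₂ := Finset.range (2 * (n + 1))) ?_ ?_).trans ?_
  · intro j; simp only [Finset.mem_range]; omega
  · intro j _ hj
    rw [Nat.choose_eq_zero_of_lt (by simpa using hj)]; simp
  · exact Finset.sum_congr rfl fun j _ => by ring

/-- The quotient of factorials in `wt` is a Beta integral, so the binomial theorem can be applied
under the integral sign. -/
theorem sum_wt_mul_pow (n : ℕ) (x : ℝ) :
    ∑ j ∈ Finset.range (2 * (n + 1)), wt n j * x ^ j =
      2 * (2 * n + 1).factorial / (n.factorial : ℝ) ^ 2 *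
        ∫ t in (0 : ℝ)..1, t ^ (2 * n + 1) * (1 - t) ^ n * (t * x + 1) ^ n := by
  have h (t : ℝ) : t ^ (2 * n + 1) * (1 - t) ^ n * (t * x + 1) ^ n =
      ∑ j ∈ Finset.range (2 * (n + 1)),
        (n.choose j : ℝ) * x ^ j * (t ^ (2 * n + j + 1) * (1 - t) ^ n) := by
    rw [← sum_choose_mul_pow, Finset.mul_sum]
    exact Finset.sum_congr rfl fun j _ => by ring
  simp only [h]
  rw [intervalIntegral.integral_finsetSum, Finset.mul_sum]
  · refine Finset.sum_congr rfl fun j _ => ?_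
    rw [intervalIntegral.integral_const_mul, integral_pow_mul_one_sub_pow, wt,
      show 2 * n + j + 1 + n + 1 = 3 * n + j + 2 by ring]
    ring
  · intro j _
    exact Continuous.intervalIntegrable (by fun_prop) 0 1

theorem sum_wt (n : ℕ) : ∑ j ∈ Finset.range (2 * (n + 1)), wt n j = 1 := by
  have h := sum_wt_mul_pow n 1
  simp only [one_pow, mul_one] at h
  rw [h]
  -- At `x = 1` the integrand is `t (t² (1 - t²))ⁿ`, and `s = t²` gives half of a symmetric Beta
  -- integral, which cancels the normalisation exactly.
  have h1 : ∫ t in (0 : ℝ)..1, t ^ (2 * n + 1) * (1 - t) ^ n * (t + 1) ^ n =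
      (1 / 2) * ∫ t in (0 : ℝ)..1, t ^ n * (1 - t) ^ n := by
    have := intervalIntegral.integral_comp_mul_deriv (a := 0) (b := 1)
      (f := fun t : ℝ => t ^ 2) (f' := fun t : ℝ => 2 * t) (g := fun s : ℝ => s ^ n * (1 - s) ^ n)
      (fun t _ => by simpa using hasDerivAt_pow 2 t) (by fun_prop) (by fun_prop)
    simp only [Function.comp] at this
    rw [zero_pow two_ne_zero, one_pow] at this
    rw [← this, ← intervalIntegral.integral_const_mul]
    refine intervalIntegral.integral_congr fun t _ => ?_
    rw [show 1 - t ^ 2 = (1 - t) * (t + 1) by ring, mul_pow]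
    ring
  rw [h1, integral_pow_mul_one_sub_pow, show n + n + 1 = 2 * n + 1 by ring]
  have h2 : (n.factorial : ℝ) ≠ 0 := by exact_mod_cast n.factorial_ne_zero
  have h3 : ((2 * n + 1).factorial : ℝ) ≠ 0 := by exact_mod_cast (2 * n + 1).factorial_ne_zero
  field_simp

theorem wt_le_one (n j : ℕ) : wt n j ≤ 1 := by
  rcases lt_or_ge j (2 * (n + 1)) with h | h
  · rw [← sum_wt n]
    exact Finset.single_le_sum (fun i _ => wt_nonneg n i) (Finset.mem_range.mpr h)
  · rw [wt_of_lt (by omega)]; exact zero_le_one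

theorem two_mul_factorial_div_le (n : ℕ) :
    2 * ((2 * n + 1).factorial : ℝ) / (n.factorial : ℝ) ^ 2 ≤ 2 * (2 * n + 1) * 4 ^ n := by
  have h : ((2 * n).factorial : ℝ) = n.centralBinom * (n.factorial : ℝ) ^ 2 := by
    have h2 : (n.factorial : ℝ) ≠ 0 := by exact_mod_cast n.factorial_ne_zero
    rw [Nat.centralBinom, Nat.cast_choose ℝ (by omega : n ≤ 2 * n),
      show 2 * n - n = n by omega]
    field_simp
  rw [Nat.factorial_succ, Nat.cast_mul, h, div_le_iff₀ (by positivity)]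
  have : (n.centralBinom : ℝ) ≤ 4 ^ n := by exact_mod_cast n.centralBinom_le_four_pow
  push_cast
  have h3 : (n.centralBinom : ℝ) * (2 * (2 * n + 1) * (n.factorial : ℝ) ^ 2) ≤
      4 ^ n * (2 * (2 * n + 1) * (n.factorial : ℝ) ^ 2) := by gcongr
  linarith

theorem tendsto_natCast_add_pow_mul_pow (s k : ℕ) {r : ℝ} (h0 : 0 ≤ r) (h1 : r < 1) :
    Tendsto (fun n : ℕ => ((n : ℝ) + s) ^ k * r ^ n) atTop (𝓝 0) := by
  rcases h0.eq_or_lt with rfl | h0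
  · refine tendsto_const_nhds.congr' ?_
    filter_upwards [eventually_ne_atTop 0] with n hn
    simp [hn]
  have h := (tendsto_pow_const_mul_const_pow_of_lt_one k h0.le h1).comp (tendsto_add_atTop_nat s)
  have h2 := h.mul_const ((r ^ s)⁻¹)
  rw [zero_mul] at h2
  refine h2.congr fun n => ?_
  have : r ^ s ≠ 0 := by positivity
  simp only [Function.comp]
  push_cast
  rw [pow_add]
  field_simp

/-- At `x = -1` the integrand is `t (t(1 - t))^(2n) ≤ 16⁻ⁿ`, which beats the prefactor of order at
most `n 4ⁿ`. -/
theorem tendsto_sum_wt_alternating :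
    Tendsto (fun n : ℕ => ∑ j ∈ Finset.range (2 * (n + 1)), wt n j * (-1) ^ j) atTop (𝓝 0) := by
  have hb (n : ℕ) : ‖∑ j ∈ Finset.range (2 * (n + 1)), wt n j * (-1) ^ j‖ ≤
      4 * (((n : ℝ) + 1) ^ 1 * (1 / 4) ^ n) := by
    rw [sum_wt_mul_pow, norm_mul, Real.norm_of_nonneg (by positivity)]
    have h1 : ‖∫ t in (0 : ℝ)..1, t ^ (2 * n + 1) * (1 - t) ^ n * (t * (-1) + 1) ^ n‖ ≤
        (1 / 16) ^ n := by
      have := intervalIntegral.norm_integral_le_of_norm_le_const (a := 0) (b := 1)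
        (C := (1 / 16 : ℝ) ^ n)
        (f := fun t : ℝ => t ^ (2 * n + 1) * (1 - t) ^ n * (t * (-1) + 1) ^ n) ?_
      · simpa using this
      · intro t ht
        rw [Set.uIoc_of_le zero_le_one] at ht
        obtain ⟨h0, h1⟩ := ht
        have e : t ^ (2 * n + 1) * (1 - t) ^ n * (t * (-1) + 1) ^ n =
            t * ((t * (1 - t)) ^ 2) ^ n := by
          rw [show t * (-1) + 1 = 1 - t by ring, mul_pow, mul_pow, ← pow_mul, ← pow_mul]; ring
        rw [e, Real.norm_of_nonneg (by positivity)]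
        have h2 : (t * (1 - t)) ^ 2 ≤ 1 / 16 := by
          have h3 : t * (1 - t) ≤ 1 / 4 := by nlinarith [sq_nonneg (t - 1 / 2)]
          have h4 : 0 ≤ t * (1 - t) := mul_nonneg h0.le (by linarith)
          nlinarith
        calc t * ((t * (1 - t)) ^ 2) ^ n ≤ 1 * (1 / 16) ^ n := by gcongr
          _ = _ := one_mul _
    refine (mul_le_mul (two_mul_factorial_div_le n) h1 (norm_nonneg _) (by positivity)).trans ?_
    rw [mul_assoc, ← mul_pow]
    norm_num
    have : (0 : ℝ) < (1 / 4) ^ n := by positivity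
    nlinarith
  refine squeeze_zero_norm hb ?_
  have := (tendsto_natCast_add_pow_mul_pow 1 1 (r := 1 / 4) (by norm_num) (by norm_num)).const_mul 4
  simpa using this

theorem sum_range_two_mul (f : ℕ → ℝ) (N : ℕ) :
    ∑ j ∈ Finset.range (2 * N), f j = ∑ i ∈ Finset.range N, (f (2 * i) + f (2 * i + 1)) := by
  induction N with
  | zero => simp
  | succ N ih =>
    rw [show 2 * (N + 1) = 2 * N + 1 + 1 by ring, Finset.sum_range_succ, Finset.sum_range_succ, ih,
      Finset.sum_range_succ]
    ring

/-- Asymptotically half of the mass sits on the even integers. -/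
theorem tendsto_sum_wt_even :
    Tendsto (fun n : ℕ => ∑ i ∈ Finset.range (n + 1), wt n (2 * i)) atTop (𝓝 (1 / 2)) := by
  have h := (tendsto_sum_wt_alternating.const_add 1).div_const 2
  rw [add_zero] at h
  refine h.congr fun n => ?_
  have e : (1 : ℝ) + ∑ j ∈ Finset.range (2 * (n + 1)), wt n j * (-1) ^ j =
      ∑ j ∈ Finset.range (2 * (n + 1)), (wt n j + wt n j * (-1) ^ j) := by
    rw [Finset.sum_add_distrib, sum_wt]
  rw [e, sum_range_two_mul, Finset.sum_div]
  refine Finset.sum_congr rfl fun i _ => ?_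
  rw [pow_succ, pow_mul]
  norm_num

/-! ### Concentration of the weights -/

/-- The ratio of consecutive weights, cleared of denominators so that it also holds at and beyond `j
= n`. To leading order it equals `1` where `j² + 2nj = n²`, that is at `j = (√2 - 1)n`. -/
theorem wt_succ_mul (n j : ℕ) :
    wt n (j + 1) * ((j + 1) * (3 * n + j + 3)) = wt n j * ((2 * n + j + 2) * ((n : ℝ) - j)) := by
  rcases lt_trichotomy j n with h | rfl | h
  · obtain ⟨i, rfl⟩ := Nat.exists_eq_add_of_lt h
    rw [wt_eq (by omega), wt_eq (by omega), show j + i + 1 - (j + 1) = i by omega,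
      show j + i + 1 - j = i + 1 by omega,
      show 2 * (j + i + 1) + (j + 1) + 1 = (2 * (j + i + 1) + j + 1) + 1 by ring,
      show 3 * (j + i + 1) + (j + 1) + 2 = (3 * (j + i + 1) + j + 2) + 1 by ring,
      Nat.factorial_succ j, Nat.factorial_succ i, Nat.factorial_succ (3 * (j + i + 1) + j + 2),
      Nat.factorial_succ (2 * (j + i + 1) + j + 1)]
    push_cast
    have h1 : (j.factorial : ℝ) ≠ 0 := by exact_mod_cast j.factorial_ne_zero
    have h2 : (i.factorial : ℝ) ≠ 0 := by exact_mod_cast i.factorial_ne_zero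
    have h3 : ((3 * (j + i + 1) + j + 2).factorial : ℝ) ≠ 0 := by
      exact_mod_cast (3 * (j + i + 1) + j + 2).factorial_ne_zero
    field_simp
    ring
  · rw [wt_of_lt (Nat.lt_succ_self j)]; simp
  · rw [wt_of_lt h, wt_of_lt (h.trans (Nat.lt_succ_self j))]; simp

theorem wt_mul_pow_le_of_le {n j s : ℕ} {η : ℝ} (hη : 0 ≤ η)
    (h : ∀ i : ℕ, j ≤ i → i < j + s →
      (1 + η) * (((i : ℝ) + 1) * (3 * n + i + 3)) ≤ (2 * n + i + 2) * ((n : ℝ) - i)) :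
    wt n j * (1 + η) ^ s ≤ wt n (j + s) := by
  induction s with
  | zero => simp
  | succ s ih =>
    have h1 := ih fun i hi hi' => h i hi (by omega)
    have h2 := h (j + s) (by omega) (by omega)
    have h3 := wt_succ_mul n (j + s)
    have hpos : (0 : ℝ) < (((j + s : ℕ) : ℝ) + 1) * (3 * n + (j + s : ℕ) + 3) := by positivity
    have h4 : wt n (j + s) * (1 + η) ≤ wt n (j + s + 1) := by
      refine le_of_mul_le_mul_right ?_ hpos
      rw [h3, mul_assoc]
      exact mul_le_mul_of_nonneg_left h2 (wt_nonneg _ _)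
    calc wt n j * (1 + η) ^ (s + 1) = wt n j * (1 + η) ^ s * (1 + η) := by ring
      _ ≤ wt n (j + s) * (1 + η) := by gcongr
      _ ≤ _ := h4

theorem wt_mul_pow_le_of_ge {n j s : ℕ} {η : ℝ} (hη : 0 ≤ η)
    (h : ∀ i : ℕ, j ≤ i → i < j + s →
      (1 + η) * ((2 * n + i + 2) * ((n : ℝ) - i)) ≤ ((i : ℝ) + 1) * (3 * n + i + 3)) :
    wt n (j + s) * (1 + η) ^ s ≤ wt n j := by
  induction s with
  | zero => simp
  | succ s ih =>
    have h1 := ih fun i hi hi' => h i hi (by omega)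
    have h2 := h (j + s) (by omega) (by omega)
    have h3 := wt_succ_mul n (j + s)
    have hpos : (0 : ℝ) < (((j + s : ℕ) : ℝ) + 1) * (3 * n + (j + s : ℕ) + 3) := by positivity
    have h4 : wt n (j + s + 1) * (1 + η) ≤ wt n (j + s) := by
      refine le_of_mul_le_mul_right ?_ hpos
      rw [mul_right_comm, h3, mul_assoc, mul_comm (_ * _) (1 + η)]
      exact mul_le_mul_of_nonneg_left h2 (wt_nonneg _ _)
    calc wt n (j + (s + 1)) * (1 + η) ^ (s + 1) = wt n (j + s + 1) * (1 + η) * (1 + η) ^ s := by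
          rw [← add_assoc]; ring
      _ ≤ wt n (j + s) * (1 + η) ^ s := by gcongr
      _ ≤ _ := h1

theorem sqrt_two_bounds : (1.4 : ℝ) < √2 ∧ √2 < 1.5 ∧ √2 * √2 = 2 := by
  refine ⟨?_, ?_, Real.mul_self_sqrt (by norm_num)⟩
  · rw [Real.lt_sqrt (by norm_num)]; norm_num
  · rw [Real.sqrt_lt' (by norm_num)]; norm_num

/-- From an index at distance more than `δn` from the peak, about `δn/2` steps towards the peak stay
at distance at least `δn/2`, and each step multiplies the weight by at least `1 + η`. As weights are
at most `1`, the starting weight is at most about `(1 + η)^(-δn/2)`. -/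
theorem wt_le_of_abs_gt {δ : ℝ} (hδ : 0 < δ) : ∃ r K : ℝ, 0 ≤ r ∧ r < 1 ∧ 0 ≤ K ∧
    ∀ᶠ n : ℕ in atTop, ∀ j ≤ n, δ * n < |(j : ℝ) - (√2 - 1) * n| → wt n j ≤ K * r ^ n := by
  obtain ⟨hs1, hs2, hs⟩ := sqrt_two_bounds
  -- Below the peak the smaller side of the ratio is at most `2n · 7n = 14n²`, so `η` times it is at
  -- most `δn²`; above the peak `5n²` suffices.
  set η : ℝ := δ / 14 with hη
  have hη0 : 0 < η := by positivity
  have h1η : 1 < 1 + η := by linarith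
  -- The constant `1 + η` pays for rounding the number of steps down.
  refine ⟨(1 + η) ^ (-(δ / 2)), 1 + η, by positivity,
    Real.rpow_lt_one_of_one_lt_of_neg h1η (by linarith), by positivity, ?_⟩
  -- Then `δn² > 8n` absorbs the terms linear in `n` and `i` that remain below the peak.
  obtain ⟨N, hN⟩ := exists_nat_gt (8 / δ)
  filter_upwards [eventually_ge_atTop N, eventually_ge_atTop 1] with n hn hn1 j hj hdev
  have hn8 : 8 < δ * n := by
    rw [div_lt_iff₀ hδ] at hN
    have : (N : ℝ) ≤ n := by exact_mod_cast hn
    nlinarith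
  have hn1' : (1 : ℝ) ≤ n := by exact_mod_cast hn1
  have hjn : (j : ℝ) ≤ n := by exact_mod_cast hj
  set s := ⌊δ / 2 * n⌋₊ with hsdef
  have hs_le : (s : ℝ) ≤ δ / 2 * n := Nat.floor_le (by positivity)
  have hs_gt : δ / 2 * n < s + 1 := Nat.lt_floor_add_one _
  suffices h : wt n j * (1 + η) ^ s ≤ 1 by
    have hp : (0 : ℝ) < (1 + η) ^ s := by positivity
    have h2 : (1 + η) ^ (δ / 2 * n) ≤ (1 + η) * (1 + η) ^ s := by
      rw [← Real.rpow_natCast (1 + η) s, ← Real.rpow_one_add' (by positivity) (by positivity)]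
      exact Real.rpow_le_rpow_of_exponent_le h1η.le (by linarith)
    have h3 : ((1 + η) ^ (-(δ / 2))) ^ n = ((1 + η) ^ (δ / 2 * n))⁻¹ := by
      rw [← Real.rpow_natCast, ← Real.rpow_mul (by positivity), ← Real.rpow_neg (by positivity)]
      ring_nf
    have h4 : (0 : ℝ) < (1 + η) ^ (δ / 2 * n) := by positivity
    rw [h3, ← div_eq_mul_inv, le_div_iff₀ h4]
    calc wt n j * (1 + η) ^ (δ / 2 * n) ≤ wt n j * ((1 + η) * (1 + η) ^ s) := by
          gcongr; exact wt_nonneg _ _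
      _ = (wt n j * (1 + η) ^ s) * (1 + η) := by ring
      _ ≤ 1 * (1 + η) := by gcongr
      _ = _ := one_mul _
  rcases lt_abs.mp hdev with hgt | hlt
  · have hsj : s ≤ j := by
      have : (s : ℝ) ≤ j := by nlinarith
      exact_mod_cast this
    obtain ⟨i₀, rfl⟩ := Nat.exists_eq_add_of_le' hsj
    push_cast at hgt hjn
    refine (wt_mul_pow_le_of_ge hη0.le fun i hi hi' => ?_).trans (wt_le_one n i₀)
    have hi1 : (i₀ : ℝ) ≤ i := by exact_mod_cast hi
    have hi2 : (i : ℝ) ≤ n := by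
      have : i ≤ n := by omega
      exact_mod_cast this
    have hA : δ / 2 * n ≤ i - (√2 - 1) * n := by linarith
    have hB : 2 * (n : ℝ) ≤ (√2 + 1) * n + i := by nlinarith
    -- The quadratic part factors through its roots `(√2 - 1)n` and `-(√2 + 1)n`; the first factor
    -- measures the distance to the peak.
    have hid : ((i : ℝ) + 1) * (3 * n + i + 3) - (2 * n + i + 2) * ((n : ℝ) - i) =
        2 * ((i - (√2 - 1) * n) * ((√2 + 1) * n + i)) + n + 6 * i + 3 := by
      linear_combination (2 * (n : ℝ) ^ 2) * hs
    have hC : δ / 2 * n * (2 * n) ≤ (i - (√2 - 1) * n) * ((√2 + 1) * n + i) :=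
      mul_le_mul hA hB (by positivity) (le_trans (by positivity) hA)
    have hD : (2 * n + i + 2) * ((n : ℝ) - i) ≤ 5 * n * n :=
      mul_le_mul (by linarith) (by linarith [(Nat.cast_nonneg i : (0 : ℝ) ≤ i)]) (by linarith)
        (by positivity)
    have hE : η * ((2 * n + i + 2) * ((n : ℝ) - i)) ≤ η * (5 * n * n) := by gcongr
    have hi0 : (0 : ℝ) ≤ i := i.cast_nonneg
    have hF0 : 0 ≤ δ * n * n := by positivity
    have hF : η * (5 * n * n) ≤ δ * n * n := by rw [hη]; linarith
    linarith
  · refine (wt_mul_pow_le_of_le hη0.le fun i hi hi' => ?_).trans (wt_le_one n (j + s))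
    have hi1 : (i : ℝ) ≤ j + s := by exact_mod_cast hi'.le
    have hi0 : (0 : ℝ) ≤ i := i.cast_nonneg
    have hA : δ / 2 * n ≤ (√2 - 1) * n - i := by linarith
    have hin : (i : ℝ) ≤ n := by nlinarith
    have hB : 2 * (n : ℝ) ≤ (√2 + 1) * n + i := by nlinarith
    have hid : (2 * n + i + 2) * ((n : ℝ) - i) - ((i : ℝ) + 1) * (3 * n + i + 3) =
        2 * (((√2 - 1) * n - i) * ((√2 + 1) * n + i)) - n - 6 * i - 3 := by
      linear_combination (-2 * (n : ℝ) ^ 2) * hs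
    have hB' : 2.4 * (n : ℝ) ≤ (√2 + 1) * n + i := by nlinarith
    have hC : δ / 2 * n * (2.4 * n) ≤ ((√2 - 1) * n - i) * ((√2 + 1) * n + i) :=
      mul_le_mul hA hB' (by positivity) (le_trans (by positivity) hA)
    have hD : ((i : ℝ) + 1) * (3 * n + i + 3) ≤ (2 * n) * (7 * n) :=
      mul_le_mul (by linarith) (by linarith) (by positivity) (by positivity)
    have hE : η * (((i : ℝ) + 1) * (3 * n + i + 3)) ≤ η * ((2 * n) * (7 * n)) := by gcongr
    have hF : η * ((2 * n) * (7 * n)) = δ * n * n := by rw [hη]; ring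
    have hG : 8 * (n : ℝ) ≤ δ * n * n := by nlinarith
    nlinarith

/-- There are only `n + 1` terms, so the exponential bound outweighs any fixed power of `n`. The
power `M` is the polynomial loss in the later bound for `F`. -/
theorem tendsto_sum_wt_tail {δ : ℝ} (hδ : 0 < δ) (M : ℕ) :
    Tendsto (fun n : ℕ => ∑ i ∈ Finset.range (n + 1),
      if δ * n < |(2 * i : ℝ) - (√2 - 1) * n| then ((n : ℝ) + 1) ^ M * wt n (2 * i) else 0)
      atTop (𝓝 0) := by
  obtain ⟨r, K, hr0, hr1, hK, h⟩ := wt_le_of_abs_gt hδ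
  have hlim := (tendsto_natCast_add_pow_mul_pow 1 (M + 1) hr0 hr1).const_mul K
  rw [mul_zero] at hlim
  refine squeeze_zero' (Eventually.of_forall fun n => Finset.sum_nonneg fun j _ => ?_) ?_ hlim
  · split_ifs
    · exact mul_nonneg (by positivity) (wt_nonneg _ _)
    · exact le_rfl
  · filter_upwards [h] with n hn
    have hle : ∀ i ∈ Finset.range (n + 1),
        (if δ * n < |(2 * i : ℝ) - (√2 - 1) * n| then ((n : ℝ) + 1) ^ M * wt n (2 * i) else 0) ≤
          ((n : ℝ) + 1) ^ M * (K * r ^ n) := by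
      intro i _
      split_ifs with hd
      · refine mul_le_mul_of_nonneg_left ?_ (by positivity)
        rcases le_or_gt (2 * i) n with hi | hi
        · exact hn (2 * i) hi (by push_cast; exact hd)
        · rw [wt_of_lt hi]; positivity
      · positivity
    refine (Finset.sum_le_sum hle).trans (le_of_eq ?_)
    rw [Finset.sum_const, Finset.card_range, nsmul_eq_mul]
    push_cast
    ring

/-! ### Local comparison of `F` with the weights -/

/-- The ratio of `Γ(z + m)` to its approximation `m! n^(z-1)`. -/
def gammaRatio (z : ℂ) (m n : ℕ) : ℂ :=
  Complex.Gamma (z + m) / (m.factorial * (n : ℂ) ^ (z - 1))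

theorem Gamma_eq_gammaRatio {z w : ℂ} {m n : ℕ} (hn : n ≠ 0) (h : w = z + m) :
    Complex.Gamma w = gammaRatio z m n * m.factorial * (n : ℂ) ^ (z - 1) := by
  have h1 : (n : ℂ) ^ (z - 1) ≠ 0 := by rw [Complex.cpow_ne_zero_iff]; simp [hn]
  have h2 : (m.factorial : ℂ) ≠ 0 := by exact_mod_cast m.factorial_ne_zero
  rw [gammaRatio, h]
  field_simp

theorem inv_Gamma_eq_gammaRatio {z w : ℂ} {m n : ℕ} (hn : n ≠ 0) (h : w = z + m) :
    (Complex.Gamma w)⁻¹ =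
      (gammaRatio z m n)⁻¹ * (m.factorial : ℂ)⁻¹ * (n : ℂ) ^ (1 - z) := by
  rw [Gamma_eq_gammaRatio hn h, mul_inv, mul_inv, ← Complex.cpow_neg, neg_sub]

theorem factorial_eq_gammaRatio {N m n : ℕ} (hn : n ≠ 0) {e : ℕ} (h : N = m + e) :
    (N.factorial : ℂ) = gammaRatio (e + 1) m n * m.factorial * (n : ℂ) ^ (e : ℂ) := by
  have := Gamma_eq_gammaRatio (z := e + 1) (w := N + 1) (m := m) hn (by rw [h]; push_cast; ring)
  rw [Complex.Gamma_nat_eq_factorial] at this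
  rw [this, add_sub_cancel_right]

/-- Legendre's duplication formula at `m + 1/2`. It splits the factorials of even numbers in the
weights. -/
theorem factorial_two_mul_eq (m : ℕ) : ((2 * m).factorial : ℂ) =
    4 ^ m * m.factorial * Complex.Gamma (1 / 2 + m) * ((√Real.pi : ℝ) : ℂ)⁻¹ := by
  have h := Complex.Gamma_mul_Gamma_add_half (m + 1 / 2)
  rw [show (m : ℂ) + 1 / 2 + 1 / 2 = m + 1 by ring, Complex.Gamma_nat_eq_factorial,
    show 2 * ((m : ℂ) + 1 / 2) = (2 * m : ℕ) + 1 by push_cast; ring,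
    Complex.Gamma_nat_eq_factorial, show (1 : ℂ) - ((2 * m : ℕ) + 1) = -((2 * m : ℕ) : ℂ) by ring,
    Complex.cpow_neg, Complex.cpow_natCast, pow_mul] at h
  have hp : ((√Real.pi : ℝ) : ℂ) ≠ 0 := by
    exact_mod_cast (Real.sqrt_pos.mpr Real.pi_pos).ne'
  rw [add_comm] at h
  rw [mul_assoc (4 ^ m), mul_comm (m.factorial : ℂ), h]
  norm_num
  field_simp

/-- Euler's reflection formula turns an argument moving left into one moving right, where the
asymptotics apply. The sign comes from the antiperiodicity of the sine. -/
theorem inv_Gamma_sub_natCast (z : ℂ) (hz : ∀ k : ℤ, z ≠ k) (n : ℕ) :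
    (Complex.Gamma (z - n))⁻¹ =
      Complex.Gamma (1 - z + n) * ((-1) ^ n * Complex.sin (Real.pi * z)) / Real.pi := by
  have h := Complex.Gamma_mul_Gamma_one_sub (z - n)
  have hs : Complex.sin (Real.pi * (z - n)) = (-1) ^ n * Complex.sin (Real.pi * z) := by
    rw [mul_sub, mul_comm (Real.pi : ℂ) n, Complex.sin_antiperiodic.sub_nat_mul_eq]
  have hne : Complex.Gamma (z - n) ≠ 0 := by
    refine Complex.Gamma_ne_zero fun m hm => hz (n - m) ?_
    push_cast
    linear_combination hm
  have hpi : (Real.pi : ℂ) ≠ 0 := by exact_mod_cast Real.pi_ne_zero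
  have hs0 : (-1) ^ n * Complex.sin (Real.pi * z) ≠ 0 := by
    rw [← hs, Complex.sin_ne_zero_iff]
    intro k hk
    refine hz (k + n) ?_
    have := mul_left_cancel₀ hpi (hk.trans (mul_comm _ _))
    push_cast
    linear_combination this
  rw [hs, show 1 - (z - n) = 1 - z + n by ring] at h
  rw [eq_div_iff hpi, inv_mul_eq_iff_eq_mul₀ hne, ← mul_assoc, h,
    div_mul_cancel₀ _ hs0]

theorem Gamma_sub_natCast (z : ℂ) (hz : ∀ k : ℤ, z ≠ k) (n : ℕ) :
    Complex.Gamma (z - n) = (Complex.Gamma (1 - z + n))⁻¹ *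
      ((-1) ^ n * (Complex.sin (Real.pi * z))⁻¹) * Real.pi := by
  have := congrArg Inv.inv (inv_Gamma_sub_natCast z hz n)
  rw [inv_inv] at this
  rw [this, div_eq_mul_inv, mul_inv, mul_inv, mul_inv, inv_inv, ← inv_pow, inv_neg, inv_one]

theorem Small.sin_ne {a b c d : ℂ} (h : Small a b c d) (k : ℤ) :
    -2 * a + 2 * b + c - 2 * d + 1 / 3 ≠ k := by
  obtain ⟨⟨ha, hb⟩, hc, hd⟩ := h.re
  rw [abs_lt] at ha hb hc hd
  intro hk
  have hre := congrArg Complex.re hk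
  simp at hre
  have h1 : (0 : ℝ) < k := by linarith
  have h2 : (k : ℝ) < 1 := by linarith
  have h3 : 0 < k := by exact_mod_cast h1
  have h4 : k < 1 := by exact_mod_cast h2
  omega

/-- An exact identity: once every Gamma factor is written as `gammaRatio` times a factorial and a
power of `n`, all factorials, powers of `4`, signs, powers of `π` and powers of `n` cancel. Only
factors with known limits remain. -/
theorem F_eq_mul_wt {a b c d : ℂ} (h : Small a b c d) (hc : c ≠ 0) {n k : ℕ} (hn : 0 < n)
    (hnk : n ≤ k) (hk : 2 * k ≤ 3 * n) :
    F a b c d n k * ((wt n (2 * (k - n)) : ℝ) : ℂ)⁻¹ =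
      (Complex.sin (Real.pi * c))⁻¹ *
        Complex.sin (Real.pi * (-2 * a + 2 * b + c - 2 * d + 1 / 3)) / 2 *
      (-((-2 * a + b - d - 2 * k + n - 1) / n)) *
      (gammaRatio (a + 2 / 3) k n * gammaRatio (a + d + 1 / 3) k n *
        (gammaRatio (-c) (3 * n - 2 * k) n)⁻¹ * gammaRatio (2 * a - 2 * b - c + 4 / 3) n n *
        gammaRatio (2 * a - b - c + d + 1 / 2) (2 * n) n *
        gammaRatio (1 - (-2 * a + 2 * b + c - 2 * d + 1 / 3)) n n) *
      ((gammaRatio b n n)⁻¹ * (gammaRatio (a - b + 5 / 3) (k - n) n)⁻¹ *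
        (gammaRatio (2 * a - 2 * b - c + d + 1 / 2) n n)⁻¹ *
        (gammaRatio (a - b + d + 4 / 3) (k - n) n)⁻¹ *
        (gammaRatio (4 * a - 2 * b - c + 2 * d + 2) (2 * k + n) n)⁻¹) *
      ((gammaRatio ((1 : ℕ) + 1) (2 * n) n)⁻¹ * (gammaRatio ((1 : ℕ) + 1) (2 * k) n)⁻¹ *
        gammaRatio ((2 : ℕ) + 1) (2 * k + n) n * (gammaRatio (1 / 2) k n)⁻¹ *
        gammaRatio (1 / 2) (k - n) n) := by
  have hn0 : n ≠ 0 := hn.ne'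
  have hnC : (n : ℂ) ≠ 0 := by exact_mod_cast hn0
  have hcz (m : ℤ) : c + 1 ≠ m := by
    intro h0
    refine add_intCast_ne_zero (h.c.trans (by norm_num)) hc (1 - m) ?_
    push_cast
    linear_combination h0
  have hi : ((k - n : ℕ) : ℂ) = k - n := by push_cast [hnk]; ring
  have hN : ((3 * n - 2 * k : ℕ) : ℂ) = 3 * n - 2 * k := by push_cast [hk]; ring
  have hwt : ((wt n (2 * (k - n)) : ℝ) : ℂ)⁻¹ =
      ((2 * n + 1).factorial : ℂ)⁻¹ * ((2 * k + 1).factorial : ℂ)⁻¹ *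
      ((2 * (k - n)).factorial * (3 * n - 2 * k).factorial * (2 * k + n + 2).factorial) / 2 := by
    rw [wt_eq (by omega), show n - 2 * (k - n) = 3 * n - 2 * k by omega,
      show 2 * n + 2 * (k - n) + 1 = 2 * k + 1 by omega,
      show 3 * n + 2 * (k - n) + 2 = 2 * k + n + 2 by omega]
    push_cast
    rw [inv_div]
    field_simp
  have hsin : Complex.sin (Real.pi * (c + 1)) = -Complex.sin (Real.pi * c) := by
    rw [mul_add, mul_one, Complex.sin_add_pi]
  have hg3 : Complex.Gamma (c + 2 * k - 3 * n + 1) =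
      (gammaRatio (-c) (3 * n - 2 * k) n)⁻¹ * ((3 * n - 2 * k).factorial : ℂ)⁻¹ *
        (n : ℂ) ^ (1 - -c) * ((-1) ^ n * (-(Complex.sin (Real.pi * c))⁻¹)) * Real.pi := by
    have h1 := Gamma_sub_natCast (c + 1) hcz (3 * n - 2 * k)
    rw [inv_Gamma_eq_gammaRatio (z := -c) (m := 3 * n - 2 * k) hn0 (by ring), hsin, inv_neg] at h1
    have h2 : (-1 : ℂ) ^ (3 * n - 2 * k) = (-1) ^ n := by
      have : (-1 : ℂ) ^ (3 * n - 2 * k) * (-1) ^ (2 * k) = (-1) ^ n := by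
        rw [← pow_add, show 3 * n - 2 * k + 2 * k = 2 * n + n by omega, pow_add, pow_mul]
        simp
      rw [← this, pow_mul (-1 : ℂ) 2 k]
      simp
    rw [h2, hN] at h1
    rw [← h1]
    congr 1
    ring
  have hg8 : (Complex.Gamma (-2 * a + 2 * b + c - 2 * d - n + 1 / 3))⁻¹ =
      gammaRatio (1 - (-2 * a + 2 * b + c - 2 * d + 1 / 3)) n n * n.factorial *
        (n : ℂ) ^ (1 - (-2 * a + 2 * b + c - 2 * d + 1 / 3) - 1) *
        ((-1) ^ n * Complex.sin (Real.pi * (-2 * a + 2 * b + c - 2 * d + 1 / 3))) / Real.pi := by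
    have h1 := inv_Gamma_sub_natCast _ h.sin_ne n
    rw [Gamma_eq_gammaRatio (z := 1 - (-2 * a + 2 * b + c - 2 * d + 1 / 3)) (m := n) hn0 rfl] at h1
    rw [← h1]
    congr 2
    ring
  have hi2 : ((2 * (k - n)).factorial : ℂ) = 4 ^ (k - n) * (k - n).factorial *
      (gammaRatio (1 / 2) (k - n) n * (k - n).factorial * (n : ℂ) ^ ((1 / 2 : ℂ) - 1)) *
        ((√Real.pi : ℝ) : ℂ)⁻¹ := by
    rw [factorial_two_mul_eq, Gamma_eq_gammaRatio (z := 1 / 2) (m := k - n) hn0 rfl]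
  have hk2 : ((2 * k).factorial : ℂ)⁻¹ = (4 ^ k)⁻¹ * (k.factorial : ℂ)⁻¹ *
      ((gammaRatio (1 / 2) k n)⁻¹ * (k.factorial : ℂ)⁻¹ * (n : ℂ) ^ (1 - (1 / 2 : ℂ))) *
        ((√Real.pi : ℝ) : ℂ) := by
    rw [factorial_two_mul_eq, mul_inv, mul_inv, mul_inv,
      inv_Gamma_eq_gammaRatio (z := 1 / 2) (m := k) hn0 rfl, inv_inv]
  have hk21 : ((2 * k + 1).factorial : ℂ)⁻¹ = (gammaRatio ((1 : ℕ) + 1) (2 * k) n)⁻¹ *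
      ((2 * k).factorial : ℂ)⁻¹ * (n : ℂ)⁻¹ := by
    rw [factorial_eq_gammaRatio (m := 2 * k) (e := 1) hn0 rfl, Nat.cast_one, Complex.cpow_one,
      mul_inv, mul_inv]
  have hn21 : ((2 * n + 1).factorial : ℂ)⁻¹ = (gammaRatio ((1 : ℕ) + 1) (2 * n) n)⁻¹ *
      ((2 * n).factorial : ℂ)⁻¹ * (n : ℂ)⁻¹ := by
    rw [factorial_eq_gammaRatio (m := 2 * n) (e := 1) hn0 rfl, Nat.cast_one, Complex.cpow_one,
      mul_inv, mul_inv]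
  have hs2 : ((2 * k + n + 2).factorial : ℂ) = gammaRatio ((2 : ℕ) + 1) (2 * k + n) n *
      (2 * k + n).factorial * (n : ℂ) ^ 2 := by
    rw [factorial_eq_gammaRatio (m := 2 * k + n) (e := 2) hn0 rfl, Complex.cpow_natCast]
  -- The parameters cancel and the exponents add up to `-1`, which normalises the linear factor of
  -- `F`.
  have hE : (n : ℂ) ^ (a + 2 / 3 - 1) * (n : ℂ) ^ (a + d + 1 / 3 - 1) * (n : ℂ) ^ (1 - -c) *
      (n : ℂ) ^ (2 * a - 2 * b - c + 4 / 3 - 1) * (n : ℂ) ^ (2 * a - b - c + d + 1 / 2 - 1) *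
      (n : ℂ) ^ (1 - (-2 * a + 2 * b + c - 2 * d + 1 / 3) - 1) *
      (n : ℂ) ^ (1 - b) * (n : ℂ) ^ (1 - (a - b + 5 / 3)) *
      (n : ℂ) ^ (1 - (2 * a - 2 * b - c + d + 1 / 2)) * (n : ℂ) ^ (1 - (a - b + d + 4 / 3)) *
      (n : ℂ) ^ (1 - (4 * a - 2 * b - c + 2 * d + 2)) *
      (n : ℂ) ^ ((1 / 2 : ℂ) - 1) * (n : ℂ) ^ (1 - (1 / 2 : ℂ)) = (n : ℂ)⁻¹ := by
    simp only [← Complex.cpow_add _ _ hnC]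
    rw [← Complex.cpow_neg_one]
    congr 1
    ring
  have h4 : (4 : ℂ) ^ n * (4 ^ (k - n) * (4 ^ k)⁻¹) = 1 := by
    rw [← mul_assoc, ← pow_add, show n + (k - n) = k by omega, mul_inv_cancel₀ (pow_ne_zero _ (by norm_num))]
  have hsgn : (-1 : ℂ) ^ n * (-1) ^ n = 1 := by rw [← mul_pow]; simp
  have hpi : (Real.pi : ℂ) * (Real.pi : ℂ)⁻¹ = 1 :=
    mul_inv_cancel₀ (by exact_mod_cast Real.pi_ne_zero)
  have hsp : ((√Real.pi : ℝ) : ℂ)⁻¹ * ((√Real.pi : ℝ) : ℂ) = 1 :=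
    inv_mul_cancel₀ (by exact_mod_cast (Real.sqrt_pos.mpr Real.pi_pos).ne')
  have hfac (m : ℕ) : (m.factorial : ℂ) * (m.factorial : ℂ)⁻¹ = 1 :=
    mul_inv_cancel₀ (by exact_mod_cast m.factorial_ne_zero)
  rw [hwt, hi2, hk21, hn21, hs2, hk2, F, div_eq_mul_inv]
  simp only [mul_inv]
  rw [hg3, hg8, Gamma_eq_gammaRatio (z := a + 2 / 3) (m := k) hn0 (by ring),
    Gamma_eq_gammaRatio (z := a + d + 1 / 3) (m := k) hn0 (by ring),
    Gamma_eq_gammaRatio (z := 2 * a - 2 * b - c + 4 / 3) (m := n) hn0 (by ring),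
    Gamma_eq_gammaRatio (z := 2 * a - b - c + d + 1 / 2) (m := 2 * n) hn0 (by push_cast; ring),
    inv_Gamma_eq_gammaRatio (z := b) (m := n) hn0 rfl,
    inv_Gamma_eq_gammaRatio (z := a - b + 5 / 3) (m := k - n) hn0 (by rw [hi]; ring),
    inv_Gamma_eq_gammaRatio (z := 2 * a - 2 * b - c + d + 1 / 2) (m := n) hn0 (by ring),
    inv_Gamma_eq_gammaRatio (z := a - b + d + 4 / 3) (m := k - n) hn0 (by rw [hi]; ring),
    inv_Gamma_eq_gammaRatio (z := 4 * a - 2 * b - c + 2 * d + 2) (m := 2 * k + n) hn0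
      (by push_cast; ring)]
  have hn2 : (n : ℂ) ^ 2 * ((n : ℂ)⁻¹ * (n : ℂ)⁻¹) = 1 := by field_simp
  -- The product `Y` collects all cancelling pairs. Once every factor and its inverse are made
  -- independent variables, the remaining identity is one of monomials, which `ring` settles.
  have split {X Y Z : ℂ} (hX : X = Y * Z) (hY : Y = 1) : X = Z := by rw [hX, hY, one_mul]
  refine split (Y := ((4 : ℂ) ^ n * (4 ^ (k - n) * (4 ^ k)⁻¹)) * ((-1 : ℂ) ^ n * (-1) ^ n) *
    ((Real.pi : ℂ) * (Real.pi : ℂ)⁻¹) * (((√Real.pi : ℝ) : ℂ)⁻¹ * ((√Real.pi : ℝ) : ℂ)) *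
    ((n : ℂ) ^ 2 * ((n : ℂ)⁻¹ * (n : ℂ)⁻¹)) *
    ((k.factorial : ℂ) * (k.factorial : ℂ)⁻¹) ^ 2 * ((n.factorial : ℂ) * (n.factorial : ℂ)⁻¹) ^ 2 *
    (((k - n).factorial : ℂ) * ((k - n).factorial : ℂ)⁻¹) ^ 2 *
    (((2 * n).factorial : ℂ) * ((2 * n).factorial : ℂ)⁻¹) *
    (((3 * n - 2 * k).factorial : ℂ) * ((3 * n - 2 * k).factorial : ℂ)⁻¹) *
    (((2 * k + n).factorial : ℂ) * ((2 * k + n).factorial : ℂ)⁻¹)) ?_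
    (by rw [h4, hsgn, hpi, hsp, hn2]; simp only [hfac]; norm_num)
  simp only [div_eq_mul_inv _ (n : ℂ)]
  rw [← hE]
  generalize gammaRatio (a + 2 / 3) k n = r1
  generalize gammaRatio (a + d + 1 / 3) k n = r2
  generalize (gammaRatio (-c) (3 * n - 2 * k) n)⁻¹ = r3
  generalize gammaRatio (2 * a - 2 * b - c + 4 / 3) n n = r4
  generalize gammaRatio (2 * a - b - c + d + 1 / 2) (2 * n) n = r5
  generalize gammaRatio (1 - (-2 * a + 2 * b + c - 2 * d + 1 / 3)) n n = r6
  generalize (gammaRatio b n n)⁻¹ = r7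
  generalize (gammaRatio (a - b + 5 / 3) (k - n) n)⁻¹ = r8
  generalize (gammaRatio (2 * a - 2 * b - c + d + 1 / 2) n n)⁻¹ = r9
  generalize (gammaRatio (a - b + d + 4 / 3) (k - n) n)⁻¹ = r10
  generalize (gammaRatio (4 * a - 2 * b - c + 2 * d + 2) (2 * k + n) n)⁻¹ = r11
  generalize (gammaRatio ((1 : ℕ) + 1) (2 * n) n)⁻¹ = r12
  generalize (gammaRatio ((1 : ℕ) + 1) (2 * k) n)⁻¹ = r13
  generalize gammaRatio ((2 : ℕ) + 1) (2 * k + n) n = r14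
  generalize (gammaRatio (1 / 2) k n)⁻¹ = r15
  generalize gammaRatio (1 / 2) (k - n) n = r16
  generalize (n : ℂ) ^ (a + 2 / 3 - 1) = e1
  generalize (n : ℂ) ^ (a + d + 1 / 3 - 1) = e2
  generalize (n : ℂ) ^ (1 - -c) = e3
  generalize (n : ℂ) ^ (2 * a - 2 * b - c + 4 / 3 - 1) = e4
  generalize (n : ℂ) ^ (2 * a - b - c + d + 1 / 2 - 1) = e5
  generalize (n : ℂ) ^ (1 - (-2 * a + 2 * b + c - 2 * d + 1 / 3) - 1) = e6
  generalize (n : ℂ) ^ (1 - b) = e7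
  generalize (n : ℂ) ^ (1 - (a - b + 5 / 3)) = e8
  generalize (n : ℂ) ^ (1 - (2 * a - 2 * b - c + d + 1 / 2)) = e9
  generalize (n : ℂ) ^ (1 - (a - b + d + 4 / 3)) = e10
  generalize (n : ℂ) ^ (1 - (4 * a - 2 * b - c + 2 * d + 2)) = e11
  generalize (n : ℂ) ^ ((1 / 2 : ℂ) - 1) = e12
  generalize (n : ℂ) ^ (1 - (1 / 2 : ℂ)) = e13
  generalize (k.factorial : ℂ)⁻¹ = f1
  generalize (k.factorial : ℂ) = f1'
  generalize (n.factorial : ℂ)⁻¹ = f2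
  generalize (n.factorial : ℂ) = f2'
  generalize ((k - n).factorial : ℂ)⁻¹ = f3
  generalize ((k - n).factorial : ℂ) = f3'
  generalize ((2 * n).factorial : ℂ)⁻¹ = f4
  generalize ((2 * n).factorial : ℂ) = f4'
  generalize ((3 * n - 2 * k).factorial : ℂ)⁻¹ = f5
  generalize ((3 * n - 2 * k).factorial : ℂ) = f5'
  generalize ((2 * k + n).factorial : ℂ)⁻¹ = f6
  generalize ((2 * k + n).factorial : ℂ) = f6'
  generalize (n : ℂ)⁻¹ = v
  generalize (-1 : ℂ) ^ n = sg
  generalize ((4 : ℂ) ^ k)⁻¹ = q1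
  generalize (4 : ℂ) ^ (k - n) = q2
  generalize (4 : ℂ) ^ n = q3
  generalize Complex.sin (Real.pi * (-2 * a + 2 * b + c - 2 * d + 1 / 3)) = s1
  generalize (Complex.sin (Real.pi * c))⁻¹ = s2
  generalize ((√Real.pi : ℝ) : ℂ)⁻¹ = t1
  generalize ((√Real.pi : ℝ) : ℂ) = t2
  ring

theorem ofReal_cpow_eq_exp {μ l : ℝ} (hμ : 0 < μ) (hl : Real.log μ = l) (z : ℂ) :
    (μ : ℂ) ^ z = Complex.exp ((l : ℂ) * z) := by
  rw [Complex.cpow_def_of_ne_zero (by exact_mod_cast hμ.ne'), ← Complex.ofReal_log hμ.le, hl]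

theorem log_sqrt_two_values :
    Real.log ((1 + √2) / 2) = Real.log (1 + √2) - Real.log 2 ∧
    Real.log ((√2 - 1) / 2) = -Real.log (1 + √2) - Real.log 2 ∧
    Real.log (2 - √2) = Real.log 2 / 2 - Real.log (1 + √2) ∧
    Real.log (2 + √2) = Real.log 2 / 2 + Real.log (1 + √2) := by
  obtain ⟨h1, h2, h3⟩ := sqrt_two_bounds
  have hs : Real.log √2 = Real.log 2 / 2 := Real.log_sqrt (by norm_num)
  have hp : (0 : ℝ) < 1 + √2 := by linarith
  have hm : Real.log (√2 - 1) = -Real.log (1 + √2) := by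
    rw [← Real.log_inv]
    congr 1
    refine eq_inv_of_mul_eq_one_left ?_
    linarith
  refine ⟨Real.log_div hp.ne' two_ne_zero, ?_, ?_, ?_⟩
  · rw [Real.log_div (by linarith) two_ne_zero, hm]
  · rw [show 2 - √2 = √2 * (√2 - 1) by linarith,
      Real.log_mul (by positivity) (by linarith), hs, hm]
    ring
  · rw [show 2 + √2 = √2 * (1 + √2) by linarith, Real.log_mul (by positivity) hp.ne', hs]

/-- The limit is twice the boundary value because the summation over `k` meets only even `j = 2(k -
n)`, which carry half of the mass. -/
theorem tendsto_F_mul_inv_wt {a b c d : ℂ} (h : Small a b c d) (hc : c ≠ 0) {α : Type*}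
    {l : Filter α} {n k : α → ℕ} (hn : Tendsto n l atTop)
    (hk : Tendsto (fun p => (k p : ℝ) / n p) l (𝓝 ((1 + √2) / 2))) :
    Tendsto (fun p => F a b c d (n p) (k p) * ((wt (n p) (2 * (k p - n p)) : ℝ) : ℂ)⁻¹) l
      (𝓝 (2 * boundaryLimit a b c d)) := by
  obtain ⟨h1, h2, h3⟩ := sqrt_two_bounds
  have hpos : ∀ᶠ p in l, 0 < n p := hn.eventually_gt_atTop 0
  have hnk : ∀ᶠ p in l, n p ≤ k p := by
    filter_upwards [hpos, hk.eventually (lt_mem_nhds (show (1 : ℝ) < (1 + √2) / 2 by linarith))]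
      with p hp hkp
    have : (0 : ℝ) < n p := by exact_mod_cast hp
    rw [lt_div_iff₀ this, one_mul] at hkp
    exact_mod_cast hkp.le
  have hk3 : ∀ᶠ p in l, 2 * k p ≤ 3 * n p := by
    filter_upwards [hpos, hk.eventually (gt_mem_nhds (show (1 + √2) / 2 < (3 / 2 : ℝ) by linarith))]
      with p hp hkp
    have : (0 : ℝ) < n p := by exact_mod_cast hp
    rw [div_lt_iff₀ this] at hkp
    have h4 : (2 * k p : ℝ) ≤ 3 * n p := by linarith
    exact_mod_cast h4
  -- Every index that occurs is a combination `x k + y n`, so its quotient by `n` converges and one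
  -- lemma gives all the limits.
  have lim {m : α → ℕ} {μ x y : ℝ}
      (hm : ∀ᶠ p in l, (m p : ℝ) = x * k p + y * n p) (hμ : μ = x * ((1 + √2) / 2) + y)
      (hμ0 : 0 < μ) (z : ℂ) :
      Tendsto (fun p => gammaRatio z (m p) (n p)) l (𝓝 ((μ : ℂ) ^ (z - 1))) := by
    refine tendsto_Gamma_add_div_pow hμ0 hn ?_ z
    rw [hμ]
    refine ((hk.const_mul x).add_const y).congr' ?_
    filter_upwards [hpos, hm] with p hp hmp
    have : (n p : ℝ) ≠ 0 := by exact_mod_cast hp.ne'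
    rw [hmp]
    field_simp
  have limk := lim (m := k) (x := 1) (y := 0) (μ := (1 + √2) / 2)
    (Eventually.of_forall fun p => by ring) (by ring) (by positivity)
  have limn := lim (m := n) (x := 0) (y := 1) (μ := 1)
    (Eventually.of_forall fun p => by ring) (by ring) (by positivity)
  have lim2n := lim (m := fun p => 2 * n p) (x := 0) (y := 2) (μ := 2)
    (Eventually.of_forall fun p => by push_cast; ring) (by ring) (by positivity)
  have lim2k := lim (m := fun p => 2 * k p) (x := 2) (y := 0) (μ := 1 + √2)
    (Eventually.of_forall fun p => by push_cast; ring) (by ring) (by positivity)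
  have limi := lim (m := fun p => k p - n p) (x := 1) (y := -1) (μ := (√2 - 1) / 2)
    (by filter_upwards [hnk] with p hp; push_cast [hp]; ring) (by ring) (by linarith)
  have limN := lim (m := fun p => 3 * n p - 2 * k p) (x := -2) (y := 3) (μ := 2 - √2)
    (by filter_upwards [hk3] with p hp; push_cast [hp]; ring) (by ring) (by linarith)
  have lims := lim (m := fun p => 2 * k p + n p) (x := 2) (y := 1) (μ := 2 + √2)
    (Eventually.of_forall fun p => by push_cast; ring) (by ring) (by positivity)
  have inv {f : α → ℂ} {μ : ℝ} (hμ : 0 < μ) {z : ℂ} (hf : Tendsto f l (𝓝 ((μ : ℂ) ^ z))) :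
      Tendsto (fun p => (f p)⁻¹) l (𝓝 (((μ : ℂ) ^ z)⁻¹)) := by
    refine hf.inv₀ ?_
    rw [Ne, Complex.cpow_eq_zero_iff]
    simp [hμ.ne']
  have hlin : Tendsto (fun p => -((-2 * a + b - d - 2 * k p + n p - 1) / (n p : ℂ))) l
      (𝓝 ((√2 : ℝ) : ℂ)) := by
    have e1 : Tendsto (fun p => (((k p : ℝ) / n p : ℝ) : ℂ)) l (𝓝 (((1 + √2) / 2 : ℝ) : ℂ)) :=
      (Complex.continuous_ofReal.tendsto _).comp hk
    have e2 : Tendsto (fun p => (2 * a - b + d + 1) / (n p : ℂ)) l (𝓝 0) :=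
      (tendsto_const_div_atTop_nhds_zero_nat (2 * a - b + d + 1)).comp hn
    have e3 := ((e1.const_mul 2).add e2).sub_const 1
    have e4 : 2 * (((1 + √2) / 2 : ℝ) : ℂ) + 0 - 1 = ((√2 : ℝ) : ℂ) := by push_cast; ring
    rw [e4] at e3
    refine e3.congr' ?_
    filter_upwards [hpos] with p hp
    have : (n p : ℂ) ≠ 0 := by exact_mod_cast hp.ne'
    push_cast
    field_simp
    ring
  have x0pos : (0 : ℝ) < (1 + √2) / 2 := by positivity
  have ypos : (0 : ℝ) < (√2 - 1) / 2 := by linarith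
  have νpos : (0 : ℝ) < 2 - √2 := by linarith
  have σpos : (0 : ℝ) < 2 + √2 := by positivity
  have tpos : (0 : ℝ) < 1 + √2 := by positivity
  have main := (((hlin.const_mul ((Complex.sin (Real.pi * c))⁻¹ *
        Complex.sin (Real.pi * (-2 * a + 2 * b + c - 2 * d + 1 / 3)) / 2)).mul
    ((((((limk (a + 2 / 3)).mul (limk (a + d + 1 / 3))).mul (inv νpos (limN (-c)))).mul
      (limn (2 * a - 2 * b - c + 4 / 3))).mul (lim2n (2 * a - b - c + d + 1 / 2))).mul
      (limn (1 - (-2 * a + 2 * b + c - 2 * d + 1 / 3))))).mul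
    (((((inv one_pos (limn b)).mul (inv ypos (limi (a - b + 5 / 3)))).mul
      (inv one_pos (limn (2 * a - 2 * b - c + d + 1 / 2)))).mul
      (inv ypos (limi (a - b + d + 4 / 3)))).mul
      (inv σpos (lims (4 * a - 2 * b - c + 2 * d + 2))))).mul
    (((((inv two_pos (lim2n ((1 : ℕ) + 1))).mul (inv tpos (lim2k ((1 : ℕ) + 1)))).mul
      (lims ((2 : ℕ) + 1))).mul (inv x0pos (limk (1 / 2)))).mul (limi (1 / 2)))
  obtain ⟨L1, L2, L3, L4⟩ := log_sqrt_two_values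
  have hval : 2 * boundaryLimit a b c d = (Complex.sin (Real.pi * c))⁻¹ *
        Complex.sin (Real.pi * (-2 * a + 2 * b + c - 2 * d + 1 / 3)) *
        Complex.exp ((Real.log 2 : ℝ) * (1 - 2 * b)) := by
    have e4 : (4 : ℂ) ^ (-b) = Complex.exp ((Real.log 2 : ℝ) * (-2 * b)) := by
      have := ofReal_cpow_eq_exp (μ := 4) (l := 2 * Real.log 2) (by norm_num)
        (by rw [show (4 : ℝ) = 2 ^ 2 by norm_num, Real.log_pow]; norm_num) (-b)
      push_cast at this
      rw [this]
      ring_nf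
    have e2 : Complex.exp ((Real.log 2 : ℝ) : ℂ) = 2 := by
      rw [← Complex.ofReal_exp, Real.exp_log two_pos]; norm_num
    rw [boundaryLimit, e4, show ((Real.log 2 : ℝ) : ℂ) * (1 - 2 * b) =
      (Real.log 2 : ℝ) + (Real.log 2 : ℝ) * (-2 * b) by ring, Complex.exp_add, e2]
    ring
  rw [hval]
  refine (main.congr' ?_).trans (le_of_eq (congrArg _ ?_))
  · filter_upwards [hpos, hnk, hk3] with p hp1 hp2 hp3
    rw [F_eq_mul_wt h hc hp1 hp2 hp3]
  · have hsq : ((√2 : ℝ) : ℂ) = Complex.exp ((Real.log 2 / 2 : ℝ) : ℂ) := by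
      rw [← Complex.ofReal_exp, ← Real.log_sqrt (by norm_num), Real.exp_log (by positivity)]
    have h12 (X : ℂ) : X / 2 = X * Complex.exp (-((Real.log 2 : ℝ) : ℂ)) := by
      rw [Complex.exp_neg, ← Complex.ofReal_exp, Real.exp_log two_pos, div_eq_mul_inv]; norm_num
    -- All limits are powers of `2`, `√2` and `1 + √2` up to the sines. As exponentials they reduce
    -- the claim to an identity of exponents, linear in `log 2` and `log (1 + √2)`, in which the
    -- second logarithm cancels.
    rw [hsq, h12 (_ * _)]
    simp only [ofReal_cpow_eq_exp x0pos L1, ofReal_cpow_eq_exp ypos L2, ofReal_cpow_eq_exp νpos L3,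
      ofReal_cpow_eq_exp σpos L4, ofReal_cpow_eq_exp tpos rfl, ofReal_cpow_eq_exp two_pos rfl,
      ofReal_cpow_eq_exp one_pos Real.log_one, ← Complex.exp_neg]
    simp only [Complex.ofReal_zero, zero_mul, Complex.exp_zero, mul_one, neg_zero, one_mul]
    simp only [mul_assoc, ← Complex.exp_add]
    congr 3
    push_cast
    ring

/-! ### Bounds for `F` up to polynomial factors, in three ranges of `k` -/

/-- On `S` the function `f` is dominated by `g` up to a polynomial factor. -/
def PolyLE (S : Set (ℕ × ℕ)) (f : ℕ × ℕ → ℂ) (g : ℕ × ℕ → ℝ) : Prop :=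
  ∃ (C : ℝ) (M : ℕ), 0 ≤ C ∧ ∀ p ∈ S, ‖f p‖ ≤ C * ((p.1 : ℝ) + p.2 + 1) ^ M * g p

theorem PolyLE.mul {S : Set (ℕ × ℕ)} {f₁ f₂ : ℕ × ℕ → ℂ} {g₁ g₂ : ℕ × ℕ → ℝ}
    (h₁ : PolyLE S f₁ g₁) (h₂ : PolyLE S f₂ g₂) :
    PolyLE S (fun p => f₁ p * f₂ p) (fun p => g₁ p * g₂ p) := by
  obtain ⟨C₁, M₁, hC₁, H₁⟩ := h₁
  obtain ⟨C₂, M₂, hC₂, H₂⟩ := h₂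
  refine ⟨C₁ * C₂, M₁ + M₂, by positivity, fun p hp => ?_⟩
  rw [norm_mul]
  refine (mul_le_mul (H₁ p hp) (H₂ p hp) (norm_nonneg _)
    ((norm_nonneg _).trans (H₁ p hp))).trans (le_of_eq ?_)
  ring

theorem PolyLE.mono {S : Set (ℕ × ℕ)} {f : ℕ × ℕ → ℂ} {g g' : ℕ × ℕ → ℝ}
    (h : PolyLE S f g) {K : ℝ} (hK : 0 ≤ K) (m : ℕ)
    (hg : ∀ p ∈ S, g p ≤ K * ((p.1 : ℝ) + p.2 + 1) ^ m * g' p) : PolyLE S f g' := by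
  obtain ⟨C, M, hC, H⟩ := h
  refine ⟨C * K, M + m, by positivity, fun p hp => (H p hp).trans ?_⟩
  calc _ ≤ C * ((p.1 : ℝ) + p.2 + 1) ^ M * (K * ((p.1 : ℝ) + p.2 + 1) ^ m * g' p) :=
        mul_le_mul_of_nonneg_left (hg p hp) (by positivity)
    _ = _ := by ring

theorem PolyLE.congr {S : Set (ℕ × ℕ)} {f f' : ℕ × ℕ → ℂ} {g g' : ℕ × ℕ → ℝ}
    (h : PolyLE S f g) (hf : ∀ p ∈ S, f' p = f p) (hg : ∀ p ∈ S, g p = g' p) : PolyLE S f' g' := by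
  obtain ⟨C, M, hC, H⟩ := h
  exact ⟨C, M, hC, fun p hp => by rw [hf p hp, ← hg p hp]; exact H p hp⟩

theorem rpow_succ_le_pow {S : Set (ℕ × ℕ)} {m : ℕ × ℕ → ℕ}
    (hm : ∀ p ∈ S, m p ≤ 3 * (p.1 + p.2)) (e : ℝ) : ∃ (K : ℝ) (M : ℕ), 0 ≤ K ∧ ∀ p ∈ S,
      ((m p : ℝ) + 1) ^ e ≤ K * ((p.1 : ℝ) + p.2 + 1) ^ M := by
  obtain ⟨M, hM⟩ := exists_nat_ge e
  refine ⟨3 ^ M, M, by positivity, fun p hp => ?_⟩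
  have h0 : (m p : ℝ) ≤ 3 * (p.1 + p.2) := by exact_mod_cast hm p hp
  calc ((m p : ℝ) + 1) ^ e ≤ ((m p : ℝ) + 1) ^ (M : ℝ) :=
        Real.rpow_le_rpow_of_exponent_le (by linarith [(Nat.cast_nonneg (m p) : (0 : ℝ) ≤ m p)]) hM
    _ = ((m p : ℝ) + 1) ^ M := Real.rpow_natCast _ _
    _ ≤ (3 * ((p.1 : ℝ) + p.2 + 1)) ^ M := by gcongr; linarith
    _ = _ := mul_pow _ _ _

theorem polyLE_Gamma {S : Set (ℕ × ℕ)} {m : ℕ × ℕ → ℕ}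
    (hm : ∀ p ∈ S, m p ≤ 3 * (p.1 + p.2)) (z : ℂ) :
    PolyLE S (fun p => Complex.Gamma (z + m p)) (fun p => (m p).factorial) := by
  obtain ⟨C, hC, H⟩ := exists_norm_Gamma_add_natCast_le z
  obtain ⟨K, M, hK, hM⟩ := rpow_succ_le_pow hm (z.re - 1)
  refine ⟨C * K, M, by positivity, fun p hp => (H _).trans ?_⟩
  calc C * ((m p).factorial * ((m p : ℝ) + 1) ^ (z.re - 1)) ≤
        C * ((m p).factorial * (K * ((p.1 : ℝ) + p.2 + 1) ^ M)) := by
          have := hM p hp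
          gcongr
    _ = _ := by ring

theorem polyLE_inv_Gamma {S : Set (ℕ × ℕ)} {m : ℕ × ℕ → ℕ}
    (hm : ∀ p ∈ S, m p ≤ 3 * (p.1 + p.2)) (z : ℂ) :
    PolyLE S (fun p => (Complex.Gamma (z + m p))⁻¹) (fun p => ((m p).factorial : ℝ)⁻¹) := by
  obtain ⟨C, hC, H⟩ := exists_norm_inv_Gamma_add_natCast_le z
  obtain ⟨K, M, hK, hM⟩ := rpow_succ_le_pow hm (1 - z.re)
  refine ⟨C * K, M, by positivity, fun p hp => (H _).trans ?_⟩
  calc C * (((m p).factorial : ℝ)⁻¹ * ((m p : ℝ) + 1) ^ (1 - z.re)) ≤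
        C * (((m p).factorial : ℝ)⁻¹ * (K * ((p.1 : ℝ) + p.2 + 1) ^ M)) := by
          have := hM p hp
          gcongr
    _ = _ := by ring

theorem polyLE_of_norm_le {S : Set (ℕ × ℕ)} {f : ℕ × ℕ → ℂ} {C : ℝ} (hC : 0 ≤ C)
    (h : ∀ p ∈ S, ‖f p‖ ≤ C) : PolyLE S f (fun _ => 1) :=
  ⟨C, 0, hC, fun p hp => by simpa using h p hp⟩

theorem polyLE_Gamma_sub {S : Set (ℕ × ℕ)} {m : ℕ × ℕ → ℕ}
    (hm : ∀ p ∈ S, m p ≤ 3 * (p.1 + p.2)) (z : ℂ) (hz : ∀ k : ℤ, z ≠ k) :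
    PolyLE S (fun p => Complex.Gamma (z - m p)) (fun p => ((m p).factorial : ℝ)⁻¹) := by
  have h := (polyLE_inv_Gamma hm (1 - z)).mul (polyLE_of_norm_le (S := S)
    (f := fun p => ((-1) ^ (m p) * (Complex.sin (Real.pi * z))⁻¹) * Real.pi)
    (norm_nonneg ((Complex.sin (Real.pi * z))⁻¹ * Real.pi)) (fun p _ => by simp))
  refine h.congr (fun p _ => ?_) (fun p _ => mul_one _)
  rw [Gamma_sub_natCast z hz]
  ring

theorem polyLE_inv_Gamma_sub {S : Set (ℕ × ℕ)} {m : ℕ × ℕ → ℕ}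
    (hm : ∀ p ∈ S, m p ≤ 3 * (p.1 + p.2)) (z : ℂ) (hz : ∀ k : ℤ, z ≠ k) :
    PolyLE S (fun p => (Complex.Gamma (z - m p))⁻¹) (fun p => (m p).factorial) := by
  have h := (polyLE_Gamma hm (1 - z)).mul (polyLE_of_norm_le (S := S)
    (f := fun p => ((-1) ^ (m p) * Complex.sin (Real.pi * z)) / Real.pi)
    (norm_nonneg (Complex.sin (Real.pi * z) / Real.pi)) (fun p _ => by simp))
  refine h.congr (fun p _ => ?_) (fun p _ => mul_one _)
  rw [inv_Gamma_sub_natCast z hz]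
  ring

theorem ne_intCast_of_re {z : ℂ} {m : ℤ} (h1 : (m : ℝ) < z.re) (h2 : z.re < m + 1) (k : ℤ) :
    z ≠ k := by
  rintro rfl
  simp at h1 h2
  have h3 : k < m + 1 := by exact_mod_cast h2
  omega

/-- The factors of `F` that behave alike on the whole range of summation. -/
theorem polyLE_common {a b c d : ℂ} (h : Small a b c d) (S : Set (ℕ × ℕ)) :
    PolyLE S (fun p => 4 ^ p.1 * Complex.Gamma (a + 2 / 3 + p.2) *
      Complex.Gamma (a + d + 1 / 3 + p.2) * Complex.Gamma (2 * a - 2 * b - c + 4 / 3 + p.1) *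
      (-2 * a + b - d - 2 * p.2 + p.1 - 1) *
      Complex.Gamma (2 * a - b - c + d + 1 / 2 + (2 * p.1 : ℕ)) *
      ((Complex.Gamma (b + p.1))⁻¹ *
      (Complex.Gamma (-2 * a + 2 * b + c - 2 * d + 1 / 3 - p.1))⁻¹ *
      (Complex.Gamma (2 * a - 2 * b - c + d + 1 / 2 + p.1))⁻¹ *
      (Complex.Gamma (4 * a - 2 * b - c + 2 * d + 2 + (2 * p.2 + p.1 : ℕ)))⁻¹))
    (fun p => 4 ^ p.1 * (p.2.factorial : ℝ) ^ 2 * (2 * p.1).factorial *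
      ((2 * p.2 + p.1).factorial : ℝ)⁻¹) := by
  have hpow : PolyLE S (fun p => (4 : ℂ) ^ p.1) (fun p => 4 ^ p.1) :=
    ⟨1, 0, zero_le_one, fun p _ => by simp⟩
  have hlin : PolyLE S (fun p => -2 * a + b - d - 2 * p.2 + p.1 - 1) (fun _ => 1) := by
    refine ⟨‖-2 * a + b - d - 1‖ + 2, 1, by positivity, fun p _ => ?_⟩
    have e : -2 * a + b - d - 2 * (p.2 : ℂ) + p.1 - 1 =
      (-2 * a + b - d - 1) + (p.1 - 2 * p.2) := by ring
    have h1 : ‖(p.1 : ℂ) - 2 * p.2‖ ≤ p.1 + 2 * p.2 := by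
      refine (norm_sub_le _ _).trans ?_
      rw [norm_mul]
      simp
    beta_reduce
    rw [e]
    refine (norm_add_le _ _).trans ?_
    have h2 := norm_nonneg (-2 * a + b - d - 1)
    have h3 : (0 : ℝ) ≤ p.1 := Nat.cast_nonneg _
    have h4 : (0 : ℝ) ≤ p.2 := Nat.cast_nonneg _
    nlinarith [mul_nonneg h2 h3, mul_nonneg h2 h4]
  have hk : ∀ p ∈ S, p.2 ≤ 3 * (p.1 + p.2) := fun p _ => by omega
  have hn : ∀ p ∈ S, p.1 ≤ 3 * (p.1 + p.2) := fun p _ => by omega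
  have h2n : ∀ p ∈ S, 2 * p.1 ≤ 3 * (p.1 + p.2) := fun p _ => by omega
  have hs : ∀ p ∈ S, 2 * p.2 + p.1 ≤ 3 * (p.1 + p.2) := fun p _ => by omega
  refine ((((((hpow.mul (polyLE_Gamma hk _)).mul (polyLE_Gamma hk _)).mul
    (polyLE_Gamma hn _)).mul hlin).mul (polyLE_Gamma (m := fun p => 2 * p.1) h2n _)).mul
    ((((polyLE_inv_Gamma hn _).mul
    (polyLE_inv_Gamma_sub hn _ h.sin_ne)).mul (polyLE_inv_Gamma hn _)).mul
    (polyLE_inv_Gamma (m := fun p => 2 * p.2 + p.1) hs _))).congr (fun p _ => rfl) (fun p _ => ?_)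
  have : (p.1.factorial : ℝ) ≠ 0 := by exact_mod_cast p.1.factorial_ne_zero
  field_simp

theorem F_eq_common (a b c d : ℂ) (p : ℕ × ℕ) : F a b c d p.1 p.2 =
    (4 ^ p.1 * Complex.Gamma (a + 2 / 3 + p.2) *
      Complex.Gamma (a + d + 1 / 3 + p.2) * Complex.Gamma (2 * a - 2 * b - c + 4 / 3 + p.1) *
      (-2 * a + b - d - 2 * p.2 + p.1 - 1) *
      Complex.Gamma (2 * a - b - c + d + 1 / 2 + (2 * p.1 : ℕ)) *
      ((Complex.Gamma (b + p.1))⁻¹ *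
      (Complex.Gamma (-2 * a + 2 * b + c - 2 * d + 1 / 3 - p.1))⁻¹ *
      (Complex.Gamma (2 * a - 2 * b - c + d + 1 / 2 + p.1))⁻¹ *
      (Complex.Gamma (4 * a - 2 * b - c + 2 * d + 2 + (2 * p.2 + p.1 : ℕ)))⁻¹)) *
    Complex.Gamma (c + 2 * p.2 - 3 * p.1 + 1) *
    ((Complex.Gamma (a - b + p.2 - p.1 + 5 / 3))⁻¹ *
      (Complex.Gamma (a - b + d + p.2 - p.1 + 4 / 3))⁻¹) := by
  rw [F, div_eq_mul_inv]
  simp only [mul_inv]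
  push_cast
  rw [show a + p.2 + 2 / 3 = a + 2 / 3 + p.2 by ring,
    show a + d + p.2 + 1 / 3 = a + d + 1 / 3 + p.2 by ring,
    show 2 * a - 2 * b - c + p.1 + 4 / 3 = 2 * a - 2 * b - c + 4 / 3 + p.1 by ring,
    show 2 * a - b - c + d + 2 * p.1 + 1 / 2 = 2 * a - b - c + d + 1 / 2 + 2 * p.1 by ring,
    show -2 * a + 2 * b + c - 2 * d - p.1 + 1 / 3 = -2 * a + 2 * b + c - 2 * d + 1 / 3 - p.1 by ring,
    show 2 * a - 2 * b - c + d + p.1 + 1 / 2 = 2 * a - 2 * b - c + d + 1 / 2 + p.1 by ring,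
    show 4 * a - 2 * b - c + 2 * d + 2 * p.2 + p.1 + 2 =
      4 * a - 2 * b - c + 2 * d + 2 + (2 * p.2 + p.1) by ring]
  ring

theorem factorial_sq_le (k : ℕ) :
    (4 : ℝ) ^ k * (k.factorial : ℝ) ^ 2 ≤ (2 * k + 1) * (2 * k).factorial := by
  have h1 : ((2 * k).factorial : ℝ) = k.centralBinom * (k.factorial : ℝ) ^ 2 := by
    have h2 : (k.factorial : ℝ) ≠ 0 := by exact_mod_cast k.factorial_ne_zero
    rw [Nat.centralBinom, Nat.cast_choose ℝ (by omega : k ≤ 2 * k), show 2 * k - k = k by omega]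
    field_simp
  have h2 : (4 : ℝ) ^ k ≤ (2 * k + 1) * k.centralBinom := by
    have := Nat.four_pow_le_two_mul_add_one_mul_central_binom k
    exact_mod_cast this
  rw [h1, ← mul_assoc]
  gcongr

theorem factorial_two_mul_le (k : ℕ) :
    ((2 * k).factorial : ℝ) ≤ 4 ^ k * (k.factorial : ℝ) ^ 2 := by
  have h1 : ((2 * k).factorial : ℝ) = k.centralBinom * (k.factorial : ℝ) ^ 2 := by
    have h2 : (k.factorial : ℝ) ≠ 0 := by exact_mod_cast k.factorial_ne_zero
    rw [Nat.centralBinom, Nat.cast_choose ℝ (by omega : k ≤ 2 * k), show 2 * k - k = k by omega]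
    field_simp
  rw [h1]
  gcongr
  exact_mod_cast k.centralBinom_le_four_pow

theorem factorial_add_eq_prod (m n : ℕ) :
    ((m + n).factorial : ℝ) = m.factorial * ∏ i ∈ Finset.range n, ((m : ℝ) + 1 + i) := by
  rw [← Nat.factorial_mul_ascFactorial, Nat.ascFactorial_eq_prod_range]
  push_cast
  rfl

/-- After common factorials are removed, both sides are products of `n` factors. The comparison
`3(i+1)(n+1+i) ≤ 2(2n-m+1+i)(m+1+i)` holds factor by factor for `0 ≤ m ≤ 2n` and `i + 1 ≤ n`. -/
theorem three_pow_mul_factorials_le (n m : ℕ) (hm : m ≤ 2 * n) :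
    (3 : ℝ) ^ n * ((2 * n).factorial * m.factorial * (2 * n - m).factorial) ≤
      2 ^ n * ((3 * n - m).factorial * (m + n).factorial) := by
  have e1 : ((3 * n - m).factorial : ℝ) = (2 * n - m).factorial *
      ∏ i ∈ Finset.range n, (2 * (n : ℝ) - m + 1 + i) := by
    rw [show 3 * n - m = 2 * n - m + n by omega, factorial_add_eq_prod]
    push_cast [hm]
    rfl
  have e2 : ((2 * n).factorial : ℝ) = (∏ i ∈ Finset.range n, ((i : ℝ) + 1)) *
      ∏ i ∈ Finset.range n, ((n : ℝ) + 1 + i) := by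
    rw [show 2 * n = n + n by ring, factorial_add_eq_prod]
    congr 1
    rw [← Finset.prod_range_add_one_eq_factorial]
    push_cast
    rfl
  rw [e1, e2, factorial_add_eq_prod m n]
  have key : (3 : ℝ) ^ n * ((∏ i ∈ Finset.range n, ((i : ℝ) + 1)) *
      ∏ i ∈ Finset.range n, ((n : ℝ) + 1 + i)) ≤
      2 ^ n * ((∏ i ∈ Finset.range n, (2 * (n : ℝ) - m + 1 + i)) *
        ∏ i ∈ Finset.range n, ((m : ℝ) + 1 + i)) := by
    have hpow (x : ℝ) : x ^ n = ∏ i ∈ Finset.range n, x := by simp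
    rw [hpow 3, hpow 2]
    simp only [← Finset.prod_mul_distrib]
    refine Finset.prod_le_prod (fun i _ => by positivity) fun i hi => ?_
    have h1 : (i : ℝ) + 1 ≤ n := by exact_mod_cast Finset.mem_range.mp hi
    have h2 : (m : ℝ) ≤ 2 * n := by exact_mod_cast hm
    have h3 : (0 : ℝ) ≤ m := m.cast_nonneg
    have h4 : (0 : ℝ) ≤ i := i.cast_nonneg
    nlinarith [mul_nonneg h3 (sub_nonneg.mpr h2), mul_nonneg h4 (sub_nonneg.mpr h1)]
  have hp : (0 : ℝ) ≤ m.factorial * (2 * n - m).factorial := by positivity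
  have := mul_le_mul_of_nonneg_right key hp
  linarith

/-- Again factor by factor: `2(n+1+i) ≤ 3n+l+1+i` because `i + 1 ≤ n`. -/
theorem two_pow_mul_factorials_le (n l : ℕ) :
    (2 : ℝ) ^ n * ((2 * n).factorial * (3 * n + l).factorial) ≤
      n.factorial * (4 * n + l).factorial := by
  have e2 : ((2 * n).factorial : ℝ) = n.factorial *
      ∏ i ∈ Finset.range n, ((n : ℝ) + 1 + i) := by
    rw [show 2 * n = n + n by ring, factorial_add_eq_prod]
  rw [show 4 * n + l = 3 * n + l + n by ring, factorial_add_eq_prod (3 * n + l) n, e2]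
  have key : (2 : ℝ) ^ n * ∏ i ∈ Finset.range n, ((n : ℝ) + 1 + i) ≤
      ∏ i ∈ Finset.range n, (((3 * n + l : ℕ) : ℝ) + 1 + i) := by
    have hpow (x : ℝ) : x ^ n = ∏ i ∈ Finset.range n, x := by simp
    rw [hpow 2]
    simp only [← Finset.prod_mul_distrib]
    refine Finset.prod_le_prod (fun i _ => by positivity) fun i hi => ?_
    have h1 : (i : ℝ) + 1 ≤ n := by exact_mod_cast Finset.mem_range.mp hi
    have h3 : (0 : ℝ) ≤ l := l.cast_nonneg
    push_cast
    linarith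
  have hp : (0 : ℝ) ≤ n.factorial * (3 * n + l).factorial := by positivity
  have := mul_le_mul_of_nonneg_right key hp
  linarith

theorem Small.upper_ne {a b c d : ℂ} (h : Small a b c d) :
    (∀ k : ℤ, a - b + 5 / 3 ≠ k) ∧ (∀ k : ℤ, a - b + d + 4 / 3 ≠ k) := by
  obtain ⟨⟨ha, hb⟩, hc, hd⟩ := h.re
  rw [abs_lt] at ha hb hc hd
  constructor <;> refine ne_intCast_of_re (m := 1) ?_ ?_ <;> simp <;> linarith

theorem Small.c_add_one_ne {a b c d : ℂ} (h : Small a b c d) (hc : c ≠ 0) (m : ℤ) :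
    c + 1 ≠ m := by
  intro h0
  refine add_intCast_ne_zero (h.c.trans (by norm_num)) hc (1 - m) ?_
  push_cast
  linear_combination h0

/-- Central binomial bounds replace `k!²` and `(n-k)!²` by `(2k)!/4ᵏ` and `(2n-2k)!/4ⁿ⁻ᵏ` up to
linear factors; then `three_pow_mul_factorials_le` applies with `m = 2k`. -/
theorem polyLE_F_lower {a b c d : ℂ} (h : Small a b c d) (hc : c ≠ 0) :
    PolyLE {p | p.2 < p.1} (fun p => F a b c d p.1 p.2) (fun p => (2 / 3) ^ p.1) := by
  set S : Set (ℕ × ℕ) := {p | p.2 < p.1} with hS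
  have hN : ∀ p ∈ S, 3 * p.1 - 2 * p.2 ≤ 3 * (p.1 + p.2) := fun p _ => by omega
  have hi : ∀ p ∈ S, p.1 - p.2 ≤ 3 * (p.1 + p.2) := fun p _ => by omega
  have main := ((polyLE_common h S).mul
    (polyLE_Gamma_sub (m := fun p => 3 * p.1 - 2 * p.2) hN _ (h.c_add_one_ne hc))).mul
    ((polyLE_inv_Gamma_sub (m := fun p => p.1 - p.2) hi _ h.upper_ne.1).mul
      (polyLE_inv_Gamma_sub (m := fun p => p.1 - p.2) hi _ h.upper_ne.2))
  refine (main.congr (f' := fun p => F a b c d p.1 p.2) ?_ (fun _ _ => rfl)).mono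
    (K := 4) (by norm_num) 2 ?_
  · intro p hp
    have hp' : p.2 < p.1 := hp
    have e1 : ((3 * p.1 - 2 * p.2 : ℕ) : ℂ) = 3 * p.1 - 2 * p.2 := by
      push_cast [show 2 * p.2 ≤ 3 * p.1 by omega]; ring
    have e2 : ((p.1 - p.2 : ℕ) : ℂ) = p.1 - p.2 := by push_cast [hp'.le]; ring
    rw [F_eq_common, e1, e2]
    ring_nf
  · rintro ⟨n, k⟩ hp
    have hp' : k < n := hp
    have h3 := three_pow_mul_factorials_le n (2 * k) (by omega)
    have h4 := factorial_sq_le k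
    have h5 := factorial_sq_le (n - k)
    rw [show 2 * (n - k) = 2 * n - 2 * k by omega] at h5
    have e4 : (4 : ℝ) ^ n = 4 ^ k * 4 ^ (n - k) := by rw [← pow_add]; congr 1; omega
    have e5 : ((n - k : ℕ) : ℝ) = n - k := by push_cast [hp'.le]; ring
    rw [e5] at h5
    have h6 := mul_le_mul h4 h5 (by positivity) (by positivity)
    have hk0 : (0 : ℝ) ≤ k := k.cast_nonneg
    have hkn : (k : ℝ) ≤ n := by exact_mod_cast hp'.le
    have h7 : (2 * (k : ℝ) + 1) * (2 * (n - k) + 1) ≤ 4 * ((n : ℝ) + k + 1) ^ 2 := by nlinarith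
    simp only
    have hA : (0 : ℝ) < (3 * n - 2 * k).factorial * (2 * k + n).factorial := by positivity
    have h8 : (2 * n).factorial * ((2 * k).factorial * (2 * n - 2 * k).factorial : ℝ) ≤
        (2 / 3) ^ n * ((3 * n - 2 * k).factorial * (2 * k + n).factorial) := by
      rw [div_pow, div_mul_eq_mul_div, le_div_iff₀ (by positivity)]
      linarith
    calc _ = ((4 ^ k * (k.factorial : ℝ) ^ 2) * (4 ^ (n - k) * ((n - k).factorial : ℝ) ^ 2)) *
          ((2 * n).factorial / ((3 * n - 2 * k).factorial * (2 * k + n).factorial)) := by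
          rw [e4]; field_simp
      _ ≤ ((2 * (k : ℝ) + 1) * (2 * k).factorial * ((2 * (n - k) + 1) *
          (2 * n - 2 * k).factorial)) *
          ((2 * n).factorial / ((3 * n - 2 * k).factorial * (2 * k + n).factorial)) := by gcongr
      _ = ((2 * (k : ℝ) + 1) * (2 * (n - k) + 1)) *
          ((2 * n).factorial * ((2 * k).factorial * (2 * n - 2 * k).factorial) /
          ((3 * n - 2 * k).factorial * (2 * k + n).factorial)) := by ring
      _ ≤ (4 * ((n : ℝ) + k + 1) ^ 2) * (2 / 3) ^ n := by
          refine mul_le_mul h7 ?_ (by positivity) (by positivity)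
          rw [div_le_iff₀ hA]
          exact h8

/-- The factorials match those of the weight except for two central binomial coefficients, which
equal powers of `4` up to a linear factor. -/
theorem polyLE_F_middle {a b c d : ℂ} (h : Small a b c d) (hc : c ≠ 0) :
    PolyLE {p | p.1 ≤ p.2 ∧ 2 * p.2 ≤ 3 * p.1} (fun p => F a b c d p.1 p.2)
      (fun p => wt p.1 (2 * (p.2 - p.1))) := by
  set S : Set (ℕ × ℕ) := {p | p.1 ≤ p.2 ∧ 2 * p.2 ≤ 3 * p.1} with hS
  have hN : ∀ p ∈ S, 3 * p.1 - 2 * p.2 ≤ 3 * (p.1 + p.2) := fun p _ => by omega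
  have hi : ∀ p ∈ S, p.2 - p.1 ≤ 3 * (p.1 + p.2) := fun p _ => by omega
  have main := ((polyLE_common h S).mul
    (polyLE_Gamma_sub (m := fun p => 3 * p.1 - 2 * p.2) hN _ (h.c_add_one_ne hc))).mul
    ((polyLE_inv_Gamma (m := fun p => p.2 - p.1) hi (a - b + 5 / 3)).mul
      (polyLE_inv_Gamma (m := fun p => p.2 - p.1) hi (a - b + d + 4 / 3)))
  refine (main.congr (f' := fun p => F a b c d p.1 p.2) ?_ (fun _ _ => rfl)).mono
    (K := 4) (by norm_num) 2 ?_
  · intro p hp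
    obtain ⟨hp1, hp2⟩ : p.1 ≤ p.2 ∧ 2 * p.2 ≤ 3 * p.1 := hp
    have e1 : ((3 * p.1 - 2 * p.2 : ℕ) : ℂ) = 3 * p.1 - 2 * p.2 := by
      push_cast [hp2]; ring
    have e2 : ((p.2 - p.1 : ℕ) : ℂ) = p.2 - p.1 := by push_cast [hp1]; ring
    rw [F_eq_common, e1, e2]
    ring_nf
  · rintro ⟨n, k⟩ hp
    obtain ⟨hp1, hp2⟩ : n ≤ k ∧ 2 * k ≤ 3 * n := hp
    simp only
    have h4 := factorial_sq_le k
    have h5 := factorial_two_mul_le (k - n)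
    have e4 : (4 : ℝ) ^ k = 4 ^ n * 4 ^ (k - n) := by rw [← pow_add]; congr 1; omega
    have hw : wt n (2 * (k - n)) = 2 * (2 * n + 1) * (2 * k + 1) * ((2 * n).factorial *
        (2 * k).factorial) / ((2 * (k - n)).factorial * (3 * n - 2 * k).factorial *
          ((2 * k + n + 2) * (2 * k + n + 1) * (2 * k + n).factorial)) := by
      rw [wt_eq (by omega), show n - 2 * (k - n) = 3 * n - 2 * k by omega,
        show 2 * n + 2 * (k - n) + 1 = 2 * k + 1 by omega,
        show 3 * n + 2 * (k - n) + 2 = 2 * k + n + 1 + 1 by omega, Nat.factorial_succ (2 * n),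
        Nat.factorial_succ (2 * k), Nat.factorial_succ (2 * k + n + 1),
        Nat.factorial_succ (2 * k + n)]
      push_cast
      ring
    have h6 : 4 ^ n * (k.factorial : ℝ) ^ 2 * (2 * (k - n)).factorial ≤
        (2 * k + 1) * (2 * k).factorial * ((k - n).factorial : ℝ) ^ 2 := by
      calc _ ≤ 4 ^ n * (k.factorial : ℝ) ^ 2 * (4 ^ (k - n) * ((k - n).factorial : ℝ) ^ 2) := by
            gcongr
        _ = (4 ^ k * (k.factorial : ℝ) ^ 2) * ((k - n).factorial : ℝ) ^ 2 := by rw [e4]; ring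
        _ ≤ _ := by gcongr
    have hk0 : (0 : ℝ) ≤ k := k.cast_nonneg
    have hn0 : (0 : ℝ) ≤ n := n.cast_nonneg
    have h7 : (2 * (k : ℝ) + n + 2) * (2 * k + n + 1) ≤
        4 * ((n : ℝ) + k + 1) ^ 2 * (2 * (2 * n + 1)) := by
      have : (2 * (k : ℝ) + n + 2) * (2 * k + n + 1) ≤ 4 * ((n : ℝ) + k + 1) ^ 2 := by nlinarith
      have h0 : 0 ≤ 4 * ((n : ℝ) + k + 1) ^ 2 := by positivity
      nlinarith
    rw [hw]
    calc _ = (4 ^ n * (k.factorial : ℝ) ^ 2 * (2 * (k - n)).factorial) *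
          ((2 * n).factorial / ((2 * (k - n)).factorial * ((k - n).factorial : ℝ) ^ 2 *
            (3 * n - 2 * k).factorial * (2 * k + n).factorial)) := by field_simp
      _ ≤ ((2 * k + 1) * (2 * k).factorial * ((k - n).factorial : ℝ) ^ 2) *
          ((2 * n).factorial / ((2 * (k - n)).factorial * ((k - n).factorial : ℝ) ^ 2 *
            (3 * n - 2 * k).factorial * (2 * k + n).factorial)) := by gcongr
      _ = ((2 * k + n + 2) * (2 * k + n + 1)) * ((2 * k + 1) * ((2 * n).factorial *
        (2 * k).factorial) / ((2 * (k - n)).factorial * (3 * n - 2 * k).factorial *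
          ((2 * k + n + 2) * (2 * k + n + 1) * (2 * k + n).factorial))) := by field_simp
      _ ≤ (4 * ((n : ℝ) + k + 1) ^ 2 * (2 * (2 * n + 1))) * ((2 * k + 1) * ((2 * n).factorial *
        (2 * k).factorial) / ((2 * (k - n)).factorial * (3 * n - 2 * k).factorial *
          ((2 * k + n + 2) * (2 * k + n + 1) * (2 * k + n).factorial))) := by gcongr
      _ = _ := by ring

/-- Here `2k - 3n ≥ 0`, so the Gamma factor with `c` needs no reflection. The binomial coefficient
supplies the decay in `k` that survives the polynomial loss once `n` is large. -/
theorem polyLE_F_upper {a b c d : ℂ} (h : Small a b c d) :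
    PolyLE {p | 3 * p.1 ≤ 2 * p.2} (fun p => F a b c d p.1 p.2)
      (fun p => (1 / 2) ^ p.1 * ((2 * p.2 - 3 * p.1 + p.1).choose p.1 : ℝ)⁻¹) := by
  set S : Set (ℕ × ℕ) := {p | 3 * p.1 ≤ 2 * p.2} with hS
  have hN : ∀ p ∈ S, 2 * p.2 - 3 * p.1 ≤ 3 * (p.1 + p.2) := fun p _ => by omega
  have hi : ∀ p ∈ S, p.2 - p.1 ≤ 3 * (p.1 + p.2) := fun p _ => by omega
  have main := ((polyLE_common h S).mul
    (polyLE_Gamma (m := fun p => 2 * p.2 - 3 * p.1) hN (c + 1))).mul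
    ((polyLE_inv_Gamma (m := fun p => p.2 - p.1) hi (a - b + 5 / 3)).mul
      (polyLE_inv_Gamma (m := fun p => p.2 - p.1) hi (a - b + d + 4 / 3)))
  refine (main.congr (f' := fun p => F a b c d p.1 p.2) ?_ (fun _ _ => rfl)).mono
    (K := 2) (by norm_num) 1 ?_
  · intro p hp
    have hp2 : 3 * p.1 ≤ 2 * p.2 := hp
    have e1 : ((2 * p.2 - 3 * p.1 : ℕ) : ℂ) = 2 * p.2 - 3 * p.1 := by
      push_cast [hp2]; ring
    have e2 : ((p.2 - p.1 : ℕ) : ℂ) = p.2 - p.1 := by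
      push_cast [show p.1 ≤ p.2 by omega]; ring
    rw [F_eq_common, e1, e2]
    ring_nf
  · rintro ⟨n, k⟩ hp
    have hp2 : 3 * n ≤ 2 * k := hp
    simp only
    obtain ⟨l, hl⟩ := Nat.exists_eq_add_of_le hp2
    have h4 := factorial_sq_le k
    have h5 := factorial_two_mul_le (k - n)
    have e4 : (4 : ℝ) ^ k = 4 ^ n * 4 ^ (k - n) := by rw [← pow_add]; congr 1; omega
    have h6 : 4 ^ n * (k.factorial : ℝ) ^ 2 * (2 * (k - n)).factorial ≤
        (2 * k + 1) * (2 * k).factorial * ((k - n).factorial : ℝ) ^ 2 := by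
      calc _ ≤ 4 ^ n * (k.factorial : ℝ) ^ 2 * (4 ^ (k - n) * ((k - n).factorial : ℝ) ^ 2) := by
            gcongr
        _ = (4 ^ k * (k.factorial : ℝ) ^ 2) * ((k - n).factorial : ℝ) ^ 2 := by rw [e4]; ring
        _ ≤ _ := by gcongr
    have h7 := two_pow_mul_factorials_le n l
    rw [show 2 * (k - n) = l + n by omega, show (2 * k).factorial = (3 * n + l).factorial by rw [hl]]
      at h6
    rw [show 2 * k - 3 * n = l by omega, show 2 * k + n = 4 * n + l by omega,
      Nat.cast_choose ℝ (by omega : n ≤ l + n), show l + n - n = l by omega]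
    have hk0 : (0 : ℝ) ≤ k := k.cast_nonneg
    have hn0 : (0 : ℝ) ≤ n := n.cast_nonneg
    calc _ = (4 ^ n * (k.factorial : ℝ) ^ 2 * (l + n).factorial) *
          ((2 * n).factorial * l.factorial / ((l + n).factorial * ((k - n).factorial : ℝ) ^ 2 *
            (4 * n + l).factorial)) := by field_simp
      _ ≤ ((2 * k + 1) * (3 * n + l).factorial * ((k - n).factorial : ℝ) ^ 2) *
          ((2 * n).factorial * l.factorial / ((l + n).factorial * ((k - n).factorial : ℝ) ^ 2 *
            (4 * n + l).factorial)) := by gcongr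
      _ = ((2 * k + 1) * (1 / 2) ^ n * l.factorial / ((l + n).factorial * (4 * n + l).factorial)) *
          (2 ^ n * ((2 * n).factorial * (3 * n + l).factorial)) := by
          rw [one_div, inv_pow]; field_simp
      _ ≤ ((2 * k + 1) * (1 / 2) ^ n * l.factorial / ((l + n).factorial * (4 * n + l).factorial)) *
          (n.factorial * (4 * n + l).factorial) := by gcongr
      _ = (2 * k + 1) * ((1 / 2) ^ n * (((l + n).factorial : ℝ) / (n.factorial * l.factorial))⁻¹) := by
          rw [inv_div]; field_simp
      _ ≤ _ := by
          gcongr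
          linarith

/-! ### The limit of the sums over `k` -/

/-- The weights `wt n (2 * (k - n))` as a function of `k`, extended by zero. -/
def wtShift (n k : ℕ) : ℝ := if n ≤ k then wt n (2 * (k - n)) else 0

theorem wtShift_nonneg (n k : ℕ) : 0 ≤ wtShift n k := by
  unfold wtShift; split_ifs
  · exact wt_nonneg _ _
  · exact le_rfl

/-- A series over `k ≥ n` whose terms are supported in `n ≤ k ≤ 2 n`. -/
theorem hasSum_shift (n : ℕ) (f : ℕ → ℝ) (hf : ∀ i, n < 2 * i → f i = 0) :
    HasSum (fun k => if n ≤ k then f (k - n) else 0) (∑ i ∈ Finset.range (n + 1), f i) := by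
  have h := hasSum_sum_of_ne_finset_zero (L := SummationFilter.unconditional ℕ) (f := fun k => if n ≤ k then f (k - n) else 0)
    (s := Finset.range (n + (n + 1))) (fun k hk => by
      have : n + (n + 1) ≤ k := by simpa using hk
      simp only [show n ≤ k by omega, if_true]
      exact hf _ (by omega))
  convert h using 1
  rw [Finset.sum_range_add _ n (n + 1)]
  have h0 : ∑ k ∈ Finset.range n, (if n ≤ k then f (k - n) else 0) = 0 :=
    Finset.sum_eq_zero fun k hk => by simp [Nat.not_le.mpr (Finset.mem_range.mp hk)]
  rw [h0, zero_add]
  exact Finset.sum_congr rfl fun i _ => by simp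

theorem hasSum_wtShift (n : ℕ) :
    HasSum (wtShift n) (∑ i ∈ Finset.range (n + 1), wt n (2 * i)) :=
  hasSum_shift n (fun i => wt n (2 * i)) fun _ hi => wt_of_lt hi

theorem sum_wt_even_le_one (n : ℕ) : ∑ i ∈ Finset.range (n + 1), wt n (2 * i) ≤ 1 := by
  rw [← sum_wt n, sum_range_two_mul]
  exact Finset.sum_le_sum fun i _ => le_add_of_nonneg_right (wt_nonneg _ _)

/-- The series `∑ 1/(i+1)²`, started at the index `k₀`. -/
theorem hasSum_shifted_inv_sq (k₀ : ℕ) :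
    HasSum (fun k : ℕ => if k₀ ≤ k then (((k - k₀ : ℕ) : ℝ) + 1)⁻¹ ^ 2 else 0)
      (∑' i : ℕ, ((i : ℝ) + 1)⁻¹ ^ 2) := by
  have hs : Summable (fun i : ℕ => ((i : ℝ) + 1)⁻¹ ^ 2) := by
    have := (summable_nat_add_iff 1).mpr (Real.summable_nat_pow_inv.mpr (one_lt_two))
    refine this.congr fun i => ?_
    push_cast
    rw [inv_pow]
  have h : HasSum (fun i : ℕ => (fun k : ℕ =>
      if k₀ ≤ k then (((k - k₀ : ℕ) : ℝ) + 1)⁻¹ ^ 2 else 0) (i + k₀))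
      (∑' i : ℕ, ((i : ℝ) + 1)⁻¹ ^ 2) := by simpa using hs.hasSum
  have h' := (hasSum_nat_add_iff (f := fun k : ℕ =>
    if k₀ ≤ k then (((k - k₀ : ℕ) : ℝ) + 1)⁻¹ ^ 2 else 0) k₀).mp h
  rwa [Finset.sum_eq_zero fun k hk => by simp [Nat.not_le.mpr (Finset.mem_range.mp hk)],
    add_zero] at h'

/-- By symmetry and monotonicity, `C(l+n, n) ≥ C(l+M+2, M+2) ≥ (l+1)^(M+2)/(M+2)!`. Two powers
beyond `M` leave a summable remainder. -/
theorem succ_pow_div_choose_le {M n : ℕ} (hn : M + 2 ≤ n) (l : ℕ) :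
    ((l : ℝ) + 1) ^ M * ((l + n).choose n : ℝ)⁻¹ ≤ (M + 2).factorial * ((l : ℝ) + 1)⁻¹ ^ 2 := by
  have h1 : ((l : ℝ) + 1) ^ (M + 2) / (M + 2).factorial ≤ (l + n).choose n := by
    have h2 := Nat.pow_le_choose (α := ℝ) (M + 2) (l + (M + 2))
    rw [show l + (M + 2) + 1 - (M + 2) = l + 1 by omega] at h2
    push_cast at h2
    refine h2.trans ?_
    have h3 : (l + (M + 2)).choose (M + 2) ≤ (l + n).choose n := by
      rw [← Nat.choose_symm_add, ← Nat.choose_symm_add (a := l) (b := n)]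
      exact Nat.choose_le_choose l (by omega)
    exact_mod_cast h3
  have hpos : (0 : ℝ) < (l + n).choose n := by exact_mod_cast Nat.choose_pos (by omega)
  have hl : (0 : ℝ) < (l : ℝ) + 1 := by positivity
  rw [← div_eq_mul_inv, div_le_iff₀ hpos, inv_pow]
  rw [div_le_iff₀ (by positivity), pow_add] at h1
  calc ((l : ℝ) + 1) ^ M = (((l : ℝ) + 1) ^ M * ((l : ℝ) + 1) ^ 2) * (((l : ℝ) + 1) ^ 2)⁻¹ := by
        field_simp
    _ ≤ ((l + n).choose n * (M + 2).factorial) * (((l : ℝ) + 1) ^ 2)⁻¹ := by gcongr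
    _ = _ := by ring

/-- The tail `2 k > 3 n` of the series is dominated by a null sequence times `∑ 1/(i+1)²`. -/
theorem exists_norm_F_upper_le {a b c d : ℂ} (h : Small a b c d) : ∃ τ : ℕ → ℝ,
    Tendsto τ atTop (𝓝 0) ∧ (∀ n, 0 ≤ τ n) ∧ ∀ᶠ n in atTop, ∀ k, 3 * n < 2 * k →
      ‖F a b c d n k‖ ≤ τ n * (((k - 3 * n / 2 : ℕ) : ℝ) + 1)⁻¹ ^ 2 := by
  obtain ⟨C, M, hC, H⟩ := polyLE_F_upper h
  refine ⟨fun n => C * (3 ^ M * (M + 2).factorial) * (((n : ℝ) + (1 : ℕ)) ^ M * (1 / 2) ^ n),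
    ?_, fun n => by positivity, ?_⟩
  · simpa using (tendsto_natCast_add_pow_mul_pow 1 M (r := 1 / 2) (by norm_num)
      (by norm_num)).const_mul (C * (3 ^ M * (M + 2).factorial))
  · filter_upwards [eventually_ge_atTop (M + 2)] with n hn k hk
    have h1 := H (n, k) (show 3 * n ≤ 2 * k by omega)
    simp only at h1
    set l := 2 * k - 3 * n with hl
    have hlk : (2 * k : ℝ) = 3 * n + l := by
      have : 2 * k = 3 * n + l := by omega
      exact_mod_cast this
    have hl0 : (0 : ℝ) ≤ l := l.cast_nonneg
    have hn0 : (0 : ℝ) ≤ n := n.cast_nonneg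
    -- Separating `n` from `l` lets `2⁻ⁿ` absorb one polynomial and the binomial coefficient the
    -- other.
    have h2 : (n : ℝ) + k + 1 ≤ 3 * ((n : ℝ) + 1) * ((l : ℝ) + 1) := by nlinarith
    have h3 : ((n : ℝ) + k + 1) ^ M ≤ 3 ^ M * ((n : ℝ) + 1) ^ M * ((l : ℝ) + 1) ^ M := by
      rw [← mul_pow, ← mul_pow]
      gcongr
    have h4 := succ_pow_div_choose_le hn l
    have h5 : ((l : ℝ) + 1)⁻¹ ^ 2 ≤ (((k - 3 * n / 2 : ℕ) : ℝ) + 1)⁻¹ ^ 2 := by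
      have : k - 3 * n / 2 ≤ l := by omega
      have : ((k - 3 * n / 2 : ℕ) : ℝ) ≤ l := by exact_mod_cast this
      gcongr
    calc _ ≤ C * ((n : ℝ) + k + 1) ^ M * ((1 / 2) ^ n * ((l + n).choose n : ℝ)⁻¹) := h1
      _ ≤ C * (3 ^ M * ((n : ℝ) + 1) ^ M * ((l : ℝ) + 1) ^ M) *
          ((1 / 2) ^ n * ((l + n).choose n : ℝ)⁻¹) := by gcongr
      _ = C * 3 ^ M * ((n : ℝ) + 1) ^ M * (1 / 2) ^ n *
          (((l : ℝ) + 1) ^ M * ((l + n).choose n : ℝ)⁻¹) := by ring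
      _ ≤ C * 3 ^ M * ((n : ℝ) + 1) ^ M * (1 / 2) ^ n *
          ((M + 2).factorial * (((k - 3 * n / 2 : ℕ) : ℝ) + 1)⁻¹ ^ 2) := by
          refine mul_le_mul_of_nonneg_left (h4.trans ?_) (by positivity)
          exact mul_le_mul_of_nonneg_left h5 (by positivity)
      _ = _ := by push_cast; ring

theorem exists_norm_F_sub_le {a b c d : ℂ} (h : Small a b c d) (hc : c ≠ 0) {ε : ℝ} (hε : 0 < ε) :
    ∃ δ : ℝ, 0 < δ ∧ ∀ᶠ n : ℕ in atTop, ∀ k, n ≤ k → 2 * k ≤ 3 * n →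
      |(2 * (k - n : ℕ) : ℝ) - (√2 - 1) * n| ≤ δ * n →
      ‖F a b c d n k - 2 * boundaryLimit a b c d * (wt n (2 * (k - n)) : ℝ)‖ ≤
        ε * wt n (2 * (k - n)) := by
  -- This filter on pairs says that `n → ∞` and `k/n → (1+√2)/2`. A limit along it is already
  -- uniform in `k`, and its basis supplies the threshold and `δ`.
  set l : Filter (ℕ × ℕ) := comap Prod.fst atTop ⊓
    comap (fun p : ℕ × ℕ => (p.2 : ℝ) / p.1) (𝓝 ((1 + √2) / 2)) with hl
  have hlim := tendsto_F_mul_inv_wt h hc (l := l) (n := Prod.fst) (k := Prod.snd)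
    (tendsto_comap.mono_left inf_le_left) (tendsto_comap.mono_left inf_le_right)
  have hev := (Metric.tendsto_nhds.mp hlim) ε hε
  have hb : l.HasBasis _ _ := (atTop_basis.comap Prod.fst).inf
    ((Metric.nhds_basis_ball (x := (1 + √2) / 2)).comap (fun p : ℕ × ℕ => (p.2 : ℝ) / p.1))
  obtain ⟨⟨N, δ⟩, ⟨_, hδ⟩, hN⟩ := hb.eventually_iff.mp hev
  simp only at hδ hN
  refine ⟨δ, hδ, ?_⟩
  filter_upwards [eventually_ge_atTop N, eventually_gt_atTop 0] with n hn hn0 k hnk hk hdev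
  have hnR : (0 : ℝ) < n := by exact_mod_cast hn0
  have hmem : dist ((k : ℝ) / n) ((1 + √2) / 2) < δ := by
    rw [Real.dist_eq]
    have e : (k : ℝ) / n - (1 + √2) / 2 =
        ((2 * (k - n : ℕ) : ℝ) - (√2 - 1) * n) / (2 * n) := by
      push_cast [hnk]
      field_simp
      ring
    rw [e, abs_div, abs_of_pos (by positivity : (0 : ℝ) < 2 * n), div_lt_iff₀ (by positivity)]
    have : 0 < δ * n := by positivity
    linarith
  have h1 := hN (x := (n, k)) ⟨hn, hmem⟩
  simp only at h1
  have hw : 0 < wt n (2 * (k - n)) := by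
    rw [wt_eq (by omega)]; positivity
  rw [dist_eq_norm] at h1
  have hwC : ((wt n (2 * (k - n)) : ℝ) : ℂ) ≠ 0 := by exact_mod_cast hw.ne'
  have e : F a b c d n k - 2 * boundaryLimit a b c d * (wt n (2 * (k - n)) : ℝ) =
      (F a b c d n k * ((wt n (2 * (k - n)) : ℝ) : ℂ)⁻¹ - 2 * boundaryLimit a b c d) *
        (wt n (2 * (k - n)) : ℝ) := by
    field_simp
  rw [e, norm_mul, Complex.norm_real, Real.norm_of_nonneg hw.le]
  gcongr

/-- The range `k < n` has `n` terms, so `n * τ n` is the quantity that must vanish. -/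
theorem exists_norm_F_lower_le {a b c d : ℂ} (h : Small a b c d) (hc : c ≠ 0) : ∃ τ : ℕ → ℝ,
    Tendsto (fun n : ℕ => n * τ n) atTop (𝓝 0) ∧ (∀ n, 0 ≤ τ n) ∧ ∀ n k, k < n →
      ‖F a b c d n k‖ ≤ τ n := by
  obtain ⟨C, M, hC, H⟩ := polyLE_F_lower h hc
  refine ⟨fun n => C * 2 ^ M * (((n : ℝ) + (1 : ℕ)) ^ M * (2 / 3) ^ n), ?_,
    fun n => by positivity, fun n k hk => ?_⟩
  · have hlim := (tendsto_natCast_add_pow_mul_pow 1 (M + 1) (r := 2 / 3) (by norm_num)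
      (by norm_num)).const_mul (C * 2 ^ M)
    rw [mul_zero] at hlim
    refine squeeze_zero (fun n => by positivity) (fun n => ?_) hlim
    have h1 : (n : ℝ) ≤ n + (1 : ℕ) := by push_cast; linarith
    calc (n : ℝ) * (C * 2 ^ M * (((n : ℝ) + (1 : ℕ)) ^ M * (2 / 3) ^ n)) ≤
        (n + (1 : ℕ)) * (C * 2 ^ M * (((n : ℝ) + (1 : ℕ)) ^ M * (2 / 3) ^ n)) := by gcongr
      _ = _ := by ring
  · have h1 := H (n, k) hk
    simp only at h1
    have hk' : (k : ℝ) ≤ n := by exact_mod_cast hk.le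
    calc _ ≤ C * ((n : ℝ) + k + 1) ^ M * (2 / 3) ^ n := h1
      _ ≤ C * (2 * ((n : ℝ) + (1 : ℕ))) ^ M * (2 / 3) ^ n := by
          gcongr
          push_cast
          linarith
      _ = _ := by rw [mul_pow]; ring

theorem exists_norm_F_middle_le {a b c d : ℂ} (h : Small a b c d) (hc : c ≠ 0) :
    ∃ (C : ℝ) (M : ℕ), 0 ≤ C ∧ ∀ n k, n ≤ k → 2 * k ≤ 3 * n →
      ‖F a b c d n k‖ ≤ C * (((n : ℝ) + 1) ^ M * wt n (2 * (k - n))) := by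
  obtain ⟨C, M, hC, H⟩ := polyLE_F_middle h hc
  refine ⟨C * 3 ^ M, M, by positivity, fun n k h1 h2 => ?_⟩
  have h3 := H (n, k) ⟨h1, h2⟩
  simp only at h3
  have hk' : (2 * k : ℝ) ≤ 3 * n := by exact_mod_cast h2
  have hn0 : (0 : ℝ) ≤ n := n.cast_nonneg
  have hw := wt_nonneg n (2 * (k - n))
  calc _ ≤ C * ((n : ℝ) + k + 1) ^ M * wt n (2 * (k - n)) := h3
    _ ≤ C * (3 * ((n : ℝ) + 1)) ^ M * wt n (2 * (k - n)) := by
        gcongr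
        linarith
    _ = _ := by rw [mul_pow]; ring

theorem tendsto_tsum_norm_F_sub {a b c d : ℂ} (h : Small a b c d) (hc : c ≠ 0) :
    Tendsto (fun n => ∑' k, (F a b c d n k - 2 * boundaryLimit a b c d * (wtShift n k : ℝ)))
      atTop (𝓝 0) := by
  rw [Metric.tendsto_nhds]
  intro ε hε
  set L := boundaryLimit a b c d
  obtain ⟨δ, hδ, hloc⟩ := exists_norm_F_sub_le h hc (half_pos hε)
  obtain ⟨τ₁, hτ₁, hτ₁0, hlow⟩ := exists_norm_F_lower_le h hc
  obtain ⟨C, M, hC, hmid⟩ := exists_norm_F_middle_le h hc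
  obtain ⟨τ₃, hτ₃, hτ₃0, hup⟩ := exists_norm_F_upper_le h
  set Z : ℝ := ∑' i : ℕ, ((i : ℝ) + 1)⁻¹ ^ 2
  have hsmall := (hτ₁.add ((tendsto_sum_wt_tail hδ M).const_mul (C + ‖2 * L‖))).add
    (hτ₃.mul_const Z)
  rw [mul_zero, zero_mul, add_zero, add_zero] at hsmall
  filter_upwards [hloc, hup, hsmall.eventually (gt_mem_nhds (half_pos hε))] with n hl hu hs
  set T : ℕ → ℝ := fun i =>
    if δ * n < |(2 * i : ℝ) - (√2 - 1) * n| then ((n : ℝ) + 1) ^ M * wt n (2 * i) else 0 with hT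
  have hT0 (i : ℕ) : 0 ≤ T i := by
    rw [hT]
    simp only
    split_ifs
    · exact mul_nonneg (by positivity) (wt_nonneg _ _)
    · exact le_rfl
  have hsum1 : HasSum (fun k : ℕ => if k < n then τ₁ n else 0) (n * τ₁ n) := by
    have := hasSum_sum_of_ne_finset_zero (L := SummationFilter.unconditional ℕ)
      (f := fun k : ℕ => if k < n then τ₁ n else 0)
      (s := Finset.range n) (fun k hk => by simp at hk; simp [hk])
    convert this using 1
    rw [Finset.sum_congr rfl fun k hk => if_pos (Finset.mem_range.mp hk)]
    simp
  have hsum2 := hasSum_shift n T (fun i hi => by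
    rw [hT]; simp only; rw [wt_of_lt hi]; simp)
  have hsum3 := hasSum_shifted_inv_sq (3 * n / 2)
  -- The four majorants cover the terms near the peak, those with `k < n`, those with `n ≤ k ≤ 3n/2`
  -- off the peak, where `F` and the weight are bounded separately, and those with `2k > 3n`.
  have hsum := (((hasSum_wtShift n).mul_left (ε / 2)).add hsum1).add
    ((hsum2.mul_left (C + ‖2 * L‖)).add (hsum3.mul_left (τ₃ n)))
  have hbound (k : ℕ) : ‖F a b c d n k - 2 * L * (wtShift n k : ℝ)‖ ≤
      ε / 2 * wtShift n k + (if k < n then τ₁ n else 0) +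
        ((C + ‖2 * L‖) * (if n ≤ k then T (k - n) else 0) +
        τ₃ n * (if 3 * n / 2 ≤ k then (((k - 3 * n / 2 : ℕ) : ℝ) + 1)⁻¹ ^ 2 else 0)) := by
    have p1 : 0 ≤ ε / 2 * wtShift n k := mul_nonneg (by positivity) (wtShift_nonneg n k)
    have p2 : 0 ≤ if k < n then τ₁ n else 0 := by split_ifs; exacts [hτ₁0 n, le_rfl]
    have p3 : 0 ≤ (C + ‖2 * L‖) * (if n ≤ k then T (k - n) else 0) :=
      mul_nonneg (by positivity) (by split_ifs; exacts [hT0 _, le_rfl])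
    have p4 : 0 ≤ τ₃ n * (if 3 * n / 2 ≤ k then (((k - 3 * n / 2 : ℕ) : ℝ) + 1)⁻¹ ^ 2 else 0) :=
      mul_nonneg (hτ₃0 n) (by split_ifs <;> positivity)
    rcases lt_or_ge k n with hk | hk
    · have e : wtShift n k = 0 := by simp [wtShift, hk]
      have := hlow n k hk
      rw [if_pos hk] at p2 ⊢
      rw [e] at p1 ⊢
      simp only [Complex.ofReal_zero, mul_zero, sub_zero] at p1 ⊢
      linarith
    have ew : wtShift n k = wt n (2 * (k - n)) := by simp [wtShift, hk]
    rcases lt_or_ge (3 * n) (2 * k) with hk3 | hk3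
    · have e : wtShift n k = 0 := by rw [ew]; exact wt_of_lt (by omega)
      have := hu k hk3
      rw [if_pos (show 3 * n / 2 ≤ k by omega)] at p4 ⊢
      rw [e] at p1 ⊢
      simp only [Complex.ofReal_zero, mul_zero, sub_zero] at p1 ⊢
      linarith
    rw [ew] at p1 ⊢
    rw [if_pos hk] at p3 ⊢
    rcases le_or_gt |(2 * (k - n : ℕ) : ℝ) - (√2 - 1) * n| (δ * n) with hd | hd
    · have := hl k hk hk3 hd
      linarith
    · have e : T (k - n) = ((n : ℝ) + 1) ^ M * wt n (2 * (k - n)) := by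
        rw [hT]; simp only; rw [if_pos hd]
      have hw := wt_nonneg n (2 * (k - n))
      have h1 := hmid n k hk hk3
      have h2 : ‖2 * L * (wt n (2 * (k - n)) : ℝ)‖ ≤
          ‖2 * L‖ * (((n : ℝ) + 1) ^ M * wt n (2 * (k - n))) := by
        rw [norm_mul, Complex.norm_real, Real.norm_of_nonneg hw]
        gcongr
        refine le_mul_of_one_le_left hw (one_le_pow₀ ?_)
        linarith [(Nat.cast_nonneg n : (0 : ℝ) ≤ n)]
      have h3 := norm_sub_le (F a b c d n k) (2 * L * (wt n (2 * (k - n)) : ℝ))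
      rw [e] at p3 ⊢
      rw [add_mul] at p3 ⊢
      linarith
  rw [dist_zero_right]
  refine (tsum_of_norm_bounded hsum hbound).trans_lt ?_
  have := sum_wt_even_le_one n
  have h2 : ε / 2 * ∑ i ∈ Finset.range (n + 1), wt n (2 * i) ≤ ε / 2 * 1 := by gcongr
  have hs' : n * τ₁ n + (C + ‖2 * L‖) * ∑ i ∈ Finset.range (n + 1), T i + τ₃ n * Z < ε / 2 := hs
  linarith

theorem tendsto_tsum_F {a b c d : ℂ} (h : Small a b c d) (hc : c ≠ 0) :
    Tendsto (fun n => ∑' k, F a b c d n k) atTop (𝓝 (boundaryLimit a b c d)) := by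
  have h1 := tendsto_tsum_norm_F_sub h hc
  have h2 : Tendsto (fun n : ℕ => 2 * boundaryLimit a b c d *
      ((∑ i ∈ Finset.range (n + 1), wt n (2 * i) : ℝ) : ℂ)) atTop
      (𝓝 (2 * boundaryLimit a b c d * ((1 / 2 : ℝ) : ℂ))) :=
    ((Complex.continuous_ofReal.tendsto _).comp tendsto_sum_wt_even).const_mul _
  have h3 := h1.add h2
  have e : 0 + 2 * boundaryLimit a b c d * ((1 / 2 : ℝ) : ℂ) = boundaryLimit a b c d := by
    push_cast; ring
  rw [e] at h3
  refine h3.congr fun n => ?_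
  have hw := ((Complex.hasSum_ofReal.mpr (hasSum_wtShift n)).mul_left (2 * boundaryLimit a b c d))
  rw [(summable_F h n).tsum_sub hw.summable, hw.tsum_eq]
  ring

/-! ### Normalisation of the telescoped identity -/

/-- The constant relating `F` and its mate to the terms of the four-parameter identity. -/
def scale (a b c d : ℂ) : ℂ :=
  Complex.Gamma (a + 2 / 3) * Complex.Gamma (a + d + 1 / 3) * Complex.Gamma c *
    Complex.Gamma (2 * a - 2 * b - c + 1 / 3) * Complex.Gamma (2 * a - b - c + d + 1 / 2) *
    ((Complex.Gamma (b + 1))⁻¹ * (Complex.Gamma (a - b + 2 / 3))⁻¹ *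
      (Complex.Gamma (-2 * a + 2 * b + c - 2 * d + 1 / 3))⁻¹ *
      (Complex.Gamma (2 * a - 2 * b - c + d + 1 / 2))⁻¹ *
      (Complex.Gamma (a - b + d + 1 / 3))⁻¹ *
      (Complex.Gamma (4 * a - 2 * b - c + 2 * d + 1))⁻¹) / 3

theorem inv_Gamma_sub_eq_poch (z : ℂ) (n : ℕ) :
    (Complex.Gamma (z - n))⁻¹ = (-1) ^ n * poch (1 - z) n * (Complex.Gamma z)⁻¹ := by
  induction n with
  | zero => simp [poch]
  | succ n ih =>
    rw [inv_Gamma_eq (z - (n + 1 : ℕ)) (z - n) (by push_cast; ring), ih, poch_succ]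
    push_cast
    ring

/-- The factors `b`, `c` and `-6a+6b+3c-1` arise from one recurrence step each, in `1/Γ(b)`,
`Γ(c+1)` and `Γ(2a-2b-c+4/3)`; the sign of the last comes from the linear factor of `F`. -/
theorem F_zero_eq {a b c d : ℂ} (h : Small a b c d) (hc : c ≠ 0) (k : ℕ) :
    F a b c d 0 k = scale a b c d *
      (b * c * (-6 * a + 6 * b + 3 * c - 1) * lhsTerm a b c d k) := by
  obtain ⟨⟨ha, hb⟩, hc', hd⟩ := h.re
  rw [abs_lt] at ha hb hc' hd
  have g1 := Gamma_add_natCast (a + 2 / 3) (ne_neg_natCast_of_re_pos (by simp; linarith)) k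
  have g2 := Gamma_add_natCast (a + d + 1 / 3) (ne_neg_natCast_of_re_pos (by simp; linarith)) k
  have g3 := Gamma_add_natCast (c + 1) (ne_neg_natCast_of_re_pos (by simp; linarith)) (2 * k)
  have g4 := Gamma_add_natCast (a - b + 2 / 3) (ne_neg_natCast_of_re_pos (by simp; linarith))
    (k + 1)
  have g5 := Gamma_add_natCast (a - b + d + 1 / 3) (ne_neg_natCast_of_re_pos (by simp; linarith))
    (k + 1)
  have g6 := Gamma_add_natCast (4 * a - 2 * b - c + 2 * d + 1)
    (ne_neg_natCast_of_re_pos (by simp; linarith)) (2 * k + 1)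
  rw [poch_succ] at g6
  have g7 := Gamma_eq (2 * a - 2 * b - c + 1 / 3) (2 * a - 2 * b - c + 4 / 3) (by ring)
    (ne_zero_of_re_pos (by simp; linarith))
  rw [Gamma_eq c (c + 1) rfl hc] at g3
  rw [F_eq_kernel, kernel, lhsTerm, scale]
  simp only [Nat.cast_zero, mul_zero, sub_zero, add_zero, pow_zero, one_mul]
  rw [show a + k + 2 / 3 = a + 2 / 3 + k by ring, g1,
    show a + k + d + 1 / 3 = a + d + 1 / 3 + k by ring, g2,
    show c + 2 * (k : ℂ) + 1 = c + 1 + (2 * k : ℕ) by push_cast; ring, g3,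
    show 2 * (a + k) - 2 * b - (c + 2 * k) + 4 / 3 = 2 * a - 2 * b - c + 4 / 3 by ring, g7,
    show 2 * (a + k) - b - (c + 2 * k) + d + 1 / 2 = 2 * a - b - c + d + 1 / 2 by ring,
    show a + k - b + 5 / 3 = a - b + 2 / 3 + (k + 1 : ℕ) by push_cast; ring, g4,
    show -2 * (a + k) + 2 * b + (c + 2 * k) - 2 * d + 1 / 3 =
      -2 * a + 2 * b + c - 2 * d + 1 / 3 by ring,
    show 2 * (a + k) - 2 * b - (c + 2 * k) + d + 1 / 2 = 2 * a - 2 * b - c + d + 1 / 2 by ring,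
    show a + k - b + d + 4 / 3 = a - b + d + 1 / 3 + (k + 1 : ℕ) by push_cast; ring, g5,
    show 4 * (a + k) - 2 * b - (c + 2 * k) + 2 * d + 2 =
      4 * a - 2 * b - c + 2 * d + 1 + (2 * k + 1 : ℕ) by push_cast; ring, g6,
    inv_Gamma_eq b (b + 1) rfl, div_eq_mul_inv (poch (a + 2 / 3) k * _ * _ * _)]
  push_cast
  simp only [mul_inv]
  rw [show 4 * a - 2 * b - c + 2 * d + 1 + 2 * (k : ℂ) =
    4 * a - 2 * b - c + 2 * d + 2 * k + 1 by ring]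
  ring

theorem P_eq_P_zero (a b c d n : ℂ) : P a (b + n) (c - 3 * n) d 0 = P a b c d n := by
  unfold P; ring

theorem mateTerm_zero_eq {a b c d : ℂ} (h : Small a b c d) (n : ℕ) :
    mateTerm a b c d n 0 = scale a b c d * rhsTerm a b c d n := by
  obtain ⟨⟨ha, hb⟩, hc', hd⟩ := h.re
  rw [abs_lt] at ha hb hc' hd
  have g1 := Gamma_add_natCast (2 * a - 2 * b - c + 1 / 3)
    (ne_neg_natCast_of_re_pos (by simp; linarith)) (n + 1)
  have g2 := Gamma_add_natCast (2 * a - b - c + d + 1 / 2)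
    (ne_neg_natCast_of_re_pos (by simp; linarith)) (2 * n)
  have g3 := Gamma_add_natCast (b + 1) (ne_neg_natCast_of_re_pos (by simp; linarith)) n
  have g4 := Gamma_add_natCast (2 * a - 2 * b - c + d + 1 / 2)
    (ne_neg_natCast_of_re_pos (by simp; linarith)) (n + 1)
  have g5 := Gamma_add_natCast (4 * a - 2 * b - c + 2 * d + 1)
    (ne_neg_natCast_of_re_pos (by simp; linarith)) n
  have g6 := inv_Gamma_sub_eq_poch (a - b + 2 / 3) n
  have g7 := inv_Gamma_sub_eq_poch (-2 * a + 2 * b + c - 2 * d + 1 / 3) n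
  have g8 := inv_Gamma_sub_eq_poch (a - b + d + 1 / 3) n
  have g9 : Complex.Gamma (c - 3 * n - 2) =
      (-1) ^ n * (poch (1 - c) (3 * n + 2))⁻¹ * Complex.Gamma c := by
    have := congrArg Inv.inv (inv_Gamma_sub_eq_poch c (3 * n + 2))
    rw [inv_inv, mul_inv, mul_inv, inv_inv, ← inv_pow, inv_neg, inv_one] at this
    push_cast at this
    rw [show c - 3 * (n : ℂ) - 2 = c - (3 * n + 2) by ring, this,
      show 3 * n + 2 = 2 * (n + 1) + n by ring, pow_add, pow_mul]
    simp
  rw [poch_succ] at g1 g4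
  rw [mateTerm, mate, rhsTerm, scale]
  simp only [Nat.cast_zero, mul_zero, add_zero]
  rw [P_eq_P_zero, g9,
    show 2 * a - 2 * (b + n) - (c - 3 * n) + 4 / 3 =
      2 * a - 2 * b - c + 1 / 3 + (n + 1 : ℕ) by push_cast; ring, g1,
    show 2 * a - (b + n) - (c - 3 * n) + d + 1 / 2 =
      2 * a - b - c + d + 1 / 2 + (2 * n : ℕ) by push_cast; ring, g2,
    show b + (n : ℂ) + 1 = b + 1 + n by ring, g3,
    show a - (b + n) + 2 / 3 = a - b + 2 / 3 - n by ring, g6,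
    show -2 * a + 2 * (b + n) + (c - 3 * n) - 2 * d + 1 / 3 =
      -2 * a + 2 * b + c - 2 * d + 1 / 3 - n by ring, g7,
    show 2 * a - 2 * (b + n) - (c - 3 * n) + d + 3 / 2 =
      2 * a - 2 * b - c + d + 1 / 2 + (n + 1 : ℕ) by push_cast; ring, g4,
    show a - (b + n) + d + 1 / 3 = a - b + d + 1 / 3 - n by ring, g8,
    show 4 * a - 2 * (b + n) - (c - 3 * n) + 2 * d + 1 =
      4 * a - 2 * b - c + 2 * d + 1 + n by ring, g5,
    show 1 - (a - b + 2 / 3) = -a + b + 1 / 3 by ring,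
    show 1 - (-2 * a + 2 * b + c - 2 * d + 1 / 3) = 2 * a - 2 * b - c + 2 * d + 2 / 3 by ring,
    show 1 - (a - b + d + 1 / 3) = -a + b - d + 2 / 3 by ring,
    show -4 * a + 4 * b + 2 * c - 2 * d - 2 * (n : ℂ) - 1 =
      -2 * (2 * a - 2 * b - c + d + 1 / 2 + n) by ring,
    show 6 * a - 6 * b - 3 * c + 3 * (n : ℂ) + 1 = 3 * (2 * a - 2 * b - c + 1 / 3 + n) by ring,
    div_eq_mul_inv (4 ^ n * _ * _ * _ * _ * _ * _ * _)]
  simp only [mul_inv]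
  -- Each of the four Gamma factors whose argument moves left contributes a sign `(-1)^n`.
  have hs : ((-1 : ℂ) ^ n) ^ 4 = 1 := by rw [← pow_mul, mul_comm, pow_mul]; norm_num
  generalize (-1 : ℂ) ^ n = s at *
  generalize Complex.Gamma c = y1
  generalize (poch (1 - c) (3 * n + 2))⁻¹ = y2
  generalize (2 * a - 2 * b - c + d + 1 / 2 + (n : ℂ))⁻¹ = y3
  linear_combination (-(4 : ℂ) ^ n * P a b c d n / 18 * Complex.Gamma (a + 2 / 3) *
    Complex.Gamma (a + d + 1 / 3) * y1 * y2 * y3 *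
    (Complex.Gamma (2 * a - 2 * b - c + 1 / 3) * poch (2 * a - 2 * b - c + 1 / 3) n *
      (2 * a - 2 * b - c + 1 / 3 + n)) *
    (Complex.Gamma (2 * a - b - c + d + 1 / 2) * poch (2 * a - b - c + d + 1 / 2) (2 * n)) *
    ((Complex.Gamma (b + 1))⁻¹ * (poch (b + 1) n)⁻¹) *
    (poch (-a + b + 1 / 3) n * (Complex.Gamma (a - b + 2 / 3))⁻¹) *
    (poch (2 * a - 2 * b - c + 2 * d + 2 / 3) n *
      (Complex.Gamma (-2 * a + 2 * b + c - 2 * d + 1 / 3))⁻¹) *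
    ((Complex.Gamma (2 * a - 2 * b - c + d + 1 / 2))⁻¹ *
      (poch (2 * a - 2 * b - c + d + 1 / 2) n)⁻¹) *
    (poch (-a + b - d + 2 / 3) n * (Complex.Gamma (a - b + d + 1 / 3))⁻¹) *
    ((Complex.Gamma (4 * a - 2 * b - c + 2 * d + 1))⁻¹ *
      (poch (4 * a - 2 * b - c + 2 * d + 1) n)⁻¹)) * hs

theorem Small.Gamma_ne {a b c d : ℂ} (h : Small a b c d) :
    (Complex.Gamma (b + 1) ≠ 0 ∧ Complex.Gamma (1 - c) ≠ 0 ∧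
      Complex.Gamma (a - b + 2 / 3) ≠ 0 ∧ Complex.Gamma (a - b + d + 1 / 3) ≠ 0 ∧
      Complex.Gamma (2 * a - 2 * b - c + d + 1 / 2) ≠ 0 ∧
      Complex.Gamma (4 * a - 2 * b - c + 2 * d + 1) ≠ 0) ∧
    (Complex.Gamma (a + 2 / 3) ≠ 0 ∧ Complex.Gamma (a + d + 1 / 3) ≠ 0 ∧
      Complex.Gamma (2 * a - 2 * b - c + 1 / 3) ≠ 0 ∧
      Complex.Gamma (2 * a - b - c + d + 1 / 2) ≠ 0 ∧
      Complex.Gamma (2 * a - 2 * b - c + 2 * d + 2 / 3) ≠ 0) := by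
  obtain ⟨⟨ha, hb⟩, hc, hd⟩ := h.re
  rw [abs_lt] at ha hb hc hd
  refine ⟨⟨?_, ?_, ?_, ?_, ?_, ?_⟩, ?_, ?_, ?_, ?_, ?_⟩ <;>
    exact Complex.Gamma_ne_zero_of_re_pos (by simp; linarith)

theorem Gamma_ne_zero_of_ne_intCast {z : ℂ} (hz : ∀ k : ℤ, z ≠ k) : Complex.Gamma z ≠ 0 :=
  Complex.Gamma_ne_zero fun m hm => hz (-m) (by push_cast; exact hm)

theorem Small.c_ne {a b c d : ℂ} (h : Small a b c d) (hc : c ≠ 0) (m : ℤ) : c ≠ m := by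
  intro h0
  refine add_intCast_ne_zero (h.c.trans (by norm_num)) hc (-m) ?_
  push_cast
  linear_combination h0

theorem scale_ne_zero {a b c d : ℂ} (h : Small a b c d) (hc : c ≠ 0) : scale a b c d ≠ 0 := by
  obtain ⟨⟨g1, -, g3, g4, g5, g6⟩, k1, k2, k3, k4, -⟩ := h.Gamma_ne
  have g7 := Gamma_ne_zero_of_ne_intCast h.sin_ne
  have g8 := Gamma_ne_zero_of_ne_intCast (h.c_ne hc)
  unfold scale
  simp only [ne_eq, div_eq_zero_iff, mul_eq_zero, inv_eq_zero, g1, g3, g4, g5, g6, g7, g8, k1, k2,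
    k3, k4, or_self, false_or]
  norm_num

/-- Everything cancels except two reflection pairs, which give the cosecant and the sine. -/
theorem scale_mul_gammaTerm {a b c d : ℂ} (h : Small a b c d) :
    scale a b c d * gammaTerm a b c d = boundaryLimit a b c d := by
  obtain ⟨⟨g1, g2, g3, g4, g5, g6⟩, k1, k2, k3, k4, k5⟩ := h.Gamma_ne
  have g7 := Gamma_ne_zero_of_ne_intCast h.sin_ne
  have r1 := Complex.Gamma_mul_Gamma_one_sub c
  have r2 := Complex.Gamma_mul_Gamma_one_sub (-2 * a + 2 * b + c - 2 * d + 1 / 3)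
  rw [show 1 - (-2 * a + 2 * b + c - 2 * d + 1 / 3) = 2 * a - 2 * b - c + 2 * d + 2 / 3 by ring]
    at r2
  have hpi : (Real.pi : ℂ) ≠ 0 := by exact_mod_cast Real.pi_ne_zero
  have e : scale a b c d * gammaTerm a b c d = (4 : ℂ) ^ (-b) *
      ((Complex.Gamma c * Complex.Gamma (1 - c)) *
      (Complex.Gamma (-2 * a + 2 * b + c - 2 * d + 1 / 3) *
        Complex.Gamma (2 * a - 2 * b - c + 2 * d + 2 / 3))⁻¹) := by
    unfold scale gammaTerm
    generalize Complex.Gamma (b + 1) = y1 at g1 ⊢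
    generalize Complex.Gamma (a - b + 2 / 3) = y3 at g3 ⊢
    generalize Complex.Gamma (a - b + d + 1 / 3) = y4 at g4 ⊢
    generalize Complex.Gamma (2 * a - 2 * b - c + d + 1 / 2) = y5 at g5 ⊢
    generalize Complex.Gamma (4 * a - 2 * b - c + 2 * d + 1) = y6 at g6 ⊢
    generalize Complex.Gamma (a + 2 / 3) = x1 at k1 ⊢
    generalize Complex.Gamma (a + d + 1 / 3) = x2 at k2 ⊢
    generalize Complex.Gamma (2 * a - 2 * b - c + 1 / 3) = x3 at k3 ⊢
    generalize Complex.Gamma (2 * a - b - c + d + 1 / 2) = x4 at k4 ⊢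
    generalize Complex.Gamma (2 * a - 2 * b - c + 2 * d + 2 / 3) = x5
    generalize Complex.Gamma (-2 * a + 2 * b + c - 2 * d + 1 / 3) = x6
    field_simp
  rw [e, r1, r2, boundaryLimit, inv_div]
  field_simp

/-! ### Bounds on the summands, uniform in the parameters -/

theorem norm_poch_le_factorial {z : ℂ} (hz : ‖z‖ ≤ 1) (n : ℕ) : ‖poch z n‖ ≤ n.factorial := by
  induction n with
  | zero => simp [poch]
  | succ n ih =>
    have h1 : ‖z + n‖ ≤ n + 1 := by
      refine (norm_add_le _ _).trans ?_
      rw [Complex.norm_natCast]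
      linarith
    rw [poch_succ, norm_mul, Nat.factorial_succ, mul_comm]
    push_cast
    exact mul_le_mul h1 ih (norm_nonneg _) (by positivity)

theorem factorial_le_norm_poch {u : ℂ} (hu : ‖u‖ ≤ 1 / 100) (n : ℕ) :
    (99 / 100) ^ n * n.factorial ≤ ‖poch (1 + u) n‖ := by
  induction n with
  | zero => simp [poch]
  | succ n ih =>
    have h1 : (99 / 100) * ((n : ℝ) + 1) ≤ ‖1 + u + n‖ := by
      have h2 : ((n : ℝ) + 1) - ‖u‖ ≤ ‖1 + u + n‖ := by
        have h3 : ‖((n + 1 : ℕ) : ℂ)‖ = n + 1 := by rw [Complex.norm_natCast]; push_cast; ring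
        rw [← h3, show 1 + u + (n : ℂ) = ((n + 1 : ℕ) : ℂ) - -u by push_cast; ring, ← norm_neg u]
        exact norm_sub_norm_le _ _
      have : (0 : ℝ) ≤ n := n.cast_nonneg
      linarith
    rw [poch_succ, norm_mul, Nat.factorial_succ]
    push_cast
    calc _ = ((99 / 100) ^ n * n.factorial) * ((99 / 100) * ((n : ℝ) + 1)) := by ring
      _ ≤ _ := mul_le_mul ih h1 (by positivity) (norm_nonneg _)

theorem norm_poch_le_norm_poch {z w : ℂ} (h : ∀ j : ℕ, ‖z + j‖ ≤ ‖w + j‖) (n : ℕ) :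
    ‖poch z n‖ ≤ ‖poch w n‖ := by
  rw [poch_eq_prod, poch_eq_prod, norm_prod, norm_prod]
  exact Finset.prod_le_prod (fun _ _ => norm_nonneg _) fun j _ => h j

theorem re_le_norm_add_natCast (w : ℂ) (j : ℕ) : w.re + j ≤ ‖w + j‖ := by
  refine le_trans ?_ (Complex.re_le_norm _)
  simp

/-- A lower bound of rate `5` for `C(3n, n)`, whose true rate is `27/4`; any rate sufficiently above
`4` would serve. -/
theorem three_mul_five_pow_le (n : ℕ) :
    3 * (5 : ℝ) ^ n * (n.factorial * (2 * n).factorial) ≤ 5 * (3 * n).factorial := by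
  induction n with
  | zero => norm_num
  | succ n ih =>
    -- The step inequality fails at `n = 0`. The constants `3` and `5` give equality at `n = 1`,
    -- from where the induction runs.
    rcases Nat.eq_zero_or_pos n with rfl | hn
    · norm_num [Nat.factorial]
    have hn1 : (1 : ℝ) ≤ n := by exact_mod_cast hn
    rw [show 2 * (n + 1) = 2 * n + 1 + 1 by ring, show 3 * (n + 1) = 3 * n + 1 + 1 + 1 by ring]
    simp only [Nat.factorial_succ]
    push_cast
    have h1 : 5 * ((n : ℝ) + 1) * (2 * n + 1 + 1) * (2 * n + 1) ≤
        (3 * n + 1 + 1 + 1) * (3 * n + 1 + 1) * (3 * n + 1) := by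
      nlinarith [mul_nonneg (sub_nonneg.mpr hn1) (sq_nonneg (n : ℝ))]
    calc _ = (3 * (5 : ℝ) ^ n * (n.factorial * (2 * n).factorial)) *
          (5 * ((n : ℝ) + 1) * (2 * n + 1 + 1) * (2 * n + 1)) := by ring
      _ ≤ (5 * (3 * n).factorial) * ((3 * n + 1 + 1 + 1) * (3 * n + 1 + 1) * (3 * n + 1)) :=
          mul_le_mul ih h1 (by positivity) (by positivity)
      _ = _ := by ring

theorem exists_norm_P_le : ∃ K : ℝ, 0 ≤ K ∧ ∀ a b c d : ℂ, Small a b c d → ∀ n : ℕ,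
    ‖P a b c d n‖ ≤ K * ((n : ℝ) + 1) ^ 3 := by
  have hcont (f : ℂ × ℂ × ℂ × ℂ → ℂ) (hf : Continuous f) : ∃ K : ℝ, ∀ a b c d : ℂ,
      Small a b c d → ‖f (a, b, c, d)‖ ≤ K := by
    obtain ⟨K, hK⟩ := (isCompact_closedBall (0 : ℂ × ℂ × ℂ × ℂ) 1).exists_bound_of_continuousOn
      hf.continuousOn
    refine ⟨K, fun a b c d h => hK _ ?_⟩
    simp only [mem_closedBall_zero_iff, Prod.norm_def, sup_le_iff]
    exact ⟨by linarith [h.a], by linarith [h.b], by linarith [h.c], by linarith [h.d]⟩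
  -- As a cubic in `n`, `P` has leading coefficient `198`. The three functions bounded here are its
  -- coefficients of degree `0`, `2` and `1`, the last recovered from `P(1) - P(0)`.
  obtain ⟨K₀, h₀⟩ := hcont (fun p => P p.1 p.2.1 p.2.2.1 p.2.2.2 0) (by unfold P; fun_prop)
  obtain ⟨K₁, h₁⟩ := hcont (fun p => 90 * p.2.2.2 - 198 * p.2.2.1 + 180 * p.1 + 243)
    (by fun_prop)
  obtain ⟨K₂, h₂⟩ := hcont (fun p => P p.1 p.2.1 p.2.2.1 p.2.2.2 1 - P p.1 p.2.1 p.2.2.1 p.2.2.2 0 -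
    (90 * p.2.2.2 - 198 * p.2.2.1 + 180 * p.1 + 243) - 198) (by unfold P; fun_prop)
  have hz : Small 0 0 0 0 := by constructor <;> norm_num
  have k0 := (norm_nonneg _).trans (h₀ 0 0 0 0 hz)
  have k1 := (norm_nonneg _).trans (h₁ 0 0 0 0 hz)
  have k2 := (norm_nonneg _).trans (h₂ 0 0 0 0 hz)
  refine ⟨K₀ + K₁ + K₂ + 198, by positivity, fun a b c d h n => ?_⟩
  have e : P a b c d n = P a b c d 0 + (P a b c d 1 - P a b c d 0 -
      (90 * d - 198 * c + 180 * a + 243) - 198) * n +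
      (90 * d - 198 * c + 180 * a + 243) * n ^ 2 + 198 * n ^ 3 := by
    unfold P; ring
  rw [e]
  refine (norm_add_le _ _).trans ?_
  refine (add_le_add_left (norm_add₃_le) _).trans ?_
  simp only [norm_mul, norm_pow, Complex.norm_natCast]
  have hn : (0 : ℝ) ≤ n := n.cast_nonneg
  have t0 : (1 : ℝ) ≤ ((n : ℝ) + 1) ^ 3 := one_le_pow₀ (by linarith)
  have t1 : (n : ℝ) ≤ ((n : ℝ) + 1) ^ 3 := by nlinarith [sq_nonneg (n : ℝ)]
  have t2 : (n : ℝ) ^ 2 ≤ ((n : ℝ) + 1) ^ 3 := by nlinarith [pow_nonneg hn 3, sq_nonneg (n : ℝ)]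
  have t3 : (n : ℝ) ^ 3 ≤ ((n : ℝ) + 1) ^ 3 := by gcongr; linarith
  have a0 := mul_le_mul (h₀ a b c d h) t0 zero_le_one k0
  have a1 := mul_le_mul (h₂ a b c d h) t1 hn k2
  have a2 := mul_le_mul (h₁ a b c d h) t2 (by positivity) k1
  have a3 : ‖(198 : ℂ)‖ * (n : ℝ) ^ 3 ≤ 198 * ((n : ℝ) + 1) ^ 3 := by
    simp only [Complex.norm_ofNat]; gcongr
  rw [mul_one] at a0
  linarith

theorem Small.norm_comb_le {a b c d : ℂ} (h : Small a b c d) (s t u v : ℂ)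
    (hs : ‖s‖ + ‖t‖ + ‖u‖ + ‖v‖ ≤ 12) : ‖s * a + t * b + u * c + v * d‖ ≤ 12 / 1000 := by
  have h1 : ‖s * a + t * b + u * c + v * d‖ ≤ ‖s‖ * ‖a‖ + ‖t‖ * ‖b‖ + ‖u‖ * ‖c‖ + ‖v‖ * ‖d‖ := by
    simp only [← norm_mul]
    exact (norm_add_le _ _).trans (add_le_add_left norm_add₃_le _)
  have := mul_le_mul_of_nonneg_left h.a.le (norm_nonneg s)
  have := mul_le_mul_of_nonneg_left h.b.le (norm_nonneg t)
  have := mul_le_mul_of_nonneg_left h.c.le (norm_nonneg u)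
  have := mul_le_mul_of_nonneg_left h.d.le (norm_nonneg v)
  linarith

/-- At the origin the terms decay like `(16/27)ⁿ` up to powers of `n`; the crude rate `17/20` leaves
room for perturbed Pochhammer symbols. Uniformity in the parameters is what the Weierstrass theorem
needs. -/
theorem exists_norm_rhsTerm_le : ∃ K : ℝ, 0 ≤ K ∧ ∀ a b c d : ℂ, Small a b c d → ∀ n : ℕ,
    ‖rhsTerm a b c d n‖ ≤ K * (((n : ℝ) + (1 : ℕ)) ^ 4 * (17 / 20) ^ n) := by
  obtain ⟨K, hK, hP⟩ := exists_norm_P_le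
  refine ⟨8 * K, by positivity, fun a b c d h n => ?_⟩
  have hn : (0 : ℝ) ≤ n := n.cast_nonneg
  have e1 : ‖-a + b‖ ≤ 12 / 1000 := by
    have := h.norm_comb_le (-1) 1 0 0 (by simp; norm_num)
    simpa using this
  have e2 : ‖-a + b - d‖ ≤ 12 / 1000 := by
    have := h.norm_comb_le (-1) 1 0 (-1) (by simp; norm_num)
    rwa [show -1 * a + 1 * b + 0 * c + -1 * d = -a + b - d by ring] at this
  have e3 : ‖2 * a - b - c + d‖ ≤ 12 / 1000 := by
    have := h.norm_comb_le 2 (-1) (-1) 1 (by simp; norm_num)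
    rwa [show 2 * a + -1 * b + -1 * c + 1 * d = 2 * a - b - c + d by ring] at this
  have e4 : ‖2 * a - 2 * b - c + 2 * d‖ ≤ 12 / 1000 := by
    have := h.norm_comb_le 2 (-2) (-1) 2 (by simp; norm_num)
    rwa [show 2 * a + -2 * b + -1 * c + 2 * d = 2 * a - 2 * b - c + 2 * d by ring] at this
  have e5 : ‖4 * a - 2 * b - c + 2 * d‖ ≤ 1 / 100 := by
    have h1 : ‖4 * a - 2 * b - c + 2 * d‖ ≤ ‖(4 : ℂ)‖ * ‖a‖ + ‖(2 : ℂ)‖ * ‖b‖ + ‖c‖ +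
        ‖(2 : ℂ)‖ * ‖d‖ := by
      simp only [← norm_mul]
      exact (norm_add_le _ _).trans (add_le_add_left ((norm_sub_le _ _).trans
        (add_le_add_left (norm_sub_le _ _) _)) _)
    simp only [Complex.norm_ofNat] at h1
    linarith [h.a, h.b, h.c, h.d]
  have e6 : ‖2 * a - 2 * b - c‖ ≤ 12 / 1000 := by
    have := h.norm_comb_le 2 (-2) (-1) 0 (by simp; norm_num)
    rwa [show 2 * a + -2 * b + -1 * c + 0 * d = 2 * a - 2 * b - c by ring] at this
  have add_le {w : ℂ} (hw : ‖w‖ ≤ 12 / 1000) (q : ℝ) (hq : 0 ≤ q) (hq1 : q ≤ 9 / 10) :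
      ‖w + (q : ℂ)‖ ≤ 1 := by
    refine (norm_add_le _ _).trans ?_
    rw [Complex.norm_real, Real.norm_of_nonneg hq]
    linarith
  have p1 : ‖poch (-a + b + 1 / 3) n‖ ≤ n.factorial := by
    refine norm_poch_le_factorial ?_ n
    have := add_le e1 (1 / 3) (by norm_num) (by norm_num)
    push_cast at this
    exact this
  have p2 : ‖poch (-a + b - d + 2 / 3) n‖ ≤ n.factorial := by
    refine norm_poch_le_factorial ?_ n
    have := add_le e2 (2 / 3) (by norm_num) (by norm_num)
    push_cast at this
    exact this
  have p3 : ‖poch (2 * a - b - c + d + 1 / 2) (2 * n)‖ ≤ (2 * n).factorial := by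
    refine norm_poch_le_factorial ?_ _
    have := add_le e3 (1 / 2) (by norm_num) (by norm_num)
    push_cast at this
    exact this
  have p4 : ‖poch (2 * a - 2 * b - c + 2 * d + 2 / 3) n‖ ≤ n.factorial := by
    refine norm_poch_le_factorial ?_ n
    have := add_le e4 (2 / 3) (by norm_num) (by norm_num)
    push_cast at this
    exact this
  obtain ⟨⟨ha, hb⟩, hc, hd⟩ := h.re
  rw [abs_lt] at ha hb hc hd
  have p5 : ‖poch (2 * a - 2 * b - c + 1 / 3) n‖ ≤
      ‖poch (2 * a - 2 * b - c + d + 1 / 2) n‖ := by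
    refine norm_poch_le_norm_poch (fun j => ?_) n
    have h1 := re_le_norm_add_natCast (2 * a - 2 * b - c + d + 1 / 2) j
    have h2 : ‖2 * a - 2 * b - c + 1 / 3 + (j : ℂ)‖ ≤ 12 / 1000 + 1 / 3 + j := by
      refine norm_add₃_le.trans ?_
      rw [Complex.norm_natCast]
      have : ‖(1 / 3 : ℂ)‖ = 1 / 3 := by simp
      linarith
    refine h2.trans (le_trans ?_ h1)
    simp
    linarith
  have p5pos : 0 < ‖poch (2 * a - 2 * b - c + d + 1 / 2) n‖ := by
    rw [norm_pos_iff, poch_eq_prod]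
    exact Finset.prod_ne_zero_iff.mpr fun j _ => ne_zero_of_re_pos (by
      have : (0 : ℝ) ≤ j := j.cast_nonneg
      simp
      linarith)
  have q1 := factorial_le_norm_poch (u := b) (by linarith [h.b]) n
  have q2 := factorial_le_norm_poch (u := -c) (by rw [norm_neg]; linarith [h.c]) (3 * n + 2)
  have q3 := factorial_le_norm_poch e5 n
  rw [add_comm] at q1
  rw [← sub_eq_add_neg] at q2
  rw [add_comm 1 (4 * a - 2 * b - c + 2 * d)] at q3
  have l1 : ‖6 * a - 6 * b - 3 * c + 3 * (n : ℂ) + 1‖ ≤ 4 * ((n : ℝ) + 1) := by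
    have h1 : ‖6 * a - 6 * b - 3 * c + 3 * (n : ℂ) + 1‖ ≤
        3 * ‖2 * a - 2 * b - c‖ + 3 * n + 1 := by
      have h2 : ‖(3 : ℂ) * (2 * a - 2 * b - c)‖ = 3 * ‖2 * a - 2 * b - c‖ := by
        rw [norm_mul]; simp
      have h3 : ‖(3 : ℂ) * n‖ = 3 * n := by rw [norm_mul]; simp
      rw [← h2, ← h3, show 6 * a - 6 * b - 3 * c + 3 * (n : ℂ) + 1 =
        3 * (2 * a - 2 * b - c) + 3 * n + 1 by ring]
      exact norm_add₃_le.trans (by simp)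
    linarith
  have l2 : (1 / 2 : ℝ) ≤ ‖-4 * a + 4 * b + 2 * c - 2 * d - 2 * (n : ℂ) - 1‖ := by
    refine le_trans ?_ ((neg_le_abs _).trans (Complex.abs_re_le_norm _))
    simp
    linarith
  have q2' : (99 / 100 : ℝ) ^ (3 * n + 2) * (3 * n).factorial ≤ ‖poch (1 - c) (3 * n + 2)‖ := by
    refine le_trans ?_ q2
    gcongr
    omega
  rw [rhsTerm, norm_div, div_le_iff₀]
  swap
  · rw [norm_pos_iff]
    have n1 : poch (b + 1) n ≠ 0 := norm_pos_iff.mp (lt_of_lt_of_le (by positivity) q1)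
    have n2 : poch (1 - c) (3 * n + 2) ≠ 0 := norm_pos_iff.mp (lt_of_lt_of_le (by positivity) q2)
    have n3 : poch (4 * a - 2 * b - c + 2 * d + 1) n ≠ 0 :=
      norm_pos_iff.mp (lt_of_lt_of_le (by positivity) q3)
    have n4 : -4 * a + 4 * b + 2 * c - 2 * d - 2 * (n : ℂ) - 1 ≠ 0 :=
      norm_pos_iff.mp (lt_of_lt_of_le (by norm_num) l2)
    have n5 := norm_pos_iff.mp p5pos
    exact mul_ne_zero (mul_ne_zero (mul_ne_zero (mul_ne_zero (mul_ne_zero (by norm_num) n1) n2) n4)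
      n5) n3
  simp only [norm_mul, norm_pow]
  have hnum : ‖(4 : ℂ)‖ ^ n * ‖6 * a - 6 * b - 3 * c + 3 * (n : ℂ) + 1‖ * ‖P a b c d n‖ *
      ‖poch (-a + b + 1 / 3) n‖ * ‖poch (2 * a - 2 * b - c + 1 / 3) n‖ *
      ‖poch (-a + b - d + 2 / 3) n‖ * ‖poch (2 * a - b - c + d + 1 / 2) (2 * n)‖ *
      ‖poch (2 * a - 2 * b - c + 2 * d + 2 / 3) n‖ ≤
      4 ^ n * (4 * ((n : ℝ) + 1)) * (K * ((n : ℝ) + 1) ^ 3) * n.factorial *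
      ‖poch (2 * a - 2 * b - c + d + 1 / 2) n‖ * n.factorial * (2 * n).factorial *
      n.factorial := by
    have := hP a b c d h n
    simp only [Complex.norm_ofNat]
    gcongr
  have hden : (9 : ℝ) * ((99 / 100) ^ n * n.factorial) *
      ((99 / 100 : ℝ) ^ (3 * n + 2) * (3 * n).factorial) * (1 / 2) *
      ‖poch (2 * a - 2 * b - c + d + 1 / 2) n‖ * ((99 / 100) ^ n * n.factorial) ≤
      ‖(9 : ℂ)‖ * ‖poch (b + 1) n‖ * ‖poch (1 - c) (3 * n + 2)‖ *
      ‖-4 * a + 4 * b + 2 * c - 2 * d - 2 * (n : ℂ) - 1‖ *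
      ‖poch (2 * a - 2 * b - c + d + 1 / 2) n‖ *
      ‖poch (4 * a - 2 * b - c + 2 * d + 1) n‖ := by
    simp only [Complex.norm_ofNat]
    gcongr
  refine hnum.trans (le_trans ?_ (mul_le_mul_of_nonneg_left hden (by positivity)))
  have h5 := three_mul_five_pow_le n
  -- The rate comes from `4/5 ≤ (17/20)(99/100)⁵`; the power `5n` counts the losses `n + 3n + n` in
  -- the three denominators.
  have h6 : (4 : ℝ) ^ n ≤ (17 / 20) ^ n * (99 / 100) ^ (5 * n) * 5 ^ n := by
    rw [pow_mul, ← mul_pow, ← mul_pow]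
    gcongr
    norm_num
  have h7 : (99 / 100 : ℝ) ^ n * (99 / 100 : ℝ) ^ (3 * n + 2) * (99 / 100 : ℝ) ^ n =
      (99 / 100) ^ (5 * n) * (99 / 100) ^ 2 := by
    rw [← pow_add, ← pow_add, ← pow_add]; congr 1; ring
  have hf : (0 : ℝ) ≤ ‖poch (2 * a - 2 * b - c + d + 1 / 2) n‖ := p5pos.le
  have h8 : (4 : ℝ) ^ n * (n.factorial * (2 * n).factorial) ≤
      (17 / 20) ^ n * (99 / 100) ^ (5 * n) * (5 / 3 * (3 * n).factorial) := by
    calc _ ≤ ((17 / 20) ^ n * (99 / 100) ^ (5 * n) * 5 ^ n) *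
          (n.factorial * (2 * n).factorial : ℝ) := by gcongr
      _ = ((17 / 20) ^ n * (99 / 100) ^ (5 * n)) *
          (5 ^ n * (n.factorial * (2 * n).factorial) : ℝ) := by ring
      _ ≤ _ := by
          refine mul_le_mul_of_nonneg_left ?_ (by positivity)
          linarith
  push_cast
  calc _ = (4 * K * ((n : ℝ) + 1) ^ 4 * ‖poch (2 * a - 2 * b - c + d + 1 / 2) n‖ *
        (n.factorial : ℝ) ^ 2) * ((4 : ℝ) ^ n * (n.factorial * (2 * n).factorial)) := by ring
    _ ≤ (4 * K * ((n : ℝ) + 1) ^ 4 * ‖poch (2 * a - 2 * b - c + d + 1 / 2) n‖ *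
        (n.factorial : ℝ) ^ 2) *
        ((17 / 20) ^ n * (99 / 100) ^ (5 * n) * (5 / 3 * (3 * n).factorial)) := by gcongr
    _ ≤ (4 * K * ((n : ℝ) + 1) ^ 4 * ‖poch (2 * a - 2 * b - c + d + 1 / 2) n‖ *
        (n.factorial : ℝ) ^ 2) *
        ((17 / 20) ^ n * (99 / 100) ^ (5 * n) * (9 * (99 / 100) ^ 2 * (3 * n).factorial)) := by
        gcongr
        norm_num
    _ = 8 * K * ((n + 1) ^ 4 * (17 / 20) ^ n) * (9 * (n.factorial : ℝ) * (3 * n).factorial *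
        (1 / 2) * ‖poch (2 * a - 2 * b - c + d + 1 / 2) n‖ * n.factorial *
        ((99 / 100) ^ (5 * n) * (99 / 100) ^ 2)) := by ring
    _ = _ := by rw [← h7]; ring

theorem summable_rhs_bound (K : ℝ) :
    Summable (fun n : ℕ => K * (((n : ℝ) + (1 : ℕ)) ^ 4 * (17 / 20) ^ n)) := by
  refine Summable.mul_left _ ?_
  have h := (summable_nat_add_iff 1).mpr (summable_pow_mul_geometric_of_norm_lt_one (R := ℝ) 4
    (r := 17 / 20) (by rw [Real.norm_of_nonneg (by norm_num)]; norm_num))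
  refine (h.mul_right (20 / 17)).congr fun n => ?_
  push_cast
  rw [pow_succ (17 / 20 : ℝ)]
  ring

/-- Since `|w + k| ≥ (k+1)/4`, each factor grows by at most `1 + t` with `t = 1/(25(k+1))`, and `(1
+ t)⁸ ≤ 1 + 16t ≤ (k+2)/(k+1)`. The eighth power keeps a growth of `(k+1)^(1/8)` free of fractional
exponents. -/
theorem norm_poch_pow_le {z w : ℂ} (hw : 1 / 4 ≤ w.re) (hzw : ‖z - w‖ ≤ 1 / 100) (k : ℕ) :
    ‖poch z k‖ ^ 8 ≤ ((k : ℝ) + 1) * ‖poch w k‖ ^ 8 := by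
  induction k with
  | zero => simp [poch]
  | succ k ih =>
    have hk : (0 : ℝ) ≤ k := k.cast_nonneg
    obtain ⟨t, ht⟩ : ∃ t : ℝ, t = 1 / (25 * ((k : ℝ) + 1)) := ⟨_, rfl⟩
    have ht0 : 0 ≤ t := by rw [ht]; positivity
    have ht1 : t ≤ 1 / 25 := by
      rw [ht]
      exact one_div_le_one_div_of_le (by norm_num) (by linarith)
    have htk : t * (k + 1) = 1 / 25 := by rw [ht]; field_simp
    have h1 : ‖z + k‖ ≤ ‖w + k‖ * (1 + t) := by
      have h2 := re_le_norm_add_natCast w k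
      have h3 : ‖z + k‖ ≤ ‖w + k‖ + ‖z - w‖ := by
        rw [show z + (k : ℂ) = w + k + (z - w) by ring]
        exact norm_add_le _ _
      have h4 : t * ((k + 1) / 4) ≤ t * ‖w + k‖ := by gcongr; linarith
      linarith
    have h2 : (1 + t) ^ 8 * (k + 1) ≤ k + 1 + 1 := by
      have e1 : (1 + t) ^ 2 ≤ 1 + 3 * t := by nlinarith
      have e2 : (1 + 3 * t) ^ 2 ≤ 1 + 7 * t := by nlinarith
      have e3 : (1 + 7 * t) ^ 2 ≤ 1 + 16 * t := by nlinarith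
      have e4 : (1 + t) ^ 8 ≤ 1 + 16 * t := by
        calc (1 + t) ^ 8 = (((1 + t) ^ 2) ^ 2) ^ 2 := by ring
          _ ≤ ((1 + 3 * t) ^ 2) ^ 2 := by gcongr
          _ ≤ (1 + 7 * t) ^ 2 := by gcongr
          _ ≤ _ := e3
      nlinarith
    rw [poch_succ, poch_succ, norm_mul, norm_mul, mul_pow, mul_pow]
    push_cast
    calc _ ≤ (((k : ℝ) + 1) * ‖poch w k‖ ^ 8) * (‖w + k‖ * (1 + t)) ^ 8 := by gcongr
      _ = ((1 + t) ^ 8 * (k + 1)) * (‖poch w k‖ ^ 8 * ‖w + k‖ ^ 8) := by ring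
      _ ≤ _ := by gcongr

theorem poch_ne_zero_of_re_pos {z : ℂ} (hz : 0 < z.re) (n : ℕ) : poch z n ≠ 0 := by
  rw [poch_eq_prod]
  exact Finset.prod_ne_zero_iff.mpr fun j _ => ne_zero_of_re_pos (by
    have : (0 : ℝ) ≤ j := j.cast_nonneg
    simp
    linarith)

theorem norm_poch_div_pow_le {z w : ℂ} (hw : 1 / 4 ≤ w.re) (hzw : ‖z - w‖ ≤ 1 / 100) (k : ℕ) :
    ‖poch z k / poch w k‖ ^ 8 ≤ (k : ℝ) + 1 := by
  have h0 : poch w k ≠ 0 := poch_ne_zero_of_re_pos (by linarith) k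
  rw [norm_div, div_pow, div_le_iff₀ (by positivity)]
  exact norm_poch_pow_le hw hzw k

/-- Three Pochhammer quotients together cost at most `2√(k+1)`, while the linear factors give
`(k+1)⁻²`. Unlike in `exists_norm_F_le`, the constant does not depend on the parameters, as the
limit `c → 0` and differentiation at the origin require. -/
theorem norm_lhsTerm_le {a b c d : ℂ} (h : Small a b c d) (k : ℕ) :
    ‖lhsTerm a b c d k‖ ≤ 128 * (√((k : ℝ) + (1 : ℕ)) / ((k : ℝ) + (1 : ℕ)) ^ 2) := by
  have hk : (0 : ℝ) ≤ k := k.cast_nonneg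
  obtain ⟨⟨ha, hb⟩, hc, hd⟩ := h.re
  rw [abs_lt] at ha hb hc hd
  have A := norm_poch_div_pow_le (z := a + 2 / 3) (w := a - b + 2 / 3) (by simp; linarith)
    (by rw [show a + 2 / 3 - (a - b + 2 / 3) = b by ring]; linarith [h.b]) k
  have B := norm_poch_div_pow_le (z := a + d + 1 / 3) (w := a - b + d + 1 / 3)
    (by simp; linarith)
    (by rw [show a + d + 1 / 3 - (a - b + d + 1 / 3) = b by ring]; linarith [h.b]) k
  have C := norm_poch_div_pow_le (z := c + 1) (w := 4 * a - 2 * b - c + 2 * d + 1)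
    (by simp; linarith) (by
      rw [show c + 1 - (4 * a - 2 * b - c + 2 * d + 1) = 2 * c + 2 * b - 4 * a - 2 * d by ring]
      have h1 : ‖2 * c + 2 * b - 4 * a - 2 * d‖ ≤ ‖(2 : ℂ)‖ * ‖c‖ + ‖(2 : ℂ)‖ * ‖b‖ +
          ‖(4 : ℂ)‖ * ‖a‖ + ‖(2 : ℂ)‖ * ‖d‖ := by
        simp only [← norm_mul]
        exact (norm_sub_le _ _).trans (add_le_add_left ((norm_sub_le _ _).trans
          (add_le_add_left (norm_add_le _ _) _)) _)
      simp only [Complex.norm_ofNat] at h1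
      linarith [h.a, h.b, h.c, h.d]) (2 * k)
  have l1 : ‖2 * a - b + d + 2 * (k : ℂ) + 1‖ ≤ 2 * (k + 1) := by
    have h1 : ‖2 * a - b + d + 2 * (k : ℂ) + 1‖ ≤ ‖(2 : ℂ)‖ * ‖a‖ + ‖b‖ + ‖d‖ +
        ‖(2 : ℂ)‖ * ‖(k : ℂ)‖ + ‖(1 : ℂ)‖ := by
      simp only [← norm_mul]
      exact (norm_add_le _ _).trans (add_le_add_left ((norm_add_le _ _).trans
        (add_le_add_left ((norm_add_le _ _).trans (add_le_add_left (norm_sub_le _ _) _)) _)) _)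
    simp only [Complex.norm_ofNat, Complex.norm_natCast, norm_one] at h1
    linarith [h.a, h.b, h.d]
  have l2 : ((k : ℝ) + 1) / 2 ≤ ‖4 * a - 2 * b - c + 2 * d + 2 * (k : ℂ) + 1‖ := by
    refine le_trans ?_ (Complex.re_le_norm _)
    simp
    linarith
  have l3 : ((k : ℝ) + 1) / 4 ≤ ‖a - b + 2 / 3 + (k : ℂ)‖ := by
    refine le_trans ?_ (Complex.re_le_norm _)
    simp
    linarith
  have l4 : ((k : ℝ) + 1) / 4 ≤ ‖a - b + d + 1 / 3 + (k : ℂ)‖ := by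
    refine le_trans ?_ (Complex.re_le_norm _)
    simp
    linarith
  have e : lhsTerm a b c d k = (poch (a + 2 / 3) k / poch (a - b + 2 / 3) k) *
      (poch (a + d + 1 / 3) k / poch (a - b + d + 1 / 3) k) *
      (poch (c + 1) (2 * k) / poch (4 * a - 2 * b - c + 2 * d + 1) (2 * k)) *
      ((2 * a - b + d + 2 * (k : ℂ) + 1) / ((4 * a - 2 * b - c + 2 * d + 2 * (k : ℂ) + 1) *
        (a - b + 2 / 3 + (k : ℂ)) * (a - b + d + 1 / 3 + (k : ℂ)))) := by
    rw [lhsTerm, poch_succ, poch_succ]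
    simp only [div_eq_mul_inv, mul_inv]
    ring
  have hABC : ‖(poch (a + 2 / 3) k / poch (a - b + 2 / 3) k) *
      (poch (a + d + 1 / 3) k / poch (a - b + d + 1 / 3) k) *
      (poch (c + 1) (2 * k) / poch (4 * a - 2 * b - c + 2 * d + 1) (2 * k))‖ ≤
      2 * √((k : ℝ) + 1) := by
    rw [norm_mul, norm_mul]
    refine le_of_pow_le_pow_left₀ (n := 8) (by norm_num) (by positivity) ?_
    rw [mul_pow, mul_pow, mul_pow, show (8 : ℕ) = 2 * 4 by rfl, pow_mul √((k : ℝ) + 1),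
      Real.sq_sqrt (by positivity)]
    push_cast at C
    calc _ ≤ ((k : ℝ) + 1) * (k + 1) * (2 * k + 1) := by gcongr
      _ ≤ 2 ^ (2 * 4) * ((k : ℝ) + 1) ^ 3 := by
          rw [show 2 ^ (2 * 4) * ((k : ℝ) + 1) ^ 3 = (k + 1) * (k + 1) * (256 * (k + 1)) by ring]
          gcongr
          linarith
      _ ≤ _ := by
          gcongr
          · linarith
          · norm_num
  rw [e, norm_mul, norm_div, norm_mul _ (a - b + d + 1 / 3 + (k : ℂ)),
    norm_mul _ (a - b + 2 / 3 + (k : ℂ))]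
  push_cast
  calc _ ≤ 2 * √((k : ℝ) + 1) *
        (2 * (k + 1) / (((k : ℝ) + 1) / 2 * ((k + 1) / 4) * ((k + 1) / 4))) := by gcongr
    _ = _ := by field_simp; ring

theorem summable_lhs_bound :
    Summable (fun k : ℕ => 128 * (√((k : ℝ) + (1 : ℕ)) / ((k : ℝ) + (1 : ℕ)) ^ 2)) := by
  refine Summable.mul_left _ ?_
  have h := (summable_nat_add_iff 1).mpr (Real.summable_nat_rpow (p := -(3 / 2)).mpr (by norm_num))
  refine h.congr fun n => ?_
  have hn : (0 : ℝ) < (n : ℝ) + (1 : ℕ) := by positivity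
  push_cast at hn ⊢
  rw [Real.sqrt_eq_rpow, ← Real.rpow_natCast, ← Real.rpow_sub hn]
  norm_num

theorem summable_lhsTerm {a b c d : ℂ} (h : Small a b c d) :
    Summable (fun k : ℕ => lhsTerm a b c d k) :=
  summable_lhs_bound.of_norm_bounded fun k => norm_lhsTerm_le h k

theorem summable_rhsTerm {a b c d : ℂ} (h : Small a b c d) :
    Summable (fun n : ℕ => rhsTerm a b c d n) := by
  obtain ⟨K, -, hK⟩ := exists_norm_rhsTerm_le
  exact (summable_rhs_bound K).of_norm_bounded fun n => hK a b c d h n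

theorem exists_norm_tsum_lhsTerm_le : ∃ K : ℝ, ∀ a b c d : ℂ, Small a b c d →
    ‖∑' k, lhsTerm a b c d k‖ ≤ K :=
  ⟨_, fun _ _ _ _ h => tsum_of_norm_bounded summable_lhs_bound.hasSum
    fun k => norm_lhsTerm_le h k⟩

/-- The four-parameter identity for `c ≠ 0`. -/
theorem tsum_lhsTerm_of_ne_zero {a b c d : ℂ} (h : Small a b c d) (hc : c ≠ 0) :
    b * c * (-6 * a + 6 * b + 3 * c - 1) * ∑' k, lhsTerm a b c d k =
      gammaTerm a b c d + ∑' n, rhsTerm a b c d n := by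
  refine mul_left_cancel₀ (scale_ne_zero h hc) ?_
  rw [mul_add, scale_mul_gammaTerm h, ← tsum_mul_left, ← tsum_mul_left, ← tsum_mul_left]
  simp only [← F_zero_eq h hc, ← mateTerm_zero_eq h]
  have h1 : Summable (fun n : ℕ => mateTerm a b c d n 0) := by
    simp only [mateTerm_zero_eq h]
    exact (summable_rhsTerm h).mul_left _
  have h2 := h1.hasSum.tendsto_sum_nat
  have h3 (N : ℕ) : ∑ n ∈ Finset.range N, mateTerm a b c d n 0 =
      ∑' k, F a b c d 0 k - ∑' k, F a b c d N k := by
    simp only [← tsum_F_sub_tsum_F_succ h hc]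
    exact Finset.sum_range_sub' (fun n => ∑' k, F a b c d n k) N
  simp only [h3] at h2
  have h4 := tendsto_nhds_unique h2 (tendsto_const_nhds.sub (tendsto_tsum_F h hc))
  rw [h4]
  ring

/-! ### Holomorphy in the parameters and the case `c = 0` -/

theorem differentiable_poch (n : ℕ) : Differentiable ℂ (fun z : ℂ => poch z n) :=
  Polynomial.differentiable _

theorem differentiableAt_rhsTerm {a b c d : ℂ → ℂ} {t : ℂ} (ha : DifferentiableAt ℂ a t)
    (hb : DifferentiableAt ℂ b t) (hc : DifferentiableAt ℂ c t) (hd : DifferentiableAt ℂ d t)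
    (h : Small (a t) (b t) (c t) (d t)) (n : ℕ) :
    DifferentiableAt ℂ (fun s => rhsTerm (a s) (b s) (c s) (d s) n) t := by
  have hp {f : ℂ → ℂ} (hf : DifferentiableAt ℂ f t) (m : ℕ) :
      DifferentiableAt ℂ (fun s => poch (f s) m) t :=
    (differentiable_poch m (f t)).fun_comp' t hf
  obtain ⟨⟨ra, rb⟩, rc, rd⟩ := h.re
  rw [abs_lt] at ra rb rc rd
  have hn : (0 : ℝ) ≤ n := n.cast_nonneg
  unfold rhsTerm P
  refine DifferentiableAt.fun_div ?_ ?_ ?_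
  · have := hp (f := fun s => -a s + b s + 1 / 3) (by fun_prop) n
    have := hp (f := fun s => 2 * a s - 2 * b s - c s + 1 / 3) (by fun_prop) n
    have := hp (f := fun s => -a s + b s - d s + 2 / 3) (by fun_prop) n
    have := hp (f := fun s => 2 * a s - b s - c s + d s + 1 / 2) (by fun_prop) (2 * n)
    have := hp (f := fun s => 2 * a s - 2 * b s - c s + 2 * d s + 2 / 3) (by fun_prop) n
    fun_prop
  · have := hp (f := fun s => b s + 1) (by fun_prop) n
    have := hp (f := fun s => 1 - c s) (by fun_prop) (3 * n + 2)
    have := hp (f := fun s => 2 * a s - 2 * b s - c s + d s + 1 / 2) (by fun_prop) n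
    have := hp (f := fun s => 4 * a s - 2 * b s - c s + 2 * d s + 1) (by fun_prop) n
    fun_prop
  · have n1 : poch (b t + 1) n ≠ 0 := poch_ne_zero_of_re_pos (by simp; linarith) n
    have n2 : poch (1 - c t) (3 * n + 2) ≠ 0 := poch_ne_zero_of_re_pos (by simp; linarith) _
    have n3 : poch (2 * a t - 2 * b t - c t + d t + 1 / 2) n ≠ 0 :=
      poch_ne_zero_of_re_pos (by simp; linarith) n
    have n4 : poch (4 * a t - 2 * b t - c t + 2 * d t + 1) n ≠ 0 :=
      poch_ne_zero_of_re_pos (by simp; linarith) n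
    have n5 : -4 * a t + 4 * b t + 2 * c t - 2 * d t - 2 * (n : ℂ) - 1 ≠ 0 := by
      rw [← neg_ne_zero]
      exact ne_zero_of_re_pos (by simp; linarith)
    exact mul_ne_zero (mul_ne_zero (mul_ne_zero (mul_ne_zero (mul_ne_zero (by norm_num) n1) n2) n5)
      n3) n4

theorem differentiableAt_Gamma_comp {f : ℂ → ℂ} {t : ℂ} (hf : DifferentiableAt ℂ f t)
    (h : 0 < (f t).re) : DifferentiableAt ℂ (fun s => Complex.Gamma (f s)) t :=
  (Complex.differentiableAt_Gamma _ (ne_neg_natCast_of_re_pos h)).fun_comp' t hf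

theorem differentiableAt_gammaTerm {a b c d : ℂ → ℂ} {t : ℂ} (ha : DifferentiableAt ℂ a t)
    (hb : DifferentiableAt ℂ b t) (hc : DifferentiableAt ℂ c t) (hd : DifferentiableAt ℂ d t)
    (h : Small (a t) (b t) (c t) (d t)) :
    DifferentiableAt ℂ (fun s => gammaTerm (a s) (b s) (c s) (d s)) t := by
  obtain ⟨-, k1, k2, k3, k4, k5⟩ := h.Gamma_ne
  obtain ⟨⟨ra, rb⟩, rc, rd⟩ := h.re
  rw [abs_lt] at ra rb rc rd
  have h4 : DifferentiableAt ℂ (fun s => (4 : ℂ) ^ (-b s)) t :=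
    DifferentiableAt.const_cpow (by fun_prop) (Or.inl (by norm_num))
  unfold gammaTerm
  refine DifferentiableAt.fun_div ?_ ?_ ?_
  · have := differentiableAt_Gamma_comp (t := t) (f := fun s => b s + 1) (by fun_prop)
      (by simp; linarith)
    have := differentiableAt_Gamma_comp (t := t) (f := fun s => 1 - c s) (by fun_prop)
      (by simp; linarith)
    have := differentiableAt_Gamma_comp (t := t) (f := fun s => a s - b s + 2 / 3) (by fun_prop)
      (by simp; linarith)
    have := differentiableAt_Gamma_comp (t := t) (f := fun s => a s - b s + d s + 1 / 3)
      (by fun_prop) (by simp; linarith)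
    have := differentiableAt_Gamma_comp (t := t)
      (f := fun s => 2 * a s - 2 * b s - c s + d s + 1 / 2) (by fun_prop) (by simp; linarith)
    have := differentiableAt_Gamma_comp (t := t)
      (f := fun s => 4 * a s - 2 * b s - c s + 2 * d s + 1) (by fun_prop) (by simp; linarith)
    fun_prop
  · have := differentiableAt_Gamma_comp (t := t) (f := fun s => a s + 2 / 3) (by fun_prop)
      (by simp; linarith)
    have := differentiableAt_Gamma_comp (t := t) (f := fun s => a s + d s + 1 / 3)
      (by fun_prop) (by simp; linarith)
    have := differentiableAt_Gamma_comp (t := t)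
      (f := fun s => 2 * a s - 2 * b s - c s + 1 / 3) (by fun_prop) (by simp; linarith)
    have := differentiableAt_Gamma_comp (t := t)
      (f := fun s => 2 * a s - b s - c s + d s + 1 / 2) (by fun_prop) (by simp; linarith)
    have := differentiableAt_Gamma_comp (t := t)
      (f := fun s => 2 * a s - 2 * b s - c s + 2 * d s + 2 / 3) (by fun_prop) (by simp; linarith)
    fun_prop
  · exact mul_ne_zero (mul_ne_zero (mul_ne_zero (mul_ne_zero k1 k2) k3) k4) k5

section Family

variable {a b c d : ℂ → ℂ} {U : Set ℂ}

theorem differentiableOn_tsum_rhsTerm (hU : IsOpen U) (ha : Differentiable ℂ a)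
    (hb : Differentiable ℂ b) (hc : Differentiable ℂ c) (hd : Differentiable ℂ d)
    (h : ∀ t ∈ U, Small (a t) (b t) (c t) (d t)) :
    DifferentiableOn ℂ (fun t => ∑' n, rhsTerm (a t) (b t) (c t) (d t) n) U := by
  obtain ⟨K, -, hK⟩ := exists_norm_rhsTerm_le
  exact Complex.differentiableOn_tsum_of_summable_norm (summable_rhs_bound K)
    (fun n t ht => (differentiableAt_rhsTerm (ha t) (hb t) (hc t) (hd t) (h t ht)
      n).differentiableWithinAt) hU fun n t ht => hK _ _ _ _ (h t ht) n

theorem hasSum_deriv_rhsTerm (hU : IsOpen U) (ha : Differentiable ℂ a)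
    (hb : Differentiable ℂ b) (hc : Differentiable ℂ c) (hd : Differentiable ℂ d)
    (h : ∀ t ∈ U, Small (a t) (b t) (c t) (d t)) {t : ℂ} (ht : t ∈ U) :
    HasSum (fun n => deriv (fun t => rhsTerm (a t) (b t) (c t) (d t) n) t)
      (deriv (fun t => ∑' n, rhsTerm (a t) (b t) (c t) (d t) n) t) := by
  obtain ⟨K, -, hK⟩ := exists_norm_rhsTerm_le
  exact Complex.hasSum_deriv_of_summable_norm (summable_rhs_bound K)
    (fun n t ht => (differentiableAt_rhsTerm (ha t) (hb t) (hc t) (hd t) (h t ht)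
      n).differentiableWithinAt) hU (fun n t ht => hK _ _ _ _ (h t ht) n) ht

end Family

/-- The four-parameter identity. -/
theorem tsum_lhsTerm {a b c d : ℂ} (h : Small a b c d) :
    b * c * (-6 * a + 6 * b + 3 * c - 1) * ∑' k, lhsTerm a b c d k =
      gammaTerm a b c d + ∑' n, rhsTerm a b c d n := by
  by_cases hc : c = 0
  swap
  · exact tsum_lhsTerm_of_ne_zero h hc
  subst hc
  have hs (t : ℂ) (ht : t ∈ Metric.ball (0 : ℂ) (1 / 1000)) : Small a b t d :=
    ⟨h.a, h.b, by simpa using ht, h.d⟩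
  have h0 : (0 : ℂ) ∈ Metric.ball (0 : ℂ) (1 / 1000) := by simp
  have h1 : ContinuousAt (fun t => gammaTerm a b t d + ∑' n, rhsTerm a b t d n) 0 :=
    (differentiableAt_gammaTerm (a := fun _ => a) (b := fun _ => b) (c := fun t => t)
      (d := fun _ => d) (by fun_prop) (by fun_prop) (by fun_prop) (by fun_prop)
      (hs 0 h0)).continuousAt.add
    ((differentiableOn_tsum_rhsTerm (a := fun _ => a) (b := fun _ => b) (c := fun t => t)
      (d := fun _ => d) Metric.isOpen_ball (by fun_prop) (by fun_prop) (by fun_prop) (by fun_prop)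
      hs).differentiableAt (Metric.isOpen_ball.mem_nhds h0)).continuousAt
  obtain ⟨K, hK⟩ := exists_norm_tsum_lhsTerm_le
  -- Only boundedness of the inner series is used: the prefactor vanishes with `t`.
  have h2 : Tendsto (fun t => b * t * (-6 * a + 6 * b + 3 * t - 1) * ∑' k, lhsTerm a b t d k)
      (𝓝[≠] 0) (𝓝 0) := by
    refine Tendsto.zero_mul_isBoundedUnder_le (f := fun t : ℂ =>
      b * t * (-6 * a + 6 * b + 3 * t - 1)) ?_ ⟨K, ?_⟩
    · have : Continuous (fun t : ℂ => b * t * (-6 * a + 6 * b + 3 * t - 1)) := by fun_prop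
      have := this.tendsto 0
      simp only [mul_zero, zero_mul] at this
      exact this.mono_left nhdsWithin_le_nhds
    · rw [eventually_map]
      filter_upwards [nhdsWithin_le_nhds (Metric.isOpen_ball.mem_nhds h0)] with t ht
      exact hK _ _ _ _ (hs t ht)
  have h3 : Tendsto (fun t => b * t * (-6 * a + 6 * b + 3 * t - 1) * ∑' k, lhsTerm a b t d k)
      (𝓝[≠] 0) (𝓝 (gammaTerm a b 0 d + ∑' n, rhsTerm a b 0 d n)) := by
    refine (h1.tendsto.mono_left nhdsWithin_le_nhds).congr' ?_
    filter_upwards [nhdsWithin_le_nhds (Metric.isOpen_ball.mem_nhds h0), self_mem_nhdsWithin]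
      with t ht ht0
    exact (tsum_lhsTerm_of_ne_zero (hs t ht) ht0).symm
  rw [← tendsto_nhds_unique h2 h3]
  ring

/-! ### The triplication formula -/

theorem cexp_three_mul_log_three : Complex.exp (3 * Real.log 3) = 27 := by
  rw [show (3 : ℂ) * Real.log 3 = ((3 * Real.log 3 : ℝ) : ℂ) by push_cast; ring,
    ← Complex.ofReal_exp, mul_comm, Real.exp_mul, Real.exp_log (by norm_num)]
  norm_num

/-- The product in the triplication formula of the Gamma function; it is constant. -/
def triple (t : ℂ) : ℂ :=
  Complex.Gamma (t + 1 / 3) * Complex.Gamma (t + 2 / 3) * Complex.Gamma (t + 1) *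
    Complex.exp (3 * Real.log 3 * t) / Complex.Gamma (3 * t + 1)

theorem triple_add_one {t : ℂ} (ht : -(1 / 3) < t.re) : triple (t + 1) = triple t := by
  have n1 : t + 1 / 3 ≠ 0 := ne_zero_of_re_pos (by simp; linarith)
  have n2 : t + 2 / 3 ≠ 0 := ne_zero_of_re_pos (by simp; linarith)
  have n3 : t + 1 ≠ 0 := ne_zero_of_re_pos (by simp; linarith)
  have m1 : 3 * t + 1 ≠ 0 := ne_zero_of_re_pos (by simp; linarith)
  have m2 : 3 * t + 1 + 1 ≠ 0 := ne_zero_of_re_pos (by simp; linarith)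
  have m3 : 3 * t + 1 + 1 + 1 ≠ 0 := ne_zero_of_re_pos (by simp; linarith)
  have hG : Complex.Gamma (3 * t + 1) ≠ 0 :=
    Complex.Gamma_ne_zero_of_re_pos (by simp; linarith)
  unfold triple
  rw [Gamma_eq (t + 1 / 3) (t + 1 + 1 / 3) (by ring) n1,
    Gamma_eq (t + 2 / 3) (t + 1 + 2 / 3) (by ring) n2, Complex.Gamma_add_one (t + 1) n3,
    Gamma_eq (3 * t + 1 + 1 + 1) (3 * (t + 1) + 1) (by ring) m3,
    Complex.Gamma_add_one _ m2, Complex.Gamma_add_one _ m1, mul_add, mul_one, Complex.exp_add,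
    cexp_three_mul_log_three,
    div_eq_div_iff (mul_ne_zero m3 (mul_ne_zero m2 (mul_ne_zero m1 hG))) hG]
  ring

theorem triple_add_natCast {t : ℂ} (ht : -(1 / 3) < t.re) (n : ℕ) :
    triple (t + n) = triple t := by
  induction n with
  | zero => simp
  | succ n ih =>
    push_cast
    rw [← add_assoc, triple_add_one, ih]
    have : (0 : ℝ) ≤ n := n.cast_nonneg
    simp
    linarith

/-- By periodicity `triple t = triple (t + n)`, and the Gamma asymptotics compare the latter with a
sequence free of `t`. This forces `triple` to be constant. -/
theorem tendsto_triple {t : ℂ} (ht : -(1 / 3) < t.re) :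
    Tendsto (fun n : ℕ => triple t * (9 * 27 ^ n * ((n : ℂ) + 1) * (n.factorial : ℂ) ^ 3 /
      (3 * n + 2).factorial)⁻¹) atTop (𝓝 1) := by
  have h1 := tendsto_Gamma_add_natCast (t + 1 / 3)
  have h2 := tendsto_Gamma_add_natCast (t + 2 / 3)
  have h3 := tendsto_Gamma_add_natCast (t + 1)
  -- The split `3(t+n) + 1 = (3t-1) + (3n+2)` makes the base of the power `3n + 3 = 3(n+1)`, which
  -- separates into powers of `3` and of `n + 1`.
  have h4 := (tendsto_Gamma_add_natCast (3 * t - 1)).comp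
    (tendsto_atTop_mono (fun n : ℕ => (by omega : n ≤ 3 * n + 2)) tendsto_id)
  have h5 := ((h1.mul h2).mul h3).div h4 one_ne_zero
  simp only [mul_one, div_one] at h5
  refine h5.congr fun n => ?_
  rw [← triple_add_natCast ht n]
  have hn : ((n : ℂ) + 1) ≠ 0 := by exact_mod_cast Nat.succ_ne_zero n
  have e4 : (((3 * n + 2 : ℕ) : ℂ) + 1) ^ (3 * t - 1 - 1) =
      Complex.exp (3 * Real.log 3 * t) / 9 * ((n : ℂ) + 1) ^ (3 * t - 2) := by
    rw [show ((3 * n + 2 : ℕ) : ℂ) + 1 = (3 : ℕ) * (n + 1 : ℕ) by push_cast; ring,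
      Complex.natCast_mul_natCast_cpow, show 3 * t - 1 - 1 = 3 * t - 2 by ring]
    push_cast
    congr 1
    rw [Complex.cpow_sub _ _ (by norm_num), Complex.cpow_def_of_ne_zero (by norm_num),
      Complex.ofReal_log (by norm_num)]
    norm_num
    ring_nf
  have e5 : ((n : ℂ) + 1) ^ (t + 1 / 3 - 1) * ((n : ℂ) + 1) ^ (t + 2 / 3 - 1) *
      ((n : ℂ) + 1) ^ (t + 1 - 1) = ((n : ℂ) + 1) ^ (3 * t - 2) * (n + 1) := by
    rw [← Complex.cpow_add _ _ hn, ← Complex.cpow_add _ _ hn]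
    conv_rhs => rhs; rw [← Complex.cpow_one ((n : ℂ) + 1)]
    rw [← Complex.cpow_add _ _ hn]
    congr 1
    ring
  have e6 : Complex.exp (3 * Real.log 3 * (t + n)) = Complex.exp (3 * Real.log 3 * t) * 27 ^ n := by
    rw [mul_add, Complex.exp_add, mul_comm _ (n : ℂ), Complex.exp_nat_mul,
      cexp_three_mul_log_three]
  have hx := Complex.exp_ne_zero (3 * Real.log 3 * t)
  have hp : ((n : ℂ) + 1) ^ (3 * t - 2) ≠ 0 := by
    rw [Complex.cpow_ne_zero_iff]; exact Or.inl hn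
  have hf : (n.factorial : ℂ) ≠ 0 := by exact_mod_cast n.factorial_ne_zero
  have hf' : ((3 * n + 2).factorial : ℂ) ≠ 0 := by exact_mod_cast (3 * n + 2).factorial_ne_zero
  have hG : Complex.Gamma (3 * (t + n) + 1) ≠ 0 :=
    Complex.Gamma_ne_zero_of_re_pos (by
      have : (0 : ℝ) ≤ n := n.cast_nonneg
      simp
      linarith)
  simp only [Pi.div_apply, Function.comp_apply]
  rw [e4, triple, e6, show 3 * t - 1 + ((3 * n + 2 : ℕ) : ℂ) = 3 * (t + n) + 1 by push_cast; ring,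
    div_mul_div_comm, div_mul_div_comm, div_div_div_eq,
    show (n.factorial : ℂ) * ((n : ℂ) + 1) ^ (t + 1 / 3 - 1) *
      (n.factorial * ((n : ℂ) + 1) ^ (t + 2 / 3 - 1)) *
      (n.factorial * ((n : ℂ) + 1) ^ (t + 1 - 1)) =
      (n.factorial : ℂ) ^ 3 * (((n : ℂ) + 1) ^ (t + 1 / 3 - 1) * ((n : ℂ) + 1) ^ (t + 2 / 3 - 1) *
        ((n : ℂ) + 1) ^ (t + 1 - 1)) by ring, e5,
    show t + 1 / 3 + (n : ℂ) = t + n + 1 / 3 by ring,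
    show t + 2 / 3 + (n : ℂ) = t + n + 2 / 3 by ring,
    show t + 1 + (n : ℂ) = t + n + 1 by ring]
  have h27 : (27 : ℂ) ^ n ≠ 0 := pow_ne_zero _ (by norm_num)
  generalize (27 : ℂ) ^ n = y27 at *
  generalize ((n : ℂ) + 1) ^ (3 * t - 2) = yp at *
  generalize Complex.exp (3 * Real.log 3 * t) = yx at *
  field_simp

theorem triple_zero_ne_zero : triple 0 ≠ 0 := by
  have g1 : Complex.Gamma (1 / 3) ≠ 0 := Complex.Gamma_ne_zero_of_re_pos (by simp)
  have g2 : Complex.Gamma (2 / 3) ≠ 0 := Complex.Gamma_ne_zero_of_re_pos (by simp)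
  simp [triple] at g1 g2 ⊢
  exact ⟨g1, g2⟩

theorem triple_eq {t : ℂ} (ht : -(1 / 3) < t.re) : triple t = triple 0 := by
  have h1 := (tendsto_triple ht).const_mul (triple 0)
  have h2 := (tendsto_triple (t := 0) (by simp)).const_mul (triple t)
  rw [mul_one] at h1 h2
  exact tendsto_nhds_unique h2 (h1.congr fun n => by ring)

/-! ### Logarithmic derivatives at the origin -/

/-- `f` is differentiable at `t` with derivative `f t * l`: the logarithmic derivative is `l`. -/
def HasLogDerivAt (f : ℂ → ℂ) (l t : ℂ) : Prop := HasDerivAt f (f t * l) t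

namespace HasLogDerivAt

theorem const (x t : ℂ) : HasLogDerivAt (fun _ => x) 0 t := by
  rw [HasLogDerivAt, mul_zero]
  exact hasDerivAt_const _ _

theorem of_hasDerivAt {f : ℂ → ℂ} {f' t : ℂ} (hf : HasDerivAt f f' t) (h0 : f t ≠ 0) :
    HasLogDerivAt f (f' / f t) t := by
  rwa [HasLogDerivAt, mul_div_cancel₀ _ h0]

theorem mul {f g : ℂ → ℂ} {l m t : ℂ} (hf : HasLogDerivAt f l t) (hg : HasLogDerivAt g m t) :
    HasLogDerivAt (fun s => f s * g s) (l + m) t :=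
  (HasDerivAt.fun_mul hf hg).congr_deriv (by ring)

theorem div {f g : ℂ → ℂ} {l m t : ℂ} (hf : HasLogDerivAt f l t) (hg : HasLogDerivAt g m t)
    (h0 : g t ≠ 0) : HasLogDerivAt (fun s => f s / g s) (l - m) t :=
  (HasDerivAt.fun_div hf hg h0).congr_deriv (by field_simp)

theorem linear {f : ℂ → ℂ} {m q : ℂ} (hf : ∀ t, f t = m * t + q) (hq : q ≠ 0) :
    HasLogDerivAt f (m / q) 0 := by
  obtain rfl : f = fun t => m * t + q := funext hf
  have h := ((hasDerivAt_id (0 : ℂ)).const_mul m).add_const q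
  simp only [id, mul_one] at h
  simpa using of_hasDerivAt h (by simpa using hq)

theorem poch {f : ℂ → ℂ} {m q : ℂ} (hf : ∀ t, f t = m * t + q) (hq : 0 < q.re) (n : ℕ) :
    HasLogDerivAt (fun t => poch (f t) n) (m * ∑ j ∈ Finset.range n, (q + j)⁻¹) 0 := by
  induction n with
  | zero => simpa [SunSeries.poch] using const 1 0
  | succ n ih =>
    simp only [poch_succ, Finset.sum_range_succ]
    rw [mul_add m]
    refine ih.mul ?_
    rw [← div_eq_mul_inv]
    refine linear (fun t => by rw [hf]; ring) (ne_zero_of_re_pos ?_)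
    have : (0 : ℝ) ≤ n := n.cast_nonneg
    simp
    linarith

theorem gamma {f : ℂ → ℂ} {m q : ℂ} (hf : ∀ t, f t = m * t + q) (hq : 0 < q.re) :
    HasLogDerivAt (fun t => Complex.Gamma (f t)) (m * Complex.digamma q) 0 := by
  obtain rfl : f = fun t => m * t + q := funext hf
  have h := ((hasDerivAt_id (0 : ℂ)).const_mul m).add_const q
  simp only [id, mul_one] at h
  have hG := (Complex.differentiableAt_Gamma q (ne_neg_natCast_of_re_pos hq)).hasDerivAt
  have e : q = m * 0 + q := by ring
  rw [e] at hG
  have h2 := hG.comp (0 : ℂ) h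
  refine h2.congr_deriv ?_
  have h0 : Complex.Gamma q ≠ 0 := Complex.Gamma_ne_zero_of_re_pos hq
  rw [Complex.digamma_def, logDeriv_apply]
  simp only [mul_zero, zero_add]
  field_simp

end HasLogDerivAt

/-- Along the line `P` is a cubic polynomial in `t`: its constant term is `(3n+2)(66n²+37n+4)`, and
the numerator is its linear coefficient. -/
theorem hasLogDerivAt_P (α β γ : ℂ) (n : ℕ) :
    HasLogDerivAt (fun t => P (α * t) (β * t) (γ * t) 0 n)
      (((180 * (n : ℂ) ^ 2 + 252 * n + 68) * α - (54 * n + 16) * β -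
        (198 * (n : ℂ) ^ 2 + 180 * n + 34) * γ) / ((3 * n + 2) * (66 * (n : ℂ) ^ 2 + 37 * n + 4)))
      0 := by
  have hP0 : P (α * 0) (β * 0) (γ * 0) 0 n = (3 * n + 2) * (66 * (n : ℂ) ^ 2 + 37 * n + 4) := by
    unfold P; ring
  have h0 : (3 * n + 2) * (66 * (n : ℂ) ^ 2 + 37 * n + 4) ≠ 0 := by
    refine mul_ne_zero ?_ ?_
    · exact_mod_cast (by omega : 3 * n + 2 ≠ 0)
    · exact_mod_cast (by omega : 66 * n ^ 2 + 37 * n + 4 ≠ 0)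
  have hd (p₀ p₁ p₂ p₃ : ℂ) :
      HasDerivAt (fun t : ℂ => p₀ + p₁ * t + p₂ * t ^ 2 + p₃ * t ^ 3) p₁ 0 := by
    have h1 := (hasDerivAt_id (0 : ℂ)).const_mul p₁
    have h2 := (hasDerivAt_pow 2 (0 : ℂ)).const_mul p₂
    have h3 := (hasDerivAt_pow 3 (0 : ℂ)).const_mul p₃
    exact (((h1.const_add p₀).add h2).add h3).congr_deriv (by simp)
  have h := HasLogDerivAt.of_hasDerivAt (f := fun t => P (α * t) (β * t) (γ * t) 0 n)
    ((hd (P 0 0 0 0 n) ((180 * (n : ℂ) ^ 2 + 252 * n + 68) * α - (54 * n + 16) * β -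
      (198 * (n : ℂ) ^ 2 + 180 * n + 34) * γ)
      ((90 * n + 45) * γ ^ 2 + (144 * n + 90) * β * γ + (216 * n + 108) * β ^ 2 -
        (288 * n + 180) * α * γ - (504 * n + 288) * α * β + (288 * n + 180) * α ^ 2)
      (-18 * γ ^ 3 - 72 * β * γ ^ 2 - 144 * β ^ 2 * γ - 72 * β ^ 3 + 108 * α * γ ^ 2 +
        360 * α * β * γ + 288 * α * β ^ 2 - 216 * α ^ 2 * γ - 360 * α ^ 2 * β +
        144 * α ^ 3)).congr_of_eventuallyEq
      (Eventually.of_forall fun t => by unfold P; ring)) (by rw [hP0]; exact h0)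
  rwa [hP0] at h

/-- The logarithmic derivative at the origin of `rhsTerm` along `(α, β, γ, 0)`. -/
def rhsLogDeriv (α β γ : ℂ) (n : ℕ) : ℂ :=
  0 + (6 * α - 6 * β - 3 * γ) / (3 * n + 1) +
    ((180 * (n : ℂ) ^ 2 + 252 * n + 68) * α - (54 * n + 16) * β -
      (198 * (n : ℂ) ^ 2 + 180 * n + 34) * γ) / ((3 * n + 2) * (66 * (n : ℂ) ^ 2 + 37 * n + 4)) +
    (β - α) * ∑ j ∈ Finset.range n, ((1 / 3 : ℂ) + j)⁻¹ +
    (2 * α - 2 * β - γ) * ∑ j ∈ Finset.range n, ((1 / 3 : ℂ) + j)⁻¹ +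
    (β - α) * ∑ j ∈ Finset.range n, ((2 / 3 : ℂ) + j)⁻¹ +
    (2 * α - β - γ) * ∑ j ∈ Finset.range (2 * n), ((1 / 2 : ℂ) + j)⁻¹ +
    (2 * α - 2 * β - γ) * ∑ j ∈ Finset.range n, ((2 / 3 : ℂ) + j)⁻¹ -
    (0 + β * ∑ j ∈ Finset.range n, ((1 : ℂ) + j)⁻¹ +
      -γ * ∑ j ∈ Finset.range (3 * n + 2), ((1 : ℂ) + j)⁻¹ +
      (-4 * α + 4 * β + 2 * γ) / (-2 * n - 1) +
      (2 * α - 2 * β - γ) * ∑ j ∈ Finset.range n, ((1 / 2 : ℂ) + j)⁻¹ +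
      (4 * α - 2 * β - γ) * ∑ j ∈ Finset.range n, ((1 : ℂ) + j)⁻¹)

/-- The terms of `rhsLogDeriv`, including the zeros from constant factors, are arranged exactly as
the product and quotient rules produce them. -/
theorem hasLogDerivAt_rhsTerm (α β γ : ℂ) (n : ℕ) :
    HasLogDerivAt (fun t => rhsTerm (α * t) (β * t) (γ * t) 0 n) (rhsLogDeriv α β γ n) 0 := by
  have hl : -2 * (n : ℂ) - 1 ≠ 0 := by
    rw [← neg_ne_zero, show -(-2 * (n : ℂ) - 1) = 2 * n + 1 by ring]
    exact_mod_cast (by omega : 2 * n + 1 ≠ 0)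
  have hl' : 3 * (n : ℂ) + 1 ≠ 0 := by exact_mod_cast (by omega : 3 * n + 1 ≠ 0)
  unfold rhsTerm rhsLogDeriv
  refine HasLogDerivAt.div
    ((((((((HasLogDerivAt.const _ _).mul (.linear (fun t => ?_) hl')).mul
      (hasLogDerivAt_P α β γ n)).mul
      (.poch (fun t => ?_) (by simp) n)).mul (.poch (fun t => ?_) (by simp) n)).mul
      (.poch (fun t => ?_) (by simp) n)).mul (.poch (fun t => ?_) (by simp) (2 * n))).mul
      (.poch (fun t => ?_) (by simp) n))
    ((((((HasLogDerivAt.const _ _).mul (.poch (fun t => ?_) (by simp) n)).mul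
      (.poch (fun t => ?_) (by simp) (3 * n + 2))).mul (.linear (fun t => ?_) hl)).mul
      (.poch (fun t => ?_) (by simp) n)).mul (.poch (fun t => ?_) (by simp) n)) ?_
  any_goals ring1
  have n1 : poch (1 : ℂ) n ≠ 0 := poch_ne_zero_of_re_pos (by simp) n
  have n2 : poch (1 : ℂ) (3 * n + 2) ≠ 0 := poch_ne_zero_of_re_pos (by simp) _
  have n3 : poch (1 / 2 : ℂ) n ≠ 0 := poch_ne_zero_of_re_pos (by simp) n
  simp only [mul_zero, zero_add, sub_zero, add_zero]
  exact mul_ne_zero (mul_ne_zero (mul_ne_zero (mul_ne_zero (mul_ne_zero (by norm_num) n1) n2)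
    (by rwa [zero_sub, ← neg_mul]))
      n3) n1

/-- The logarithmic derivative at the origin of `gammaTerm` along `(α, β, γ, 0)`. -/
def gammaLogDeriv (α β γ : ℂ) : ℂ :=
  0 + -β * Complex.log 4 + β * Complex.digamma 1 + -γ * Complex.digamma 1 +
    (α - β) * Complex.digamma (2 / 3) + (α - β) * Complex.digamma (1 / 3) +
    (2 * α - 2 * β - γ) * Complex.digamma (1 / 2) + (4 * α - 2 * β - γ) * Complex.digamma 1 -
    (α * Complex.digamma (2 / 3) + α * Complex.digamma (1 / 3) +
      (2 * α - 2 * β - γ) * Complex.digamma (1 / 3) +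
      (2 * α - β - γ) * Complex.digamma (1 / 2) +
      (2 * α - 2 * β - γ) * Complex.digamma (2 / 3))

theorem hasLogDerivAt_gammaTerm (α β γ : ℂ) :
    HasLogDerivAt (fun t => gammaTerm (α * t) (β * t) (γ * t) 0) (gammaLogDeriv α β γ) 0 := by
  have h4 : HasLogDerivAt (fun t => (4 : ℂ) ^ (-(β * t))) (-β * Complex.log 4) 0 := by
    have h := ((hasDerivAt_id (0 : ℂ)).const_mul β).neg.const_cpow (c := 4)
      (Or.inl (by norm_num))
    exact h.congr_deriv (by simp; ring)
  unfold gammaTerm gammaLogDeriv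
  refine HasLogDerivAt.div
    ((((((((HasLogDerivAt.const _ _).mul h4).mul (.gamma (fun t => ?_) (by simp))).mul
      (.gamma (fun t => ?_) (by simp))).mul (.gamma (fun t => ?_) (by simp))).mul
      (.gamma (fun t => ?_) (by simp))).mul (.gamma (fun t => ?_) (by simp))).mul
      (.gamma (fun t => ?_) (by simp)))
    (((((HasLogDerivAt.gamma (fun t => ?_) (by simp)).mul
      (.gamma (fun t => ?_) (by simp))).mul (.gamma (fun t => ?_) (by simp))).mul
      (.gamma (fun t => ?_) (by simp))).mul (.gamma (fun t => ?_) (by simp))) ?_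
  any_goals ring1
  have n1 : Complex.Gamma (1 / 3 : ℂ) ≠ 0 := Complex.Gamma_ne_zero_of_re_pos (by simp)
  have n2 : Complex.Gamma (2 / 3 : ℂ) ≠ 0 := Complex.Gamma_ne_zero_of_re_pos (by simp)
  have n3 : Complex.Gamma (1 / 2 : ℂ) ≠ 0 := Complex.Gamma_ne_zero_of_re_pos (by simp)
  simp only [mul_zero, zero_add, sub_zero, add_zero]
  exact mul_ne_zero (mul_ne_zero (mul_ne_zero (mul_ne_zero n2 n1) n1) n3) n2

/-- The derivative of the four-parameter identity at the origin. -/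
theorem hasSum_rhsTerm_mul_rhsLogDeriv (α β γ : ℂ) (hα : ‖α‖ ≤ 3) (hβ : ‖β‖ ≤ 3) (hγ : ‖γ‖ ≤ 3) :
    HasSum (fun n => rhsTerm 0 0 0 0 n * rhsLogDeriv α β γ n)
      (-(gammaTerm 0 0 0 0 * gammaLogDeriv α β γ)) := by
  have hmul {x t : ℂ} (hx : ‖x‖ ≤ 3) (ht : t ∈ Metric.ball (0 : ℂ) (1 / 3000)) :
      ‖x * t‖ < 1 / 1000 := by
    rw [mem_ball_zero_iff] at ht
    rw [norm_mul]
    nlinarith [norm_nonneg x, norm_nonneg t]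
  have hs (t : ℂ) (ht : t ∈ Metric.ball (0 : ℂ) (1 / 3000)) :
      Small (α * t) (β * t) (γ * t) 0 := ⟨hmul hα ht, hmul hβ ht, hmul hγ ht, by norm_num⟩
  have h0 : (0 : ℂ) ∈ Metric.ball (0 : ℂ) (1 / 3000) := by simp
  have hn := Metric.isOpen_ball.mem_nhds h0
  have h1 := hasSum_deriv_rhsTerm (a := fun t => α * t) (b := fun t => β * t)
    (c := fun t => γ * t) (d := fun _ => 0) Metric.isOpen_ball (by fun_prop) (by fun_prop)
    (by fun_prop) (by fun_prop) hs h0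
  have h2 := ((differentiableOn_tsum_rhsTerm (a := fun t => α * t) (b := fun t => β * t)
    (c := fun t => γ * t) (d := fun _ => 0) Metric.isOpen_ball (by fun_prop) (by fun_prop)
    (by fun_prop) (by fun_prop) hs).differentiableAt hn).hasDerivAt
  have h3 := (hasLogDerivAt_gammaTerm α β γ)
  rw [HasLogDerivAt] at h3
  obtain ⟨K, hK⟩ := exists_norm_tsum_lhsTerm_le
  have h4 : HasDerivAt (fun t => β * t * (γ * t) * (-6 * (α * t) + 6 * (β * t) + 3 * (γ * t) - 1) *
      ∑' k, lhsTerm (α * t) (β * t) (γ * t) 0 k) 0 0 := by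
    rw [hasDerivAt_iff_hasFDerivAt]
    -- The factor `bc` equals `βγt²` and the inner series is bounded near the origin, so the left
    -- side does not contribute to first order.
    have hO : (fun t => β * t * (γ * t) * (-6 * (α * t) + 6 * (β * t) + 3 * (γ * t) - 1) *
        ∑' k, lhsTerm (α * t) (β * t) (γ * t) 0 k) =O[𝓝 0] fun t => ‖t - 0‖ ^ 2 := by
      have o1 : (fun t => ∑' k, lhsTerm (α * t) (β * t) (γ * t) 0 k) =O[𝓝 0]
          fun _ => (1 : ℝ) := by
        refine Asymptotics.IsBigO.of_bound K ?_
        filter_upwards [hn] with t ht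
        simpa using hK _ _ _ _ (hs t ht)
      have o2 : (fun t => β * γ * (-6 * (α * t) + 6 * (β * t) + 3 * (γ * t) - 1)) =O[𝓝 0]
          fun _ => (1 : ℝ) := by
        have : Continuous (fun t => β * γ * (-6 * (α * t) + 6 * (β * t) + 3 * (γ * t) - 1)) := by
          fun_prop
        exact (this.tendsto 0).isBigO_one ℝ
      have o3 : (fun t : ℂ => t ^ 2) =O[𝓝 0] fun t => ‖t - 0‖ ^ 2 :=
        Asymptotics.IsBigO.of_bound 1 (Eventually.of_forall fun t => by simp)
      refine ((o3.mul (o2.mul o1)).congr (fun t => ?_) fun t => ?_)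
      · ring
      · ring
    have := hO.hasFDerivAt (𝕜 := ℂ) (by norm_num)
    simpa using this
  have h5 := h4.unique ((h3.add h2).congr_of_eventuallyEq (by
    filter_upwards [hn] with t ht
    simpa using tsum_lhsTerm (hs t ht)))
  have h6 := (eq_neg_of_add_eq_zero_right h5.symm)
  rw [h6] at h1
  simp only [mul_zero] at h1
  have h7 (n : ℕ) := (show HasDerivAt _ _ _ from hasLogDerivAt_rhsTerm α β γ n).deriv
  simp only [mul_zero] at h7
  simpa only [h7] using h1

/-! ### Special values and the three series -/

/-- Constancy of `triple` makes its logarithmic derivative at the origin vanish. -/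
theorem digamma_one_third_add_digamma_two_thirds :
    Complex.digamma (1 / 3) + Complex.digamma (2 / 3) =
      2 * Complex.digamma 1 - 3 * Real.log 3 := by
  have hx : HasLogDerivAt (fun t => Complex.exp (3 * Real.log 3 * t)) (3 * Real.log 3) 0 := by
    have h := ((hasDerivAt_id (0 : ℂ)).const_mul (3 * (Real.log 3 : ℂ))).cexp
    exact h.congr_deriv (by simp)
  have h1 : HasLogDerivAt triple (1 * Complex.digamma (1 / 3) + 1 * Complex.digamma (2 / 3) +
      1 * Complex.digamma 1 + 3 * Real.log 3 - 3 * Complex.digamma 1) 0 :=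
    ((((HasLogDerivAt.gamma (fun t => by ring) (by simp)).mul
      (.gamma (fun t => by ring) (by simp))).mul (.gamma (fun t => by ring) (by simp))).mul
      hx).div (.gamma (fun t => rfl) (by simp)) (by simp)
  have h2 : HasDerivAt triple 0 0 := by
    refine (hasDerivAt_const (0 : ℂ) (triple 0)).congr_of_eventuallyEq ?_
    have : ∀ᶠ t : ℂ in 𝓝 0, -(1 / 3) < t.re :=
      (isOpen_lt continuous_const Complex.continuous_re).mem_nhds (by simp)
    exact this.mono fun t ht => triple_eq ht
  have h3 := (mul_eq_zero.mp (HasDerivAt.unique h1 h2)).resolve_left triple_zero_ne_zero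
  linear_combination h3

theorem complex_log_four : Complex.log 4 = 2 * Complex.log 2 := by
  rw [show (4 : ℂ) = ((4 : ℝ) : ℂ) by norm_num, show (2 : ℂ) * Complex.log 2 =
    ((2 * Real.log 2 : ℝ) : ℂ) by push_cast; rw [Complex.ofReal_log (by norm_num)]; norm_num,
    ← Complex.ofReal_log (by norm_num), show (4 : ℝ) = 2 ^ 2 by norm_num, Real.log_pow]
  norm_num

/-- Here `2α - 2β - γ = 0`, so the digamma values at `1/3` and `2/3` occur only through their sum.
-/
theorem gammaLogDeriv_one_one_zero : gammaLogDeriv 1 1 0 = 3 * Real.log 3 := by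
  rw [gammaLogDeriv, complex_log_four, Complex.digamma_one_half]
  have h := digamma_one_third_add_digamma_two_thirds
  rw [Complex.digamma_one] at h ⊢
  linear_combination -h

/-- In this direction the digamma values at `1/3` and `2/3` cancel, and so does `log 2` against the
value at `1/2`. -/
theorem gammaLogDeriv_neg_two_neg_one_neg_three : gammaLogDeriv (-2) (-1) (-3) = 0 := by
  rw [gammaLogDeriv, complex_log_four, Complex.digamma_one_half, Complex.digamma_one]
  ring

theorem gammaTerm_zero : gammaTerm 0 0 0 0 = ((3 * √3 / (2 * Real.pi) : ℝ) : ℂ) := by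
  have n1 : Complex.Gamma (1 / 3 : ℂ) ≠ 0 := Complex.Gamma_ne_zero_of_re_pos (by simp)
  have n2 : Complex.Gamma (2 / 3 : ℂ) ≠ 0 := Complex.Gamma_ne_zero_of_re_pos (by simp)
  have n3 : Complex.Gamma (1 / 2 : ℂ) ≠ 0 := Complex.Gamma_ne_zero_of_re_pos (by simp)
  have r := Complex.Gamma_mul_Gamma_one_sub (1 / 3)
  have hpi : (Real.pi : ℂ) ≠ 0 := by exact_mod_cast Real.pi_ne_zero
  have hs : (√3 : ℂ) ≠ 0 := by
    exact_mod_cast (Real.sqrt_pos.mpr (by norm_num : (0 : ℝ) < 3)).ne'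
  rw [show (1 : ℂ) - 1 / 3 = 2 / 3 by norm_num,
    show (Real.pi : ℂ) * (1 / 3) = ((Real.pi / 3 : ℝ) : ℂ) by push_cast; ring,
    ← Complex.ofReal_sin, Real.sin_pi_div_three] at r
  have e : gammaTerm 0 0 0 0 = 3 / (Complex.Gamma (1 / 3) * Complex.Gamma (2 / 3)) := by
    unfold gammaTerm
    simp only [mul_zero, zero_add, sub_zero, add_zero, neg_zero, Complex.cpow_zero,
      Complex.Gamma_one, mul_one]
    field_simp
  rw [e, r]
  push_cast
  field_simp

theorem ofReal_poch (x : ℝ) (n : ℕ) : ((poch x n : ℝ) : ℂ) = poch (x : ℂ) n := by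
  rw [poch_eq_prod, poch_eq_prod]
  push_cast
  rfl

theorem poch_one_three_mul (n : ℕ) : poch (1 : ℂ) (3 * n) =
    27 ^ n * (poch (1 / 3) n * poch (2 / 3) n * poch 1 n) := by
  induction n with
  | zero => simp [poch]
  | succ n ih =>
    rw [show 3 * (n + 1) = 3 * n + 1 + 1 + 1 by ring]
    simp only [poch_succ, ih]
    push_cast
    ring

theorem poch_one_half_two_mul (n : ℕ) : poch (1 / 2 : ℂ) (2 * n) =
    4 ^ n * (poch (1 / 4) n * poch (3 / 4) n) := by
  induction n with
  | zero => simp [poch]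
  | succ n ih =>
    rw [show 2 * (n + 1) = 2 * n + 1 + 1 by ring]
    simp only [poch_succ, ih]
    push_cast
    ring

/-- The factor `3n + 2` of `P` and the linear factor `3n + 1` cancel the last two factors of
`(1)_{3n+2}`; the multiplication formulas for Pochhammer symbols do the rest. -/
theorem rhsTerm_zero (n : ℕ) :
    rhsTerm 0 0 0 0 n = ((-(coeff n * (quad n / (2 * n + 1))) / 9 : ℝ) : ℂ) := by
  have n1 : poch (1 : ℂ) n ≠ 0 := poch_ne_zero_of_re_pos (by simp) n
  have n3 : poch (1 / 2 : ℂ) n ≠ 0 := poch_ne_zero_of_re_pos (by simp) n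
  have n4 : poch (1 / 3 : ℂ) n ≠ 0 := poch_ne_zero_of_re_pos (by simp) n
  have n5 : poch (2 / 3 : ℂ) n ≠ 0 := poch_ne_zero_of_re_pos (by simp) n
  have hl : 2 * (n : ℂ) + 1 ≠ 0 := by exact_mod_cast (by omega : 2 * n + 1 ≠ 0)
  have h1 : 3 * (n : ℂ) + 1 ≠ 0 := by exact_mod_cast (by omega : 3 * n + 1 ≠ 0)
  have h2 : 3 * (n : ℂ) + 2 ≠ 0 := by exact_mod_cast (by omega : 3 * n + 2 ≠ 0)
  have hP : P 0 0 0 0 (n : ℂ) = (3 * n + 2) * (66 * (n : ℂ) ^ 2 + 37 * n + 4) := by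
    unfold P; ring
  rw [rhsTerm, hP, coeff, quad]
  simp only [mul_zero, zero_add, sub_zero, add_zero, neg_zero]
  rw [poch_succ 1 (3 * n + 1), poch_succ 1 (3 * n), poch_one_three_mul, poch_one_half_two_mul]
  push_cast [ofReal_poch]
  rw [show (0 - 2 * (n : ℂ) - 1) = -(2 * n + 1) by ring, show (1 : ℂ) + 3 * n = 3 * n + 1 by ring,
    show (1 : ℂ) + (3 * n + 1) = 3 * n + 2 by ring, div_pow,
    show (16 : ℂ) ^ n = 4 ^ n * 4 ^ n by rw [← mul_pow]; norm_num]
  have h27 : (27 : ℂ) ^ n ≠ 0 := pow_ne_zero _ (by norm_num)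
  have h4 : (4 : ℂ) ^ n ≠ 0 := pow_ne_zero _ (by norm_num)
  generalize (27 : ℂ) ^ n = y27 at *
  generalize (4 : ℂ) ^ n = y4 at *
  field_simp

theorem harm_succ (n : ℕ) : harm (n + 1) = harm n + ((n : ℝ) + 1)⁻¹ := by
  simp [harm, harmonic_succ]

theorem sum_inv_one_add (n : ℕ) : ∑ j ∈ Finset.range n, ((1 : ℂ) + j)⁻¹ = harm n := by
  induction n with
  | zero => simp [harm]
  | succ n ih =>
    rw [Finset.sum_range_succ, ih, harm_succ]
    push_cast
    rw [add_comm (1 : ℂ)]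

theorem sum_inv_half_add (n : ℕ) :
    ∑ j ∈ Finset.range n, ((1 / 2 : ℂ) + j)⁻¹ = 2 * harm (2 * n) - harm n := by
  induction n with
  | zero => simp [harm]
  | succ n ih =>
    have h1 : (n : ℂ) + 1 ≠ 0 := by exact_mod_cast Nat.succ_ne_zero n
    have h2 : 2 * (n : ℂ) + 1 ≠ 0 := by exact_mod_cast (by omega : 2 * n + 1 ≠ 0)
    rw [Finset.sum_range_succ, ih, show 2 * (n + 1) = 2 * n + 1 + 1 by ring, harm_succ, harm_succ,
      harm_succ]
    push_cast
    rw [show (1 / 2 : ℂ) + n = (2 * n + 1) / 2 by ring,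
      show 2 * (n : ℂ) + 1 + 1 = 2 * (n + 1) by ring]
    field_simp
    ring

/-- Only the two sums together are a combination of harmonic numbers; in both directions used they
enter with equal coefficients. -/
theorem sum_inv_third_add (n : ℕ) :
    ∑ j ∈ Finset.range n, ((1 / 3 : ℂ) + j)⁻¹ + ∑ j ∈ Finset.range n, ((2 / 3 : ℂ) + j)⁻¹ =
      3 * harm (3 * n) - harm n := by
  induction n with
  | zero => simp [harm]
  | succ n ih =>
    have h1 : (n : ℂ) + 1 ≠ 0 := by exact_mod_cast Nat.succ_ne_zero n
    have h2 : 3 * (n : ℂ) + 1 ≠ 0 := by exact_mod_cast (by omega : 3 * n + 1 ≠ 0)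
    have h3 : 3 * (n : ℂ) + 2 ≠ 0 := by exact_mod_cast (by omega : 3 * n + 2 ≠ 0)
    rw [Finset.sum_range_succ, Finset.sum_range_succ, add_add_add_comm, ih,
      show 3 * (n + 1) = 3 * n + 1 + 1 + 1 by ring, harm_succ, harm_succ, harm_succ, harm_succ]
    push_cast
    rw [show (1 / 3 : ℂ) + n = (3 * n + 1) / 3 by ring,
      show (2 / 3 : ℂ) + n = (3 * n + 2) / 3 by ring,
      show 3 * (n : ℂ) + 1 + 1 = 3 * n + 2 by ring,
      show 3 * (n : ℂ) + 2 + 1 = 3 * (n + 1) by ring]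
    field_simp
    ring

theorem quad_ne_zero (n : ℕ) : quad n ≠ 0 := by
  unfold quad
  positivity

theorem hasSum_coeff_mul_quad_div :
    HasSum (fun n : ℕ => coeff n * (quad n / (2 * (n : ℝ) + 1))) (27 * √3 / (2 * Real.pi)) := by
  have hz : Small 0 0 0 0 := by constructor <;> norm_num
  have h := (summable_rhsTerm hz).hasSum
  -- At the origin the left side of the four-parameter identity vanishes, so the series is minus the
  -- Gamma product.
  rw [eq_neg_of_add_eq_zero_right ((tsum_lhsTerm hz).symm.trans (by simp)), gammaTerm_zero] at h
  simp only [rhsTerm_zero] at h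
  simp only [← Complex.ofReal_neg] at h
  have h2 := (Complex.hasSum_ofReal.mp h).mul_left (-9)
  have e : 27 * √3 / (2 * Real.pi) = -9 * -(3 * √3 / (2 * Real.pi)) := by ring
  rw [e]
  refine Eq.mp (congrArg (HasSum · _) (funext fun n => ?_)) h2
  ring

theorem hasSum_coeff_mul_of_rhsLogDeriv {α β γ : ℂ} (hα : ‖α‖ ≤ 3) (hβ : ‖β‖ ≤ 3) (hγ : ‖γ‖ ≤ 3)
    {l : ℕ → ℝ} {m : ℝ} (hl : ∀ n, rhsLogDeriv α β γ n = l n) (hm : gammaLogDeriv α β γ = m) :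
    HasSum (fun n : ℕ => coeff n * (quad n / (2 * (n : ℝ) + 1)) * l n)
      (27 * √3 / (2 * Real.pi) * m) := by
  have h := hasSum_rhsTerm_mul_rhsLogDeriv α β γ hα hβ hγ
  rw [gammaTerm_zero, hm] at h
  simp only [rhsTerm_zero, hl] at h
  simp only [← Complex.ofReal_mul, ← Complex.ofReal_neg] at h
  have h2 := (Complex.hasSum_ofReal.mp h).mul_left (-9)
  have e : 27 * √3 / (2 * Real.pi) * m = -9 * -(3 * √3 / (2 * Real.pi) * m) := by ring
  rw [e]
  refine Eq.mp (congrArg (HasSum · _) (funext fun n => ?_)) h2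
  ring

theorem rhsLogDeriv_one_one_zero (n : ℕ) : rhsLogDeriv 1 1 0 n =
    ((-3 * harm n - harm (2 * n) + 2 * harm (4 * n) + (60 * n + 26) / quad n : ℝ) : ℂ) := by
  have h2 : 3 * (n : ℂ) + 2 ≠ 0 := by exact_mod_cast (by omega : 3 * n + 2 ≠ 0)
  have hq : 66 * (n : ℂ) ^ 2 + 37 * n + 4 ≠ 0 := by
    have := quad_ne_zero n
    unfold quad at this
    exact_mod_cast this
  have e : (180 * (n : ℂ) ^ 2 + 252 * n + 68) * 1 - (54 * n + 16) * 1 -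
      (198 * (n : ℂ) ^ 2 + 180 * n + 34) * 0 = (3 * n + 2) * (60 * n + 26) := by ring
  rw [rhsLogDeriv, sum_inv_one_add, sum_inv_half_add, sum_inv_half_add, e,
    mul_div_mul_left _ _ h2, ← mul_assoc, quad]
  push_cast
  norm_num
  ring

theorem rhsLogDeriv_neg_two_neg_one_neg_three (n : ℕ) : rhsLogDeriv (-2) (-1) (-3) n =
    ((3 * harm n - 2 * harm (2 * n) + 3 * harm (3 * n) -
      (108 * (n : ℝ) ^ 2 + 92 * n + 23) / (2 * n + 1) / quad n : ℝ) : ℂ) := by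
  have h1 : 3 * (n : ℂ) + 1 ≠ 0 := by exact_mod_cast (by omega : 3 * n + 1 ≠ 0)
  have h2 : 3 * (n : ℂ) + 2 ≠ 0 := by exact_mod_cast (by omega : 3 * n + 2 ≠ 0)
  have h3 : 2 * (n : ℂ) + 1 ≠ 0 := by exact_mod_cast (by omega : 2 * n + 1 ≠ 0)
  have hq : 66 * (n : ℂ) ^ 2 + 37 * n + 4 ≠ 0 := by
    have := quad_ne_zero n
    unfold quad at this
    exact_mod_cast this
  have hS := sum_inv_third_add n
  -- This is the rational part. The reciprocals of `3n + 1` and `3n + 2` come from rewriting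
  -- `H_{3n+2}` in terms of `H_{3n}`.
  have e : 3 / (3 * (n : ℂ) + 1) + (234 * (n : ℂ) ^ 2 + 90 * n - 18) /
      ((3 * n + 2) * (66 * (n : ℂ) ^ 2 + 37 * n + 4)) - 3 * ((3 * (n : ℂ) + 1)⁻¹ +
      (3 * (n : ℂ) + 2)⁻¹) - (-2) / (-(2 * (n : ℂ) + 1)) =
      -((108 * (n : ℂ) ^ 2 + 92 * n + 23) / (2 * n + 1) / (66 * (n : ℂ) ^ 2 + 37 * n + 4)) := by
    rw [neg_div_neg_eq]
    generalize hy : 66 * (n : ℂ) ^ 2 + 37 * n + 4 = y at *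
    generalize hx : 2 * (n : ℂ) + 1 = x at *
    field_simp
    rw [← hy, ← hx]
    ring
  rw [rhsLogDeriv, sum_inv_one_add, sum_inv_one_add, sum_inv_half_add, sum_inv_half_add,
    harm_succ, harm_succ, quad]
  push_cast
  rw [show 3 * (n : ℂ) + 1 + 1 = 3 * n + 2 by ring, show -2 * (n : ℂ) - 1 = -(2 * n + 1) by ring,
    show (6 * (-2) - 6 * (-1) - 3 * (-3) : ℂ) = 3 by norm_num,
    show (-4 * (-2) + 4 * (-1) + 2 * (-3) : ℂ) = -2 by norm_num,
    show (180 * (n : ℂ) ^ 2 + 252 * n + 68) * (-2) - (54 * n + 16) * (-1) -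
      (198 * (n : ℂ) ^ 2 + 180 * n + 34) * (-3) = 234 * (n : ℂ) ^ 2 + 90 * n - 18 by ring]
  linear_combination e + 2 * hS

theorem hasSum_coeff_mul_harm_log :
    HasSum (fun n : ℕ => coeff n *
        ((quad n * (-3 * harm n - harm (2 * n) + 2 * harm (4 * n)) + 60 * (n : ℝ) + 26) /
          (2 * (n : ℝ) + 1)))
      (81 * √3 * Real.log 3 / (2 * Real.pi)) := by
  have h := hasSum_coeff_mul_of_rhsLogDeriv (by simp) (by simp)
    (by simp) rhsLogDeriv_one_one_zero (m := 3 * Real.log 3)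
    (by rw [gammaLogDeriv_one_one_zero]; push_cast; rfl)
  convert h using 1
  · ext n
    have := quad_ne_zero n
    field_simp
    ring
  · ring

theorem hasSum_coeff_mul_harm_zero :
    HasSum (fun n : ℕ => coeff n *
        ((quad n * (3 * harm n - 2 * harm (2 * n) + 3 * harm (3 * n)) -
          (108 * (n : ℝ) ^ 2 + 92 * n + 23) / (2 * (n : ℝ) + 1)) / (2 * (n : ℝ) + 1))) 0 := by
  have h := hasSum_coeff_mul_of_rhsLogDeriv (by simp; norm_num) (by simp)
    (by simp) rhsLogDeriv_neg_two_neg_one_neg_three (m := 0)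
    (by rw [gammaLogDeriv_neg_two_neg_one_neg_three]; simp)
  convert h using 1
  · ext n
    have := quad_ne_zero n
    field_simp
  · ring

end

end SunSeries

theorem mainTheorem10 :
    HasSum (fun n : ℕ => SunSeries.coeff n * (SunSeries.quad n / (2 * (n : ℝ) + 1)))
      (27 * Real.sqrt 3 / (2 * Real.pi)) ∧
    HasSum (fun n : ℕ => SunSeries.coeff n *
        ((SunSeries.quad n *
            (-3 * SunSeries.harm n - SunSeries.harm (2 * n) + 2 * SunSeries.harm (4 * n))
          + 60 * (n : ℝ) + 26) / (2 * (n : ℝ) + 1)))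
      (81 * Real.sqrt 3 * Real.log 3 / (2 * Real.pi)) ∧
    HasSum (fun n : ℕ => SunSeries.coeff n *
        ((SunSeries.quad n *
            (3 * SunSeries.harm n - 2 * SunSeries.harm (2 * n) + 3 * SunSeries.harm (3 * n))
          - (108 * (n : ℝ) ^ 2 + 92 * n + 23) / (2 * (n : ℝ) + 1)) / (2 * (n : ℝ) + 1)))
      0 ∧
    ∃ ε : ℝ, 0 < ε ∧ ∀ a b c d : ℂ, ‖a‖ < ε → ‖b‖ < ε → ‖c‖ < ε → ‖d‖ < ε →
      (c ≠ 0 →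
        (∀ n : ℕ, Summable (fun k : ℕ => SunSeries.F a b c d n k)) ∧
        Filter.Tendsto (fun n : ℕ => ∑' k : ℕ, SunSeries.F a b c d n k) Filter.atTop
          (nhds (SunSeries.boundaryLimit a b c d))) ∧
      (Summable (fun k : ℕ => SunSeries.lhsTerm a b c d k) ∧
        Summable (fun n : ℕ => SunSeries.rhsTerm a b c d n) ∧
        b * c * (-6 * a + 6 * b + 3 * c - 1) * ∑' k : ℕ, SunSeries.lhsTerm a b c d k =
          SunSeries.gammaTerm a b c d + ∑' n : ℕ, SunSeries.rhsTerm a b c d n) := by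
  refine ⟨SunSeries.hasSum_coeff_mul_quad_div, SunSeries.hasSum_coeff_mul_harm_log,
    SunSeries.hasSum_coeff_mul_harm_zero, 1 / 1000, by norm_num, fun a b c d ha hb hc hd => ?_⟩
  have h : SunSeries.Small a b c d := ⟨ha, hb, hc, hd⟩
  exact ⟨fun h0 => ⟨SunSeries.summable_F h, SunSeries.tendsto_tsum_F h h0⟩,
    SunSeries.summable_lhsTerm h, SunSeries.summable_rhsTerm h, SunSeries.tsum_lhsTerm h⟩
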